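/- **Conventions.** Operads are symmetric coloured operads in sets. $\Omega$ is the category whose objects are the finite rooted trees $T$ and whose arrows $S\to T$ are the maps of coloured operads $\Omega(S)\to\Omega(T)$, where $\Omega(T)$ is the operad freely generated by the vertices of $T$, with the edges of $T$ as colours. A dendroidal set is a functor $X:\Omega^{op}\to Set$; write $X_T=X(T)$, and $\Omega[T]$ for the representable functor. The nerve $N_d$ from operads to dendroidal sets is $N_d(\mathcal P)_T=Hom(\Omega(T),\mathcal P)$, and $\tau_d$ is its left adjoint. For an inner edge $e$ of $T$, the inner horn $\Lambda^e[T]\subseteq\Omega[T]$ is the union of all faces of $T$ other than the inner face $\partial_e:T/e\to T$; $X$ is an inner Kan complex if $Hom(\Omega[T],X)\to Hom(\Lambda^e[T],X)$ is surjective for all $T$ and $e$. Let $\eta$ be the tree with one edge and no vertex, $C_n$ ($n\ge 0$) the corolla with one vertex, inputs $1,\dots,n$ and root $0$, and $C_n\circ_i C_m$ the tree obtained by grafting $C_m$ onto the input $i$ of $C_n$. For $x_1,\dots,x_n,x\in X_\eta$, let $X(x_1,\dots,x_n;x)$ be the set of all $f\in X_{C_n}$ whose restriction to the input $i$ is $x_i$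 for each $i$ and whose restriction to the root is $x$. For $f\in X_{C_n}$ and $g\in X_{C_m}$, an element $h\in X_{C_{n+m-1}}$ is called a $\circ_i$-composition of $f$ and $g$ if some $\gamma\in X_{C_n\circ_i C_m}$ restricts to $f$ at the lower vertex, to $g$ at the upper vertex, and has inner face $h$. For $f,g\in X_{C_n}$, write $f\sim g$ if $g$ is a $\circ_i$-composition of $f$ and a degenerate element of $X_{C_1}$ for some input $i$, or a composition of a degenerate element of $X_{C_1}$ (at the lower vertex) and $f$ (at the upper vertex). Let $Ho(X)$ be the collection with colours $X_\eta$ and operations $Ho(X)(x_1,\dots,x_n;x)=X(x_1,\dots,x_n;x)/\!\sim$ (the quotient by the equivalence relation generated by $\sim$). **Proposition 6.10.** Let $X$ be an inner Kan complex. There is a unique operad structure on the collection $Ho(X)$ for which the quotient maps $f\mapsto[f]$ extend to a map of dendroidal sets $q:X\to N_d(Ho(X))$ (the identity on $X_\eta$, and sending $f\in X_{C_n}$ to the map $\Omega(C_n)\to Ho(X)$ with value $[f]$ at the vertex). Its units are the classes of the degenerate elements of $X_{C_1}$, its symmetric group actions are $\sigma^*[f]=[\sigma^*f]$, and $[f]\circ_i[g]=[h]$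 for each $\circ_i$-composition $h$ of $f$ and $g$. The extension $q$ is unique, and the natural map $\tau_d(X)\to Ho(X)$ that corresponds to $q$ under the adjunction between $\tau_d$ and $N_d$ is an isomorphism of coloured operads. -/

import Mathlib

open CategoryTheory Opposite

universe u v w

namespace Dendroidal

/-! ### Symmetric coloured operads in sets -/

/-- `Shuffle n m k i` is the set of ways to enumerate (by `1, …, k`) the inputs of a partial
composition `f ∘ᵢ g`, where `f` has `n` inputs and `g` has `m` inputs: the inputs of `f ∘ᵢ g` are
the inputs of `f` other than `i`, together with the inputs of `g`. -/
abbrev Shuffle (n m k : ℕ) (i : Fin n) : Type :=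
  Fin k ≃ {x : Fin n ⊕ Fin m // x ≠ Sum.inl i}

/-- The interchange of the last two summands. -/
def swapLast {A B D : Type} : (A ⊕ B) ⊕ D → (A ⊕ D) ⊕ B :=
  Sum.elim (Sum.map Sum.inl id) (fun t => Sum.inl (Sum.inr t))

/-- The structure of a symmetric coloured operad (in sets) on a collection `Op`, where `C` is the
set of colours and `Op n c d` is the set of operations with inputs of colours `c 1, …, c n` and
output of colour `d`: units, actions of the symmetric groups, and partial compositions `f ∘ᵢ g`.
The inputs of a composition `f ∘ᵢ g` may be listed in any order `φ`; passing from one order to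
another one is the action of a permutation (`act_circ`), so that this is the same as giving
`f ∘ᵢ g` for the order in which the inputs of `g` take the place of the input `i` of `f`.
The composition takes arguments whose colours are only propositionally equal
to the required ones. -/
structure OperadStr (C : Type u) (Op : (n : ℕ) → (Fin n → C) → C → Type u) where
  /-- The unit of a colour. -/
  one (c : C) : Op 1 (fun _ => c) c
  /-- The symmetric group actions. -/
  act {n : ℕ} {c : Fin n → C} {d : C} (σ : Equiv.Perm (Fin n)) (f : Op n c d) : Op n (c ∘ σ) d
  /-- The partial composition `f ∘ᵢ g`, with its inputs enumerated by `φ`. -/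
  circ {n m k : ℕ} {c : Fin n → C} {d : C} {b : Fin m → C} {e : C} {a : Fin k → C}
    (i : Fin n) (φ : Shuffle n m k i) (he : c i = e) (ha : ∀ l, a l = Sum.elim c b (φ l).1)
    (f : Op n c d) (g : Op m b e) : Op k a d
  act_one {n : ℕ} {c : Fin n → C} {d : C} (f : Op n c d) : act 1 f = f
  act_mul {n : ℕ} {c : Fin n → C} {d : C} (σ τ : Equiv.Perm (Fin n)) (f : Op n c d) :
    act τ (act σ f) = act (σ * τ) f
  act_circ {n m k : ℕ} {c : Fin n → C} {d : C} {b : Fin m → C} {e : C} {a : Fin k → C}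
    (σ : Equiv.Perm (Fin k)) (i : Fin n) (φ : Shuffle n m k i) (he : c i = e)
    (ha : ∀ l, a l = Sum.elim c b (φ l).1) (f : Op n c d) (g : Op m b e) :
    act σ (circ i φ he ha f g) = circ (a := a ∘ σ) i (σ.trans φ) he (fun l => ha (σ l)) f g
  circ_act_left {n m k : ℕ} {c : Fin n → C} {d : C} {b : Fin m → C} {e : C} {a : Fin k → C}
    (σ : Equiv.Perm (Fin n)) (i : Fin n) (φ : Shuffle n m k i) (φ' : Shuffle n m k (σ i))
    (hφ : ∀ l, (φ' l).1 = Sum.map σ id (φ l).1) (he : c (σ i) = e)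
    (ha : ∀ l, a l = Sum.elim (c ∘ σ) b (φ l).1) (ha' : ∀ l, a l = Sum.elim c b (φ' l).1)
    (f : Op n c d) (g : Op m b e) :
    circ i φ he ha (act σ f) g = circ (σ i) φ' he ha' f g
  circ_act_right {n m k : ℕ} {c : Fin n → C} {d : C} {b : Fin m → C} {e : C} {a : Fin k → C}
    (τ : Equiv.Perm (Fin m)) (i : Fin n) (φ φ' : Shuffle n m k i)
    (hφ : ∀ l, (φ' l).1 = Sum.map id τ (φ l).1) (he : c i = e)
    (ha : ∀ l, a l = Sum.elim c (b ∘ τ) (φ l).1) (ha' : ∀ l, a l = Sum.elim c b (φ' l).1)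
    (f : Op n c d) (g : Op m b e) :
    circ i φ he ha f (act τ g) = circ i φ' he ha' f g
  /-- The left unit law `1 ∘ f = f`. -/
  one_circ {n : ℕ} {c : Fin n → C} {d : C} (φ : Shuffle 1 n n 0)
    (hφ : ∀ l, (φ l).1 = Sum.inr l) (ha : ∀ l, c l = Sum.elim (fun _ => d) c (φ l).1)
    (f : Op n c d) : circ 0 φ rfl ha (one d) f = f
  /-- The right unit law `f ∘ᵢ 1 = f`. -/
  circ_one {n : ℕ} {c : Fin n → C} {d : C} (i : Fin n) (φ : Shuffle n 1 n i)
    (hφ : ∀ l, (φ l).1 = if l = i then Sum.inr 0 else Sum.inl l)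
    (ha : ∀ l, c l = Sum.elim c (fun _ => c i) (φ l).1)
    (f : Op n c d) : circ i φ rfl ha f (one (c i)) = f
  /-- Sequential associativity `(f ∘ᵢ g) ∘ⱼ h = f ∘ᵢ (g ∘ⱼ h)`, `j` an input of `g`. -/
  circ_seq {n m p r s k : ℕ} {c : Fin n → C} {d : C} {b : Fin m → C} {e : C} {a : Fin p → C}
    {e' : C} {x : Fin r → C} {y : Fin s → C} {z : Fin k → C} (i : Fin n) (j : Fin m) (j' : Fin r)
    (φ : Shuffle n m r i) (ψ : Shuffle r p k j') (ψ' : Shuffle m p s j) (φ' : Shuffle n s k i)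
    (hj : (φ j').1 = Sum.inr j)
    (hk : ∀ l, Equiv.sumAssoc _ _ _ (Sum.map (fun t => (φ t).1) id (ψ l).1) =
      Sum.map id (fun t => (ψ' t).1) (φ' l).1)
    (he : c i = e) (hx : ∀ l, x l = Sum.elim c b (φ l).1)
    (he₁ : x j' = e') (hz : ∀ l, z l = Sum.elim x a (ψ l).1)
    (he₂ : b j = e') (hy : ∀ l, y l = Sum.elim b a (ψ' l).1)
    (hz' : ∀ l, z l = Sum.elim c y (φ' l).1)
    (f : Op n c d) (g : Op m b e) (h : Op p a e') :
    circ j' ψ he₁ hz (circ i φ he hx f g) h = circ i φ' he hz' f (circ j ψ' he₂ hy g h)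
  /-- Parallel associativity `(f ∘ᵢ g) ∘ⱼ h = (f ∘ⱼ h) ∘ᵢ g`, `i ≠ j` inputs of `f`. -/
  circ_par {n m p r s k : ℕ} {c : Fin n → C} {d : C} {b : Fin m → C} {e : C} {a : Fin p → C}
    {e' : C} {x : Fin r → C} {y : Fin s → C} {z : Fin k → C} (i j : Fin n) (j' : Fin r)
    (i' : Fin s) (φ : Shuffle n m r i) (ψ : Shuffle r p k j') (ψ' : Shuffle n p s j)
    (φ' : Shuffle s m k i') (hj : (φ j').1 = Sum.inl j) (hi : (ψ' i').1 = Sum.inl i)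
    (hk : ∀ l, swapLast (Sum.map (fun t => (φ t).1) id (ψ l).1) =
      Sum.map (fun t => (ψ' t).1) id (φ' l).1)
    (he : c i = e) (hx : ∀ l, x l = Sum.elim c b (φ l).1)
    (he₁ : x j' = e') (hz : ∀ l, z l = Sum.elim x a (ψ l).1)
    (he₂ : c j = e') (hy : ∀ l, y l = Sum.elim c a (ψ' l).1)
    (he₃ : y i' = e) (hz' : ∀ l, z l = Sum.elim y b (φ' l).1)
    (f : Op n c d) (g : Op m b e) (h : Op p a e') :
    circ j' ψ he₁ hz (circ i φ he hx f g) h = circ i' φ' he₃ hz' (circ j ψ' he₂ hy f h) g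

/-- A symmetric coloured operad in sets. -/
structure Operad : Type (u + 1) where
  /-- The set of colours. -/
  Colour : Type u
  /-- The sets of operations. -/
  Op : (n : ℕ) → (Fin n → Colour) → Colour → Type u
  /-- Units, symmetric group actions and compositions. -/
  str : OperadStr Colour Op

/-- Maps of coloured operads. -/
structure OperadHom (P : Operad.{u}) (Q : Operad.{v}) : Type (max u v) where
  /-- The map on colours. -/
  colour : P.Colour → Q.Colour
  /-- The map on operations. -/
  op {n : ℕ} {c : Fin n → P.Colour} {d : P.Colour} (f : P.Op n c d) :
    Q.Op n (colour ∘ c) (colour d)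
  map_one (c : P.Colour) : op (P.str.one c) = Q.str.one (colour c)
  map_act {n : ℕ} {c : Fin n → P.Colour} {d : P.Colour} (σ : Equiv.Perm (Fin n))
    (f : P.Op n c d) : op (P.str.act σ f) = Q.str.act σ (op f)
  map_circ {n m k : ℕ} {c : Fin n → P.Colour} {d : P.Colour} {b : Fin m → P.Colour}
    {e : P.Colour} {a : Fin k → P.Colour} (i : Fin n) (φ : Shuffle n m k i) (he : c i = e)
    (ha : ∀ l, a l = Sum.elim c b (φ l).1) (ha' : ∀ l, (colour ∘ a) l =
      Sum.elim (colour ∘ c) (colour ∘ b) (φ l).1) (f : P.Op n c d) (g : P.Op m b e) :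
    op (P.str.circ i φ he ha f g) =
      Q.str.circ (c := colour ∘ c) i φ (congrArg colour he) ha' (op f) (op g)

/-- The identity map of an operad. -/
def OperadHom.id (P : Operad.{u}) : OperadHom P P where
  colour c := c
  op f := f
  map_one _ := rfl
  map_act _ _ := rfl
  map_circ _ _ _ _ _ _ _ := rfl

lemma elim_comp_aux {A B D E : Type*} {K : Type*} {a : K → D} {c : A → D} {b : B → D}
    (F : D → E) (φ : K → A ⊕ B) (ha : ∀ l, a l = Sum.elim c b (φ l)) (l : K) :
    (F ∘ a) l = Sum.elim (F ∘ c) (F ∘ b) (φ l) := by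
  simp only [Function.comp_apply, ha]
  cases φ l <;> rfl

/-- Composition of maps of operads. -/
def OperadHom.comp {P : Operad.{u}} {Q : Operad.{v}} {R : Operad.{w}} (F : OperadHom P Q)
    (G : OperadHom Q R) : OperadHom P R where
  colour c := G.colour (F.colour c)
  op f := G.op (F.op f)
  map_one c := by rw [F.map_one, G.map_one]
  map_act σ f := by rw [F.map_act, G.map_act]
  map_circ i φ he ha ha' f g := by
    rw [F.map_circ i φ he ha (elim_comp_aux F.colour _ ha) f g]
    exact G.map_circ _ _ _ _ ha' _ _

/-- The category of coloured operads in sets. -/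
instance : Category.{u} Operad.{u} where
  Hom P Q := OperadHom P Q
  id P := OperadHom.id P
  comp F G := F.comp G

/-! ### Trees -/

/-- A finite rooted tree, given by the finite set of its edges, with the partial order in which
`a ≤ b` if the path from `b` to the root passes through `a`, and by the set of its leaves (the
input edges). Each edge that is not a leaf has exactly one vertex on top of it, of which it
is the output, and each vertex has exactly one output; so vertices are the same as
edges that are not leaves. The inputs of the vertex with output `v` are the edges that
cover `v`. A maximal edge which is not a leaf carries a vertex of valence zero. -/
structure DTree : Type 1 where
  /-- The set of edges. -/
  Edge : Type
  [order : PartialOrder Edge]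
  [finite : Finite Edge]
  /-- The root (output edge). -/
  root : Edge
  /-- The set of leaves (input edges). -/
  leaves : Set Edge
  root_le : ∀ e : Edge, root ≤ e
  linear : ∀ a b e : Edge, a ≤ e → b ≤ e → a ≤ b ∨ b ≤ a
  leaf_max : ∀ l ∈ leaves, ∀ e : Edge, l ≤ e → e = l

attribute [instance] DTree.order DTree.finite

namespace DTree

/-- An inner edge is an edge that is neither the root nor a leaf. -/
def IsInner (T : DTree) (e : T.Edge) : Prop := e ≠ T.root ∧ e ∉ T.leaves

/-- `T.IsOp c d` says that there is a subtree of `T` with root `d` and with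
leaves `c 1, …, c n` (without repetition). Explicitly: the `c j` lie above `d` and are
pairwise incomparable, and each edge above `d` that is not above some `c j` has a vertex on top of
it (these are the vertices of the subtree). -/
structure IsOp (T : DTree) {n : ℕ} (c : Fin n → T.Edge) (d : T.Edge) : Prop where
  le : ∀ j, d ≤ c j
  eq_of_le : ∀ j j', c j ≤ c j' → j = j'
  not_leaf : ∀ x, d ≤ x → (∀ j, ¬ c j ≤ x) → x ∉ T.leaves

variable {T : DTree}

lemma isOp_one (T : DTree) (e : T.Edge) : T.IsOp (fun _ : Fin 1 => e) e where
  le _ := le_rfl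
  eq_of_le _ _ _ := Subsingleton.elim _ _
  not_leaf _ hx h := absurd hx (h 0)

lemma IsOp.act {n : ℕ} {c : Fin n → T.Edge} {d : T.Edge} (h : T.IsOp c d)
    (σ : Equiv.Perm (Fin n)) : T.IsOp (c ∘ σ) d where
  le j := h.le _
  eq_of_le j j' hj := σ.injective (h.eq_of_le _ _ hj)
  not_leaf x hx hj := h.not_leaf x hx fun j => by simpa using hj (σ.symm j)

lemma IsOp.circ {n m k : ℕ} {c : Fin n → T.Edge} {d : T.Edge} {b : Fin m → T.Edge} {e : T.Edge}
    {a : Fin k → T.Edge} (i : Fin n) (φ : Shuffle n m k i) (he : c i = e)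
    (ha : ∀ l, a l = Sum.elim c b (φ l).1) (hf : T.IsOp c d) (hg : T.IsOp b e) : T.IsOp a d where
  le l := by
    rw [ha]
    rcases (φ l).1 with j | t
    · exact hf.le j
    · exact (hf.le i).trans (he ▸ hg.le t)
  eq_of_le l l' hl := by
    rw [ha, ha] at hl
    apply φ.injective
    apply Subtype.ext
    have h1 := (φ l).2
    have h2 := (φ l').2
    revert hl h1 h2
    rcases (φ l).1 with j | t <;> rcases (φ l').1 with j' | t' <;> intro hl h1 h2 <;>
      simp only [Sum.elim_inl, Sum.elim_inr] at hl
    · rw [hf.eq_of_le _ _ hl]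
    · rcases T.linear _ _ _ hl (he ▸ hg.le t' : c i ≤ b t') with h | h
      · exact absurd (congrArg Sum.inl (hf.eq_of_le _ _ h)) h1
      · exact absurd (congrArg Sum.inl (hf.eq_of_le _ _ h).symm) h1
    · exact absurd (congrArg Sum.inl
        (hf.eq_of_le _ _ ((he ▸ hg.le t : c i ≤ b t).trans hl)).symm) h2
    · rw [hg.eq_of_le _ _ hl]
  not_leaf x hx hl := by
    have key : ∀ y : Fin n ⊕ Fin m, y ≠ Sum.inl i → ¬ Sum.elim c b y ≤ x := fun y hy => by
      have := hl (φ.symm ⟨y, hy⟩)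
      rwa [ha, Equiv.apply_symm_apply] at this
    by_cases hi : c i ≤ x
    · exact hg.not_leaf x (he ▸ hi) fun t => key (Sum.inr t) (by simp)
    · refine hf.not_leaf x hx fun j => ?_
      by_cases hj : j = i
      · rwa [hj]
      · exact key (Sum.inl j) (by simpa using hj)

/-- The coloured operad `Ω(T)` of a tree `T`. Its colours are the edges of `T`. It is the free
operad generated by the vertices of `T`: for each subtree of `T` and each enumeration
`c 1, …, c n` of the leaves of this subtree there is exactly one operation, the composition of the
vertices in the subtree, and there are no other operations. -/
def operad (T : DTree) : Operad.{0} where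
  Colour := T.Edge
  Op _ c d := PLift (T.IsOp c d)
  str :=
    { one := fun e => ⟨T.isOp_one e⟩
      act := fun σ f => ⟨f.down.act σ⟩
      circ := fun i φ he ha f g => ⟨IsOp.circ i φ he ha f.down g.down⟩
      act_one := fun _ => rfl
      act_mul := fun _ _ _ => rfl
      act_circ := fun _ _ _ _ _ _ _ => rfl
      circ_act_left := fun _ _ _ _ _ _ _ _ _ _ => rfl
      circ_act_right := fun _ _ _ _ _ _ _ _ _ _ => rfl
      one_circ := fun _ _ _ _ => rfl
      circ_one := fun _ _ _ _ _ => rfl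
      circ_seq := by intros; rfl
      circ_par := by intros; rfl }

/-- The category `Ω`: its objects are the trees, its arrows `S ⟶ T` are the maps of coloured
operads `Ω(S) ⟶ Ω(T)`. -/
instance : Category.{0} DTree where
  Hom S T := OperadHom S.operad T.operad
  id T := OperadHom.id T.operad
  comp F G := F.comp G

/-- The map on edges given by an arrow in `Ω`. -/
def edge {S T : DTree} (f : S ⟶ T) : S.Edge → T.Edge := OperadHom.colour f

lemma isOp_edge {S T : DTree} (f : S ⟶ T) {n : ℕ} {c : Fin n → S.Edge} {d : S.Edge}
    (h : S.IsOp c d) : T.IsOp (edge f ∘ c) (edge f d) :=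
  (OperadHom.op f (n := n) (c := c) (d := d) ⟨h⟩).down

@[ext]
lemma hom_ext {S T : DTree} {f g : S ⟶ T} (h : ∀ x, edge f x = edge g x) : f = g := by
  obtain ⟨f, fop, _, _, _⟩ := f
  obtain ⟨g, gop, _, _, _⟩ := g
  obtain rfl : f = g := funext h
  have : @fop = @gop := by
    funext n c d x
    exact Subsingleton.elim (α := PLift _) _ _
  subst this
  rfl

@[simp] lemma edge_comp {R S T : DTree} (f : R ⟶ S) (g : S ⟶ T) (x : R.Edge) :
    edge (f ≫ g) x = edge g (edge f x) := rfl

@[simp] lemma edge_id {T : DTree} (x : T.Edge) : edge (𝟙 T) x = x := rfl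

/-- An arrow in `Ω` from a map of edges that sends operations to operations. -/
def homMk {S T : DTree} (F : S.Edge → T.Edge)
    (h : ∀ (n : ℕ) (c : Fin n → S.Edge) (d : S.Edge), S.IsOp c d → T.IsOp (F ∘ c) (F d)) :
    S ⟶ T :=
  OperadHom.mk (P := S.operad) (Q := T.operad) F (fun f => ⟨h _ _ _ f.down⟩)
    (fun _ => rfl) (fun _ _ => rfl) (fun _ _ _ _ _ _ _ => rfl)

@[simp] lemma edge_homMk {S T : DTree} (F : S.Edge → T.Edge) (h) (x : S.Edge) :
    edge (homMk (T := T) F h) x = F x := rfl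

/-! ### The unit tree and the corollas -/

/-- The tree `η` with one edge and no vertices. -/
def eta : DTree where
  Edge := Unit
  root := ()
  leaves := Set.univ
  root_le _ := le_rfl
  linear _ _ _ _ _ := Or.inl le_rfl
  leaf_max _ _ _ _ := rfl

/-- The arrow `η ⟶ T` that sends the edge of `η` to the edge `e`. -/
def ofEdge (T : DTree) (e : T.Edge) : eta ⟶ T :=
  homMk (fun _ => e) fun n c d h =>
    { le := fun _ => le_rfl
      eq_of_le := fun j j' _ => h.eq_of_le j j' le_rfl
      not_leaf := fun x hx hj => by
        by_contra _
        exact h.not_leaf () le_rfl (fun j _ => hj j hx) trivial }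

@[simp] lemma edge_ofEdge (T : DTree) (e : T.Edge) (x) : edge (T.ofEdge e) x = e := rfl

@[simp] lemma ofEdge_comp {S T : DTree} (e : S.Edge) (f : S ⟶ T) :
    S.ofEdge e ≫ f = T.ofEdge (edge f e) := rfl

/-- The edges of the corolla with `n` inputs. -/
inductive CorollaEdge (n : ℕ) : Type
  | root : CorollaEdge n
  | leaf (j : Fin n) : CorollaEdge n

instance (n : ℕ) : PartialOrder (CorollaEdge n) where
  le a b := a = .root ∨ a = b
  le_refl _ := Or.inr rfl
  le_trans a b c := by rintro (rfl | rfl) (h | h) <;> simp_all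
  le_antisymm a b := by rintro (rfl | rfl) (h | h) <;> simp_all

lemma CorollaEdge.le_def {n : ℕ} (a b : CorollaEdge n) : a ≤ b ↔ a = .root ∨ a = b := Iff.rfl

instance (n : ℕ) : Finite (CorollaEdge n) :=
  Finite.of_injective (β := Option (Fin n))
    (fun x => match x with
      | .root => none
      | .leaf j => some j)
    (by rintro (_ | j) (_ | j') h <;> simp_all)

/-- The corolla `Cₙ` with one vertex and with `n` inputs. -/
def corolla (n : ℕ) : DTree where
  Edge := CorollaEdge n
  root := .root
  leaves := {x | x ≠ .root}
  root_le _ := Or.inl rfl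
  linear a b e := by rintro (rfl | rfl) (rfl | rfl) <;> simp [CorollaEdge.le_def]
  leaf_max l hl e := by rintro (h | h) <;> simp_all

/-- The arrow `Cₙ ⟶ T` given by an operation of `Ω(T)` with `n` inputs. -/
def ofOp (T : DTree) {n : ℕ} {c : Fin n → T.Edge} {d : T.Edge} (h : T.IsOp c d) :
    corolla n ⟶ T :=
  homMk (S := corolla n)
    (fun x => match x with
      | CorollaEdge.root => d
      | CorollaEdge.leaf j => c j) fun p c' d' h' =>
    { le := fun j => by
        have := h'.le j
        rcases this with h1 | h1
        · change d' = _ at h1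
          subst h1
          rcases hc : c' j with _ | t
          · simp [hc]
          · simpa [hc] using h.le t
        · simp [← h1]
      eq_of_le := fun j j' hj => by
        have key : c' j ≤ c' j' ∨ c' j' ≤ c' j := by
          revert hj
          simp only [Function.comp_apply]
          rcases c' j with _ | t <;> rcases c' j' with _ | t' <;> intro hj
          · exact Or.inl le_rfl
          · exact Or.inl (Or.inl rfl)
          · exact Or.inr (Or.inl rfl)
          · rw [h.eq_of_le t t' hj]
            exact Or.inl le_rfl
        rcases key with h1 | h1
        · exact h'.eq_of_le _ _ h1
        · exact (h'.eq_of_le _ _ h1).symm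
      not_leaf := fun x hx hj => by
        have leaf_case : ∀ t : Fin n, d' ≤ CorollaEdge.leaf t → ¬ c t ≤ x := fun t ht hct => by
          refine h'.not_leaf (CorollaEdge.leaf t) ht (fun j hjt => hj j ?_)
            (show CorollaEdge.leaf t ≠ CorollaEdge.root from fun h => by cases h)
          rcases hjt with h1 | h1
          · simp only [Function.comp_apply]
            change c' j = _ at h1
            rw [h1]
            exact (h.le t).trans hct
          · simp only [Function.comp_apply, h1]
            exact hct
        rcases d' with _ | t
        · exact h.not_leaf x hx fun t => leaf_case t (Or.inl rfl)
        · exact absurd hx (leaf_case t le_rfl) }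

@[simp] lemma edge_ofOp_root (T : DTree) {n : ℕ} {c : Fin n → T.Edge} {d : T.Edge}
    (h : T.IsOp c d) : edge (T.ofOp h) (CorollaEdge.root : CorollaEdge n) = d := rfl

@[simp] lemma edge_ofOp_leaf (T : DTree) {n : ℕ} {c : Fin n → T.Edge} {d : T.Edge}
    (h : T.IsOp c d) (j : Fin n) : edge (T.ofOp h) (CorollaEdge.leaf j : CorollaEdge n) = c j := rfl

lemma ofOp_comp {S T : DTree} {n : ℕ} {c : Fin n → S.Edge} {d : S.Edge} (h : S.IsOp c d)
    (f : S ⟶ T) : S.ofOp h ≫ f = T.ofOp (isOp_edge f h) := by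
  ext x
  rcases x with _ | j <;> rfl

/-- The vertex of the corolla, as an operation. -/
lemma isOp_corolla (n : ℕ) :
    (corolla n).IsOp (fun j : Fin n => CorollaEdge.leaf j) CorollaEdge.root where
  le _ := Or.inl rfl
  eq_of_le j j' := by rintro (h | h) <;> simp_all
  not_leaf x _ hx hx' := by
    rcases x with _ | j
    · exact hx' rfl
    · exact hx j le_rfl

/-! ### Trees with two vertices -/

/-- The edges of the tree `Cₙ ∘ᵢ Cₘ`. -/
inductive GraftEdge (n m : ℕ) (i : Fin n) : Type
  | root : GraftEdge n m i
  | low (j : Fin n) : GraftEdge n m i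
  | high (t : Fin m) : GraftEdge n m i

namespace GraftEdge

variable {n m : ℕ} {i : Fin n}

instance : PartialOrder (GraftEdge n m i) where
  le a b := a = .root ∨ a = b ∨ (a = .low i ∧ ∃ t, b = .high t)
  le_refl _ := Or.inr (Or.inl rfl)
  le_trans a b c := by
    rintro (rfl | rfl | ⟨rfl, t, rfl⟩) (h | h | ⟨h, t', rfl⟩) <;> first | (simp_all; done) | (subst h; simp)
  le_antisymm a b := by
    rintro (rfl | rfl | ⟨rfl, t, rfl⟩) (h | h | ⟨h, t', h'⟩) <;> simp_all

lemma le_def (a b : GraftEdge n m i) :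
    a ≤ b ↔ a = .root ∨ a = b ∨ (a = .low i ∧ ∃ t, b = .high t) := Iff.rfl

instance : Finite (GraftEdge n m i) :=
  Finite.of_injective (β := Option (Fin n ⊕ Fin m))
    (fun x => match x with
      | .root => none
      | .low j => some (Sum.inl j)
      | .high t => some (Sum.inr t))
    (by rintro (_ | j | t) (_ | j' | t') h <;> simp_all)

end GraftEdge

/-- The tree `Cₙ ∘ᵢ Cₘ` with two vertices, obtained by grafting the corolla `Cₘ` onto the input
`i` of the corolla `Cₙ`. -/
def graft (n m : ℕ) (i : Fin n) : DTree where
  Edge := GraftEdge n m i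
  root := .root
  leaves := {x | x ≠ .root ∧ x ≠ .low i}
  root_le _ := Or.inl rfl
  linear a b e := by
    rintro (rfl | rfl | ⟨rfl, t, rfl⟩) (rfl | rfl | ⟨rfl, t', h⟩) <;>
      simp_all [GraftEdge.le_def]
  leaf_max l hl e := by rintro (h | h | h) <;> simp_all

/-- The lower vertex of `Cₙ ∘ᵢ Cₘ`, as an operation. -/
lemma isOp_low (n m : ℕ) (i : Fin n) :
    (graft n m i).IsOp (fun j : Fin n => GraftEdge.low j) GraftEdge.root where
  le _ := Or.inl rfl
  eq_of_le j j' := by rintro (h | h | ⟨_, _, h⟩) <;> simp_all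
  not_leaf x _ hx hx' := by
    rcases x with _ | j | t
    · exact hx'.1 rfl
    · exact hx j le_rfl
    · exact hx i (Or.inr (Or.inr ⟨rfl, t, rfl⟩))

/-- The upper vertex of `Cₙ ∘ᵢ Cₘ`, as an operation. -/
lemma isOp_high (n m : ℕ) (i : Fin n) :
    (graft n m i).IsOp (fun t : Fin m => GraftEdge.high t) (GraftEdge.low i) where
  le t := Or.inr (Or.inr ⟨rfl, t, rfl⟩)
  eq_of_le t t' := by rintro (h | h | ⟨h, _⟩) <;> simp_all
  not_leaf x h hx hx' := by
    rcases x with _ | j | t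
    · exact hx'.1 rfl
    · rcases h with h | h | ⟨_, _, h⟩
      · cases h
      · exact hx'.2 h.symm
      · cases h
    · exact hx t le_rfl

/-- The edge of `Cₙ ∘ᵢ Cₘ` given by an input of one of the two vertices. -/
def graftInput {n m : ℕ} {i : Fin n} : Fin n ⊕ Fin m → GraftEdge n m i :=
  Sum.elim GraftEdge.low GraftEdge.high

/-- The composition of both vertices of `Cₙ ∘ᵢ Cₘ`, with the leaves enumerated by `φ`. -/
lemma isOp_graft {n m k : ℕ} {i : Fin n} (φ : Shuffle n m k i) :
    (graft n m i).IsOp (fun l : Fin k => graftInput (φ l).1) GraftEdge.root :=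
  IsOp.circ (T := graft n m i) (b := fun t : Fin m => GraftEdge.high t) i φ rfl
    (fun _ => rfl) (isOp_low n m i) (isOp_high n m i)

/-! ### Faces -/

/-- The tree on a set `s` of edges of `T` with least element `r`, and with leaves `L`. -/
def sub (T : DTree) (s : Set T.Edge) (r : s) (hr : ∀ x : s, r ≤ x) (L : Set T.Edge)
    (hL : ∀ l ∈ L, ∀ x ∈ s, l ≤ x → x = l) : DTree where
  Edge := s
  root := r
  leaves := {x | x.1 ∈ L}
  root_le := hr
  linear a b e := T.linear a.1 b.1 e.1
  leaf_max l hl e h := Subtype.ext (hL l.1 hl e.1 e.2 h)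

/-- A sufficient condition for `T.sub s r hr L hL` to map to `T` in `Ω`. -/
def subHom (T : DTree) (s : Set T.Edge) (r : s) (hr : ∀ x : s, r ≤ x) (L : Set T.Edge)
    (hL : ∀ l ∈ L, ∀ x ∈ s, l ≤ x → x = l)
    (h : ∀ x ∈ T.leaves, ∀ d ∈ s, d ≤ x → ∃ y ∈ s, d ≤ y ∧ y ≤ x ∧ y ∈ L) :
    T.sub s r hr L hL ⟶ T :=
  homMk (S := T.sub s r hr L hL) (fun x => x.1) fun n c d hc =>
    { le := fun j => hc.le j
      eq_of_le := fun j j' hj => hc.eq_of_le j j' hj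
      not_leaf := fun x hx hj hl => by
        obtain ⟨y, hys, hdy, hyx, hyL⟩ := h x hl d.1 d.2 hx
        exact hc.not_leaf ⟨y, hys⟩ hdy (fun j hjy => hj j (le_trans (b := y) hjy hyx)) hyL }

/-- The vertex with output `v` is a top vertex: its output is an inner edge and its inputs (if
any) are leaves. -/
def IsTop (T : DTree) (v : T.Edge) : Prop := T.IsInner v ∧ ∀ x, v < x → x ∈ T.leaves

/-- The edge `b` is the only inner edge attached to the root vertex: `b` is inner, and each other
edge is the root, or lies above `b`, or is a leaf attached to the root vertex. -/
def IsOnlyInner (T : DTree) (b : T.Edge) : Prop :=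
  T.IsInner b ∧ ∀ x, x = T.root ∨ b ≤ x ∨ x ∈ T.leaves

/-- `T` has exactly one vertex. -/
def IsCorolla (T : DTree) : Prop := ∀ x, x ∉ T.leaves ↔ x = T.root

/-- The faces of a tree. -/
inductive Face (T : DTree) : Type
  /-- The inner face `∂ₑ : T/e ⟶ T` which contracts the inner edge `e`. -/
  | inner (e : T.Edge) (he : T.IsInner e) : Face T
  /-- The outer face `∂ᵥ : T/v ⟶ T` which deletes a top vertex and its inputs. -/
  | top (v : T.Edge) (hv : T.IsTop v) : Face T
  /-- The outer face which deletes the root vertex, and the external edges attached to it, if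
  there is exactly one inner edge `b` attached to the root vertex. -/
  | bottom (b : T.Edge) (hb : T.IsOnlyInner b) : Face T
  /-- The outer faces `e : η ⟶ T` of a tree with exactly one vertex. -/
  | edge (h : T.IsCorolla) (e : T.Edge) : Face T

lemma leaf_max_top (T : DTree) (v : T.Edge) :
    ∀ l ∈ T.leaves ∪ {v}, ∀ x ∈ {x : T.Edge | ¬ v < x}, l ≤ x → x = l := by
  rintro l (hl | rfl) x hx h
  · exact T.leaf_max l hl x h
  · exact (h.eq_of_not_lt hx).symm

/-- The domain of a face map. In `T/e` the edge `e` is removed; the inputs of the vertex on top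
of `e` become inputs of the vertex below it. -/
def Face.dom {T : DTree} : Face T → DTree
  | .inner e he => T.sub {x | x ≠ e} ⟨T.root, he.1.symm⟩ (fun x => T.root_le x.1) T.leaves
      (fun l hl x _ => T.leaf_max l hl x)
  | .top v _ => T.sub {x | ¬ v < x} ⟨T.root, fun h => (h.trans_le (T.root_le v)).false⟩
      (fun x => T.root_le x.1) (T.leaves ∪ {v}) (T.leaf_max_top v)
  | .bottom b _ => T.sub {x | b ≤ x} ⟨b, le_rfl⟩ (fun x => x.2) T.leaves
      (fun l hl x _ => T.leaf_max l hl x)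
  | .edge _ _ => eta

/-- The face maps. -/
def Face.hom {T : DTree} : (F : Face T) → (F.dom ⟶ T)
  | .inner _ he => T.subHom _ _ _ _ (fun l hl x _ => T.leaf_max l hl x) fun x hx d _ hdx =>
      ⟨x, fun h => he.2 (h ▸ hx), hdx, le_rfl, hx⟩
  | .top v _ => T.subHom _ _ _ _ (T.leaf_max_top v) fun x hx d hd hdx => by
      by_cases h : v < x
      · refine ⟨v, lt_irrefl v, ?_, h.le, Or.inr rfl⟩
        rcases T.linear _ _ _ hdx h.le with h1 | h1
        · exact h1
        · exact (h1.eq_of_not_lt hd).symm.le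
      · exact ⟨x, h, hdx, le_rfl, Or.inl hx⟩
  | .bottom _ _ => T.subHom _ _ _ _ (fun l hl x _ => T.leaf_max l hl x) fun x hx _ hd hdx =>
      ⟨x, le_trans hd hdx, hdx, le_rfl, hx⟩
  | .edge _ e => T.ofEdge e

end DTree

/-! ### Dendroidal sets -/

/-- The category of dendroidal sets. -/
abbrev DSet : Type (u + 1) := DTreeᵒᵖ ⥤ Type u

/-- The dendroidal nerve `N_d`, with `N_d(P)_T = Hom(Ω(T), P)`. -/
def dendroidalNerve : Operad.{u} ⥤ DSet.{u} where
  obj P :=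
    { obj := fun T => OperadHom T.unop.operad P
      map := fun f => ↾fun x => OperadHom.comp f.unop x }
  map F := { app := fun _ => ↾fun x => OperadHom.comp x F }

/-- The inner horn `Λᵉ[T]`: the union of all faces of the representable dendroidal set `Ω[T]`,
except the face that contracts `e`. -/
def innerHorn (T : DTree) (e : T.Edge) (he : T.IsInner e) :
    Subfunctor (uliftYoneda.{u}.obj T : DSet.{u}) :=
  ⨆ F : {F : DTree.Face T // F ≠ DTree.Face.inner e he},
    Subfunctor.range (uliftYoneda.{u}.map F.1.hom)

/-- Inner Kan complexes: each map from an inner horn `Λᵉ[T]` extends to `Ω[T]`. -/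
def IsInnerKan (X : DSet.{u}) : Prop :=
  ∀ (T : DTree) (e : T.Edge) (he : T.IsInner e),
    Function.Surjective fun x : uliftYoneda.{u}.obj T ⟶ X => (innerHorn T e he).ι ≫ x

section

variable (X : DSet.{u})

/-- The set `X_η`. -/
abbrev Vertices : Type u := X.obj (op DTree.eta)

variable {X}

/-- The restriction `f^* x` of a dendrex along `f : S ⟶ T`. -/
abbrev pull {S T : DTree} (f : S ⟶ T) (x : X.obj (op T)) : X.obj (op S) := X.map f.op x

lemma pull_pull {R S T : DTree} (f : R ⟶ S) (g : S ⟶ T) (x : X.obj (op T)) :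
    pull f (pull g x) = pull (f ≫ g) x := by
  simp [pull]

/-- The colour `e^* x ∈ X_η` of the edge `e` in the dendrex `x` of shape `T`. -/
def colourAt {T : DTree} (x : X.obj (op T)) (e : T.Edge) : Vertices X := pull (T.ofEdge e) x

lemma colourAt_pull {S T : DTree} (f : S ⟶ T) (x : X.obj (op T)) (e : S.Edge) :
    colourAt (pull f x) e = colourAt x (DTree.edge f e) := by
  rw [colourAt, pull_pull]; rfl

/-- The colour of the input `j` of a dendrex of shape `Cₙ`. -/
def input {n : ℕ} (f : X.obj (op (DTree.corolla n))) (j : Fin n) : Vertices X :=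
  colourAt f (DTree.CorollaEdge.leaf j : DTree.CorollaEdge n)

/-- The colour of the output of a dendrex of shape `Cₙ`. -/
def output {n : ℕ} (f : X.obj (op (DTree.corolla n))) : Vertices X :=
  colourAt f (DTree.CorollaEdge.root : DTree.CorollaEdge n)

variable (X) in
/-- The set `X(c₁, …, cₙ; d)` of dendrices of shape `Cₙ` with inputs `c₁, …, cₙ`
and output `d`. -/
def Dendrices (n : ℕ) (c : Fin n → Vertices X) (d : Vertices X) : Type u :=
  {f : X.obj (op (DTree.corolla n)) // (∀ j, input f j = c j) ∧ output f = d}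

/-- The restriction of a dendrex `x` of shape `T` to the corolla given by an operation
of `Ω(T)`. -/
def restr {T : DTree} (x : X.obj (op T)) {n : ℕ} {c : Fin n → T.Edge} {d : T.Edge}
    (h : T.IsOp c d) : Dendrices X n (colourAt x ∘ c) (colourAt x d) :=
  ⟨pull (T.ofOp h) x, fun _ => colourAt_pull _ _ _, colourAt_pull _ _ _⟩

end

/-! ### The left adjoint of the nerve -/

/-- Formal composites of dendrices of shape `Cₙ`. -/
inductive FormalOp (X : DSet.{u}) : (n : ℕ) → (Fin n → Vertices X) → Vertices X → Type u
  | gen {n : ℕ} {c : Fin n → Vertices X} {d : Vertices X} (f : Dendrices X n c d) : FormalOp X n c d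
  | one (c : Vertices X) : FormalOp X 1 (fun _ => c) c
  | act {n : ℕ} {c : Fin n → Vertices X} {d : Vertices X} (σ : Equiv.Perm (Fin n))
      (f : FormalOp X n c d) : FormalOp X n (c ∘ σ) d
  | circ {n m k : ℕ} {c : Fin n → Vertices X} {d : Vertices X} {b : Fin m → Vertices X}
      {e : Vertices X} {a : Fin k → Vertices X} (i : Fin n) (φ : Shuffle n m k i) (he : c i = e)
      (ha : ∀ l, a l = Sum.elim c b (φ l).1) (f : FormalOp X n c d) (g : FormalOp X m b e) : FormalOp X k a d

/-- The congruence on formal composites generated by the axioms for an operad, and by the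
relations which say that `X ⟶ N_d(τ_d(X))` is well defined: for each dendrex `x` of shape `T`,
restriction of `x` to corollas is a map of operads on `Ω(T)`. -/
inductive FormalRel (X : DSet.{u}) : {n : ℕ} → {c : Fin n → Vertices X} → {d : Vertices X} →
    FormalOp X n c d → FormalOp X n c d → Prop
  | refl {n : ℕ} {c : Fin n → Vertices X} {d : Vertices X} (f : FormalOp X n c d) : FormalRel X f f
  | symm {n : ℕ} {c : Fin n → Vertices X} {d : Vertices X} {f g : FormalOp X n c d} :
      FormalRel X f g → FormalRel X g f
  | trans {n : ℕ} {c : Fin n → Vertices X} {d : Vertices X} {f g h : FormalOp X n c d} :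
      FormalRel X f g → FormalRel X g h → FormalRel X f h
  | act_congr {n : ℕ} {c : Fin n → Vertices X} {d : Vertices X} (σ : Equiv.Perm (Fin n))
      {f g : FormalOp X n c d} : FormalRel X f g → FormalRel X (.act σ f) (.act σ g)
  | circ_congr {n m k : ℕ} {c : Fin n → Vertices X} {d : Vertices X} {b : Fin m → Vertices X}
      {e : Vertices X} {a : Fin k → Vertices X} (i : Fin n) (φ : Shuffle n m k i) (he : c i = e)
      (ha : ∀ l, a l = Sum.elim c b (φ l).1) {f f' : FormalOp X n c d} {g g' : FormalOp X m b e} :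
      FormalRel X f f' → FormalRel X g g' → FormalRel X (.circ i φ he ha f g) (.circ i φ he ha f' g')
  | gen_one {T : DTree} (x : X.obj (op T)) (e : T.Edge) :
      FormalRel X (.gen (restr x (T.isOp_one e))) (.one (colourAt x e))
  | gen_act {T : DTree} (x : X.obj (op T)) {n : ℕ} {c : Fin n → T.Edge} {d : T.Edge}
      (σ : Equiv.Perm (Fin n)) (h : T.IsOp c d) :
      FormalRel X (.gen (restr x (h.act σ))) (.act σ (.gen (restr x h)))
  | gen_circ {T : DTree} (x : X.obj (op T)) {n m k : ℕ} {c : Fin n → T.Edge} {d : T.Edge}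
      {b : Fin m → T.Edge} {e : T.Edge} {a : Fin k → T.Edge} (i : Fin n) (φ : Shuffle n m k i)
      (he : c i = e) (ha : ∀ l, a l = Sum.elim c b (φ l).1) (hf : T.IsOp c d) (hg : T.IsOp b e) :
      FormalRel X (.gen (restr x (DTree.IsOp.circ i φ he ha hf hg)))
        (.circ (c := colourAt x ∘ c) i φ (congrArg (colourAt x) he)
          (elim_comp_aux (colourAt x) _ ha) (.gen (restr x hf)) (.gen (restr x hg)))
  | act_one {n : ℕ} {c : Fin n → Vertices X} {d : Vertices X} (f : FormalOp X n c d) :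
      FormalRel X (.act 1 f) f
  | act_mul {n : ℕ} {c : Fin n → Vertices X} {d : Vertices X} (σ τ : Equiv.Perm (Fin n))
      (f : FormalOp X n c d) : FormalRel X (.act τ (.act σ f)) (.act (σ * τ) f)
  | act_circ {n m k : ℕ} {c : Fin n → Vertices X} {d : Vertices X} {b : Fin m → Vertices X}
      {e : Vertices X} {a : Fin k → Vertices X} (σ : Equiv.Perm (Fin k)) (i : Fin n)
      (φ : Shuffle n m k i) (he : c i = e) (ha : ∀ l, a l = Sum.elim c b (φ l).1)
      (f : FormalOp X n c d) (g : FormalOp X m b e) :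
      FormalRel X (.act σ (.circ i φ he ha f g))
        (.circ (a := a ∘ σ) i (σ.trans φ) he (fun l => ha (σ l)) f g)
  | circ_act_left {n m k : ℕ} {c : Fin n → Vertices X} {d : Vertices X} {b : Fin m → Vertices X}
      {e : Vertices X} {a : Fin k → Vertices X} (σ : Equiv.Perm (Fin n)) (i : Fin n)
      (φ : Shuffle n m k i) (φ' : Shuffle n m k (σ i))
      (hφ : ∀ l, (φ' l).1 = Sum.map σ id (φ l).1) (he : c (σ i) = e)
      (ha : ∀ l, a l = Sum.elim (c ∘ σ) b (φ l).1) (ha' : ∀ l, a l = Sum.elim c b (φ' l).1)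
      (f : FormalOp X n c d) (g : FormalOp X m b e) :
      FormalRel X (.circ i φ he ha (.act σ f) g) (.circ (σ i) φ' he ha' f g)
  | circ_act_right {n m k : ℕ} {c : Fin n → Vertices X} {d : Vertices X} {b : Fin m → Vertices X}
      {e : Vertices X} {a : Fin k → Vertices X} (τ : Equiv.Perm (Fin m)) (i : Fin n)
      (φ φ' : Shuffle n m k i) (hφ : ∀ l, (φ' l).1 = Sum.map id τ (φ l).1) (he : c i = e)
      (ha : ∀ l, a l = Sum.elim c (b ∘ τ) (φ l).1) (ha' : ∀ l, a l = Sum.elim c b (φ' l).1)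
      (f : FormalOp X n c d) (g : FormalOp X m b e) :
      FormalRel X (.circ i φ he ha f (.act τ g)) (.circ i φ' he ha' f g)
  | one_circ {n : ℕ} {c : Fin n → Vertices X} {d : Vertices X} (φ : Shuffle 1 n n 0)
      (hφ : ∀ l, (φ l).1 = Sum.inr l) (ha : ∀ l, c l = Sum.elim (fun _ => d) c (φ l).1)
      (f : FormalOp X n c d) : FormalRel X (.circ 0 φ rfl ha (.one d) f) f
  | circ_one {n : ℕ} {c : Fin n → Vertices X} {d : Vertices X} (i : Fin n) (φ : Shuffle n 1 n i)
      (hφ : ∀ l, (φ l).1 = if l = i then Sum.inr 0 else Sum.inl l)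
      (ha : ∀ l, c l = Sum.elim c (fun _ => c i) (φ l).1)
      (f : FormalOp X n c d) : FormalRel X (.circ i φ rfl ha f (.one (c i))) f
  | circ_seq {n m p r s k : ℕ} {c : Fin n → Vertices X} {d : Vertices X} {b : Fin m → Vertices X}
      {e : Vertices X} {a : Fin p → Vertices X} {e' : Vertices X} {x : Fin r → Vertices X}
      {y : Fin s → Vertices X} {z : Fin k → Vertices X} (i : Fin n) (j : Fin m) (j' : Fin r)
      (φ : Shuffle n m r i) (ψ : Shuffle r p k j') (ψ' : Shuffle m p s j) (φ' : Shuffle n s k i)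
      (hj : (φ j').1 = Sum.inr j)
      (hk : ∀ l, Equiv.sumAssoc _ _ _ (Sum.map (fun t => (φ t).1) id (ψ l).1) =
        Sum.map id (fun t => (ψ' t).1) (φ' l).1)
      (he : c i = e) (hx : ∀ l, x l = Sum.elim c b (φ l).1)
      (he₁ : x j' = e') (hz : ∀ l, z l = Sum.elim x a (ψ l).1)
      (he₂ : b j = e') (hy : ∀ l, y l = Sum.elim b a (ψ' l).1)
      (hz' : ∀ l, z l = Sum.elim c y (φ' l).1)
      (f : FormalOp X n c d) (g : FormalOp X m b e) (h : FormalOp X p a e') :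
      FormalRel X (.circ j' ψ he₁ hz (.circ i φ he hx f g) h)
        (.circ i φ' he hz' f (.circ j ψ' he₂ hy g h))
  | circ_par {n m p r s k : ℕ} {c : Fin n → Vertices X} {d : Vertices X} {b : Fin m → Vertices X}
      {e : Vertices X} {a : Fin p → Vertices X} {e' : Vertices X} {x : Fin r → Vertices X}
      {y : Fin s → Vertices X} {z : Fin k → Vertices X} (i j : Fin n) (j' : Fin r) (i' : Fin s)
      (φ : Shuffle n m r i) (ψ : Shuffle r p k j') (ψ' : Shuffle n p s j) (φ' : Shuffle s m k i')
      (hj : (φ j').1 = Sum.inl j) (hi : (ψ' i').1 = Sum.inl i)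
      (hk : ∀ l, swapLast (Sum.map (fun t => (φ t).1) id (ψ l).1) =
        Sum.map (fun t => (ψ' t).1) id (φ' l).1)
      (he : c i = e) (hx : ∀ l, x l = Sum.elim c b (φ l).1)
      (he₁ : x j' = e') (hz : ∀ l, z l = Sum.elim x a (ψ l).1)
      (he₂ : c j = e') (hy : ∀ l, y l = Sum.elim c a (ψ' l).1)
      (he₃ : y i' = e) (hz' : ∀ l, z l = Sum.elim y b (φ' l).1)
      (f : FormalOp X n c d) (g : FormalOp X m b e) (h : FormalOp X p a e') :
      FormalRel X (.circ j' ψ he₁ hz (.circ i φ he hx f g) h)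
        (.circ i' φ' he₃ hz' (.circ j ψ' he₂ hy f h) g)

/-- The congruence `FormalRel` as a setoid. -/
instance formalSetoid (X : DSet.{u}) (n : ℕ) (c : Fin n → Vertices X) (d : Vertices X) :
    Setoid (FormalOp X n c d) where
  r := FormalRel X
  iseqv := ⟨.refl, .symm, .trans⟩

/-- The operad `τ_d(X)` generated by the dendroidal set `X`. -/
def tauObj (X : DSet.{u}) : Operad.{u} where
  Colour := Vertices X
  Op n c d := Quotient (formalSetoid X n c d)
  str :=
    { one := fun c => ⟦.one c⟧
      act := fun σ => Quotient.map (.act σ) fun _ _ => .act_congr σ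
      circ := fun i φ he ha => Quotient.map₂ (.circ i φ he ha)
        fun _ _ hf _ _ hg => .circ_congr i φ he ha hf hg
      act_one := by
        rintro n c d ⟨f⟩; exact Quotient.sound (.act_one f)
      act_mul := by
        rintro n c d σ τ ⟨f⟩; exact Quotient.sound (.act_mul σ τ f)
      act_circ := by
        rintro n m k c d b e a σ i φ he ha ⟨f⟩ ⟨g⟩
        exact Quotient.sound (.act_circ σ i φ he ha f g)
      circ_act_left := by
        rintro n m k c d b e a σ i φ φ' hφ he ha ha' ⟨f⟩ ⟨g⟩
        exact Quotient.sound (.circ_act_left σ i φ φ' hφ he ha ha' f g)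
      circ_act_right := by
        rintro n m k c d b e a σ i φ φ' hφ he ha ha' ⟨f⟩ ⟨g⟩
        exact Quotient.sound (.circ_act_right σ i φ φ' hφ he ha ha' f g)
      one_circ := by
        rintro n c d φ hφ ha ⟨f⟩; exact Quotient.sound (.one_circ φ hφ ha f)
      circ_one := by
        rintro n c d i φ hφ ha ⟨f⟩; exact Quotient.sound (.circ_one i φ hφ ha f)
      circ_seq := by
        rintro n m p r s k c d b e a e' x y z i j j' φ ψ ψ' φ' hj hk he hx he₁ hz he₂ hy hz'
          ⟨f⟩ ⟨g⟩ ⟨h⟩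
        exact Quotient.sound
          (.circ_seq i j j' φ ψ ψ' φ' hj hk he hx he₁ hz he₂ hy hz' f g h)
      circ_par := by
        rintro n m p r s k c d b e a e' x y z i j j' i' φ ψ ψ' φ' hj hi hk he hx he₁ hz he₂ hy
          he₃ hz' ⟨f⟩ ⟨g⟩ ⟨h⟩
        exact Quotient.sound
          (.circ_par i j j' i' φ ψ ψ' φ' hj hi hk he hx he₁ hz he₂ hy he₃ hz' f g h) }

lemma OperadHom.ext_of_heq {P : Operad.{u}} {Q : Operad.{v}} {F G : OperadHom P Q}
    (hc : ∀ x, F.colour x = G.colour x)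
    (ho : ∀ (n : ℕ) (c : Fin n → P.Colour) (d : P.Colour) (f : P.Op n c d),
      F.op f ≍ G.op f) : F = G := by
  obtain ⟨f, fop, _, _, _⟩ := F
  obtain ⟨g, gop, _, _, _⟩ := G
  obtain rfl : f = g := funext hc
  have : @fop = @gop := by
    funext n c d x
    exact eq_of_heq (ho n c d x)
  subst this
  rfl

lemma OperadStr.act_heq {P : Operad.{u}} {n : ℕ} {c c' : Fin n → P.Colour} {d d' : P.Colour}
    (hc : c = c') (hd : d = d') (σ : Equiv.Perm (Fin n)) {f : P.Op n c d} {f' : P.Op n c' d'}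
    (hf : f ≍ f') : P.str.act σ f ≍ P.str.act σ f' := by
  subst hc hd hf; rfl

lemma OperadStr.one_heq {P : Operad.{u}} {c c' : P.Colour} (hc : c = c') :
    P.str.one c ≍ P.str.one c' := by
  subst hc; rfl

lemma OperadStr.circ_heq {P : Operad.{u}} {n m k : ℕ} {c c' : Fin n → P.Colour}
    {d d' : P.Colour} {b b' : Fin m → P.Colour} {e e' : P.Colour} {a a' : Fin k → P.Colour}
    (hc : c = c') (hd : d = d') (hb : b = b') (hee : e = e') (haa : a = a') (i : Fin n)
    (φ : Shuffle n m k i) (he : c i = e) (he' : c' i = e')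
    (ha : ∀ l, a l = Sum.elim c b (φ l).1) (ha' : ∀ l, a' l = Sum.elim c' b' (φ l).1)
    {f : P.Op n c d} {f' : P.Op n c' d'} (hf : f ≍ f') {g : P.Op m b e} {g' : P.Op m b' e'}
    (hg : g ≍ g') : P.str.circ i φ he ha f g ≍ P.str.circ i φ he' ha' f' g' := by
  subst hc hd hb hee haa hf hg; rfl

section

variable {X : DSet.{u}} {P : Operad.{u}}

lemma gen_heq {n : ℕ} {c c' : Fin n → Vertices X} {d d' : Vertices X} (hc : c = c') (hd : d = d')
    {f : Dendrices X n c d} {f' : Dendrices X n c' d'} (hf : f.1 = f'.1) :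
    (⟦.gen f⟧ : (tauObj X).Op n c d) ≍ (⟦.gen f'⟧ : (tauObj X).Op n c' d') := by
  subst hc hd
  obtain rfl : f = f' := Subtype.ext hf
  rfl

/-- The map `Ω(T) ⟶ τ_d(X)` given by a dendrex of shape `T`. -/
def unitHom {T : DTree} (x : X.obj (op T)) : OperadHom T.operad (tauObj X) where
  colour := colourAt x
  op f := ⟦.gen (restr x f.down)⟧
  map_one e := Quotient.sound (.gen_one x e)
  map_act σ f := Quotient.sound (.gen_act x σ f.down)
  map_circ i φ he ha _ f g := Quotient.sound (.gen_circ x i φ he ha f.down g.down)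

lemma unitHom_pull {S T : DTree} (f : S ⟶ T) (x : X.obj (op T)) :
    unitHom (pull f x) = OperadHom.comp f (unitHom x) := by
  refine OperadHom.ext_of_heq (fun e => colourAt_pull f x e) fun n c d h => ?_
  refine gen_heq (funext fun j => colourAt_pull f x (c j)) (colourAt_pull f x d) ?_
  exact (pull_pull _ f x).trans (congrArg (fun t => pull t x) (DTree.ofOp_comp h.down f))

variable (X) in
/-- The unit `X ⟶ N_d(τ_d(X))`. -/
def tauUnit : X ⟶ dendroidalNerve.obj (tauObj X) where
  app T := ↾fun x => unitHom (T := T.unop) x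
  naturality S T f := by
    ext x
    exact unitHom_pull f.unop x

lemma map_pull (F : X ⟶ dendroidalNerve.obj P) {S T : DTree} (f : S ⟶ T) (x : X.obj (op T)) :
    F.app (op S) (pull f x) = OperadHom.comp f (F.app (op T) x) :=
  NatTrans.naturality_apply F f.op x

/-- The map on colours `X_η ⟶ P` given by a map `X ⟶ N_d(P)`. -/
def liftColour (F : X ⟶ dendroidalNerve.obj P) (x : Vertices X) : P.Colour :=
  OperadHom.colour (F.app (op DTree.eta) x) ()

lemma liftColour_colourAt (F : X ⟶ dendroidalNerve.obj P) {T : DTree} (x : X.obj (op T))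
    (e : T.Edge) : liftColour F (colourAt x e) = OperadHom.colour (F.app (op T) x) e := by
  rw [liftColour, colourAt, map_pull]; rfl

lemma liftGen_aux (F : X ⟶ dendroidalNerve.obj P) {n : ℕ} {c : Fin n → Vertices X}
    {d : Vertices X} (f : Dendrices X n c d) :
    OperadHom.colour (F.app (op (DTree.corolla n)) f.1) ∘ DTree.CorollaEdge.leaf =
      liftColour F ∘ c ∧
    OperadHom.colour (F.app (op (DTree.corolla n)) f.1) DTree.CorollaEdge.root =
      liftColour F d := by
  constructor
  · funext j
    exact (liftColour_colourAt F f.1 _).symm.trans (congrArg (liftColour F) (f.2.1 j))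
  · exact (liftColour_colourAt F f.1 _).symm.trans (congrArg (liftColour F) f.2.2)

/-- The operation of `P` given by a dendrex of shape `Cₙ` and a map `X ⟶ N_d(P)`. -/
def liftGen (F : X ⟶ dendroidalNerve.obj P) {n : ℕ} {c : Fin n → Vertices X}
    {d : Vertices X} (f : Dendrices X n c d) : P.Op n (liftColour F ∘ c) (liftColour F d) :=
  cast (congrArg₂ (P.Op n) (liftGen_aux F f).1 (liftGen_aux F f).2)
    (OperadHom.op (F.app (op (DTree.corolla n)) f.1)
      (⟨DTree.isOp_corolla n⟩ : (DTree.corolla n).operad.Op n _ _))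

lemma op_heq_of_eq {Q : Operad.{v}} {F G : OperadHom Q P} (h : F = G) {n : ℕ}
    {c : Fin n → Q.Colour} {d : Q.Colour} (f : Q.Op n c d) : F.op f ≍ G.op f := by
  subst h; rfl

lemma liftGen_restr (F : X ⟶ dendroidalNerve.obj P) {T : DTree} (x : X.obj (op T)) {n : ℕ}
    {c : Fin n → T.Edge} {d : T.Edge} (h : T.IsOp c d) :
    liftGen F (restr x h) ≍
      OperadHom.op (F.app (op T) x) (⟨h⟩ : T.operad.Op n c d) := by
  refine (cast_heq _ _).trans ?_
  exact op_heq_of_eq (map_pull F (T.ofOp h) x) _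

/-- The value of a formal composite in an operad `P`, given a map `X ⟶ N_d(P)`. -/
def liftFormal (F : X ⟶ dendroidalNerve.obj P) : {n : ℕ} → {c : Fin n → Vertices X} →
    {d : Vertices X} → FormalOp X n c d → P.Op n (liftColour F ∘ c) (liftColour F d)
  | _, _, _, .gen f => liftGen F f
  | _, _, _, .one c => P.str.one (liftColour F c)
  | _, _, _, .act σ f => P.str.act σ (liftFormal F f)
  | _, _, _, .circ (c := c) i φ he ha f g =>
    P.str.circ (c := liftColour F ∘ c) i φ (congrArg (liftColour F) he)
      (elim_comp_aux (liftColour F) _ ha) (liftFormal F f) (liftFormal F g)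

lemma liftFormal_rel (F : X ⟶ dendroidalNerve.obj P) {n : ℕ} {c : Fin n → Vertices X}
    {d : Vertices X} {f g : FormalOp X n c d} (h : FormalRel X f g) :
    liftFormal F f = liftFormal F g := by
  have hcol : ∀ {T : DTree} (x : X.obj (op T)) {n : ℕ} (c : Fin n → T.Edge),
      OperadHom.colour (F.app (op T) x) ∘ c = liftColour F ∘ colourAt x ∘ c :=
    fun x _ c => funext fun j => (liftColour_colourAt F x (c j)).symm
  induction h with
  | refl f => rfl
  | symm _ ih => exact ih.symm
  | trans _ _ ih ih' => exact ih.trans ih'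
  | act_congr σ _ ih => simp only [liftFormal, ih]
  | circ_congr i φ he ha _ _ ih ih' => simp only [liftFormal, ih, ih']
  | gen_one x e =>
    simp only [liftFormal]
    apply eq_of_heq
    refine (liftGen_restr F x _).trans ?_
    refine (heq_of_eq (OperadHom.map_one (F.app _ x) e)).trans ?_
    exact OperadStr.one_heq (liftColour_colourAt F x e).symm
  | gen_act x σ h =>
    simp only [liftFormal]
    apply eq_of_heq
    refine (liftGen_restr F x _).trans ?_
    refine (heq_of_eq (OperadHom.map_act (F.app _ x) σ ⟨h⟩)).trans ?_
    exact OperadStr.act_heq (hcol x _) (liftColour_colourAt F x _).symm σ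
      (liftGen_restr F x h).symm
  | gen_circ x i φ he ha hf hg =>
    simp only [liftFormal]
    apply eq_of_heq
    refine (liftGen_restr F x _).trans ?_
    refine (heq_of_eq (OperadHom.map_circ (F.app _ x) i φ he ha
      (elim_comp_aux _ _ ha) ⟨hf⟩ ⟨hg⟩)).trans ?_
    exact OperadStr.circ_heq (hcol x _) (liftColour_colourAt F x _).symm (hcol x _)
      (liftColour_colourAt F x _).symm (hcol x _) i φ _ _ _ _
      (liftGen_restr F x hf).symm (liftGen_restr F x hg).symm
  | act_one f => exact P.str.act_one _
  | act_mul σ τ f => exact P.str.act_mul σ τ _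
  | act_circ σ i φ he ha f g => exact P.str.act_circ σ i φ _ _ _ _
  | circ_act_left σ i φ φ' hφ he ha ha' f g =>
    simp only [liftFormal]
    exact P.str.circ_act_left σ i φ φ' hφ (congrArg (liftColour F) he)
      (elim_comp_aux (liftColour F) _ ha) (elim_comp_aux (liftColour F) _ ha')
      (liftFormal F f) (liftFormal F g)
  | circ_act_right τ i φ φ' hφ he ha ha' f g =>
    simp only [liftFormal]
    exact P.str.circ_act_right τ i φ φ' hφ (congrArg (liftColour F) he)
      (elim_comp_aux (liftColour F) _ ha) (elim_comp_aux (liftColour F) _ ha')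
      (liftFormal F f) (liftFormal F g)
  | one_circ φ hφ ha f => exact P.str.one_circ φ hφ _ _
  | circ_one i φ hφ ha f => exact P.str.circ_one i φ hφ _ _
  | circ_seq i j j' φ ψ ψ' φ' hj hk he hx he₁ hz he₂ hy hz' f g h =>
    exact P.str.circ_seq i j j' φ ψ ψ' φ' hj hk _ _ _ _ _ _ _ _ _ _
  | circ_par i j j' i' φ ψ ψ' φ' hj hi hk he hx he₁ hz he₂ hy he₃ hz' f g h =>
    exact P.str.circ_par i j j' i' φ ψ ψ' φ' hj hi hk _ _ _ _ _ _ _ _ _ _ _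

/-- The map of operads `τ_d(X) ⟶ P` given by a map `X ⟶ N_d(P)`. -/
def tauLift (F : X ⟶ dendroidalNerve.obj P) : tauObj X ⟶ P :=
  OperadHom.mk (P := tauObj X) (liftColour F)
    (fun f => Quotient.lift (liftFormal F) (fun _ _ h => liftFormal_rel F h) f)
    (fun _ => rfl) (by rintro n c d σ ⟨f⟩; rfl)
    (by rintro n m k c d b e a i φ he ha ha' ⟨f⟩ ⟨g⟩; rfl)

lemma colourAt_eta (x : Vertices X) : colourAt (T := DTree.eta) x () = x := by
  have : DTree.eta.ofEdge () = 𝟙 DTree.eta := rfl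
  change pull (DTree.eta.ofEdge ()) x = x
  rw [this]
  simp [pull]

lemma tau_hom_ext {G H : tauObj X ⟶ P} (hc : ∀ x, OperadHom.colour G x = OperadHom.colour H x)
    (hg : ∀ (n : ℕ) (c : Fin n → Vertices X) (d : Vertices X) (f : Dendrices X n c d),
      OperadHom.op G (⟦.gen f⟧ : (tauObj X).Op n c d) ≍
        OperadHom.op H (⟦.gen f⟧ : (tauObj X).Op n c d)) : G = H := by
  have hcol : OperadHom.colour G = OperadHom.colour H := funext hc
  refine OperadHom.ext_of_heq hc ?_
  rintro n c d ⟨f⟩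
  clear * - hc hg hcol
  change OperadHom.op G (⟦f⟧ : (tauObj X).Op n c d) ≍ OperadHom.op H (⟦f⟧ : (tauObj X).Op n c d)
  induction f with
  | gen f => exact hg _ _ _ f
  | one c =>
    refine (heq_of_eq (OperadHom.map_one G c)).trans ?_
    exact (OperadStr.one_heq (hc c)).trans (heq_of_eq (OperadHom.map_one H c).symm)
  | act σ f ih =>
    refine (heq_of_eq (OperadHom.map_act G σ ⟦f⟧)).trans ?_
    refine HEq.trans ?_ (heq_of_eq (OperadHom.map_act H σ ⟦f⟧).symm)
    exact OperadStr.act_heq (by rw [hcol]) (hc _) σ ih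
  | circ i φ he ha f g ih ih' =>
    refine (heq_of_eq (OperadHom.map_circ G i φ he ha (elim_comp_aux _ _ ha) ⟦f⟧ ⟦g⟧)).trans ?_
    refine HEq.trans ?_
      (heq_of_eq (OperadHom.map_circ H i φ he ha (elim_comp_aux _ _ ha) ⟦f⟧ ⟦g⟧).symm)
    exact OperadStr.circ_heq (by rw [hcol]) (hc _) (by rw [hcol]) (hc _) (by rw [hcol]) i φ
      _ _ _ _ ih ih'

variable (X P) in
/-- Maps of operads `τ_d(X) ⟶ P` are the same as maps of dendroidal sets `X ⟶ N_d(P)`. -/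
def tauEquiv : (tauObj X ⟶ P) ≃ (X ⟶ dendroidalNerve.obj P) where
  toFun G := tauUnit X ≫ dendroidalNerve.map G
  invFun F := tauLift F
  left_inv G := by
    have hc : ∀ x : Vertices X, liftColour (tauUnit X ≫ dendroidalNerve.map G) x =
        OperadHom.colour G x := fun x => congrArg (OperadHom.colour G) (colourAt_eta x)
    refine tau_hom_ext hc fun n c d f => ?_
    refine (cast_heq _ _).trans ?_
    change OperadHom.op G (⟦.gen (restr f.1 (DTree.isOp_corolla n))⟧ : (tauObj X).Op n _ _) ≍ _
    obtain ⟨f, h, rfl⟩ := f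
    obtain rfl : (fun j => input f j) = c := funext h
    have : (DTree.corolla n).ofOp (DTree.isOp_corolla n) = 𝟙 (DTree.corolla n) := by
      ext x
      rcases x with _ | j <;> rfl
    have h2 : restr f (DTree.isOp_corolla n) = ⟨f, h, rfl⟩ := by
      apply Subtype.ext
      change pull _ f = f
      rw [this]
      simp [pull]
    exact heq_of_eq (congrArg (fun t => OperadHom.op G
      (⟦.gen t⟧ : (tauObj X).Op n (fun j => input f j) (output f))) h2)
  right_inv F := by
    ext T x
    refine OperadHom.ext_of_heq (fun e => liftColour_colourAt F (T := T.unop) x e) ?_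
    intro n c d h
    exact liftGen_restr F (T := T.unop) x h.down

end

/-- The functor `τ_d` from dendroidal sets to coloured operads. -/
def tau : DSet.{u} ⥤ Operad.{u} :=
  Adjunction.leftAdjointOfEquiv (G := dendroidalNerve) tauEquiv (fun _ _ _ _ _ => rfl)

/-- The functor `τ_d` is left adjoint to the dendroidal nerve. -/
def tauAdj : tau.{u} ⊣ dendroidalNerve.{u} :=
  Adjunction.adjunctionOfEquivLeft tauEquiv (fun _ _ _ _ _ => rfl)

/-! ### Homotopy of dendrices, and `Ho(X)` -/

/-- The enumeration of the inputs of `f ∘ᵢ 1` in which the input of `1` takes the place of `i`. -/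
def rightShuffle {n : ℕ} (i : Fin n) : Shuffle n 1 n i where
  toFun l := ⟨if l = i then Sum.inr 0 else Sum.inl l, by
    split_ifs with h
    · simp
    · simpa using h⟩
  invFun x := Sum.elim id (fun _ => i) x.1
  left_inv l := by
    by_cases h : l = i <;> simp [h]
  right_inv := by
    rintro ⟨j | t, h⟩
    · have : j ≠ i := fun hj => h (congrArg Sum.inl hj)
      simp [this]
    · simp [Subsingleton.elim t 0]

/-- The enumeration of the inputs of `1 ∘ f` given by the enumeration of the inputs of `f`. -/
def leftShuffle (n : ℕ) : Shuffle 1 n n 0 where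
  toFun l := ⟨Sum.inr l, by simp⟩
  invFun
    | ⟨Sum.inl j, h⟩ => (h (congrArg Sum.inl (Subsingleton.elim j 0))).elim
    | ⟨Sum.inr l, _⟩ => l
  left_inv _ := rfl
  right_inv := by
    rintro ⟨j | t, h⟩
    · exact (h (congrArg Sum.inl (Subsingleton.elim j 0))).elim
    · rfl

section

variable {X : DSet.{u}}

/-- `IsComposite i φ f g h` says that `h` is a `∘ᵢ`-composition of `f` and `g`: there is a
dendrex `γ` (a witness) of shape `Cₙ ∘ᵢ Cₘ`, with `f` at the lower vertex, `g` at the upper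
vertex, and with inner face `h`. The inputs of `h` are enumerated by `φ`. -/
def IsComposite {n m k : ℕ} (i : Fin n) (φ : Shuffle n m k i)
    (f : X.obj (op (DTree.corolla n))) (g : X.obj (op (DTree.corolla m)))
    (h : X.obj (op (DTree.corolla k))) : Prop :=
  ∃ γ : X.obj (op (DTree.graft n m i)),
    pull ((DTree.graft n m i).ofOp (DTree.isOp_low n m i)) γ = f ∧
    pull ((DTree.graft n m i).ofOp (DTree.isOp_high n m i)) γ = g ∧
    pull ((DTree.graft n m i).ofOp (DTree.isOp_graft φ)) γ = h

/-- The degenerate dendrex `id` of shape `C₁` on a vertex `x ∈ X_η`. -/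
def degen (x : Vertices X) : Dendrices X 1 (fun _ => x) x :=
  ⟨pull (DTree.eta.ofOp (DTree.eta.isOp_one ())) x,
    fun _ => (colourAt_pull _ _ _).trans (colourAt_eta x),
    (colourAt_pull _ _ _).trans (colourAt_eta x)⟩

/-- The dendrex `σ^* f`, where `σ : Cₙ ⟶ Cₙ` is the automorphism given by a permutation. -/
def perm {n : ℕ} {c : Fin n → Vertices X} {d : Vertices X} (σ : Equiv.Perm (Fin n))
    (f : Dendrices X n c d) : Dendrices X n (c ∘ σ) d :=
  ⟨pull ((DTree.corolla n).ofOp ((DTree.isOp_corolla n).act σ)) f.1,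
    fun j => (colourAt_pull _ _ _).trans (f.2.1 (σ j)), (colourAt_pull _ _ _).trans f.2.2⟩

/-- `f` is homotopic to `g` along the input edge `i`: there is a dendrex of shape `Cₙ ∘ᵢ C₁`
with `f` at the lower vertex, a degenerate dendrex at the upper vertex, and with inner face `g`. -/
def HomotopicAlong {n : ℕ} (i : Fin n) (f g : X.obj (op (DTree.corolla n))) : Prop :=
  IsComposite i (rightShuffle i) f (degen (input f i)).1 g

/-- `f` is homotopic to `g` along the root: there is a dendrex of shape `C₁ ∘ Cₙ` with a degenerate
dendrex at the lower vertex, `f` at the upper vertex, and with inner face `g`. -/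
def HomotopicAlongRoot {n : ℕ} (f g : X.obj (op (DTree.corolla n))) : Prop :=
  IsComposite 0 (leftShuffle n) (degen (output f)).1 f g

/-- `f` is homotopic to `g` along some edge of the corolla. -/
def Homotopic {n : ℕ} (f g : X.obj (op (DTree.corolla n))) : Prop :=
  HomotopicAlongRoot f g ∨ ∃ i : Fin n, HomotopicAlong i f g

variable (X) in
/-- The set `Ho(X)(c₁, …, cₙ; d)` of homotopy classes of dendrices in `X(c₁, …, cₙ; d)`. -/
def HoOp (n : ℕ) (c : Fin n → Vertices X) (d : Vertices X) : Type u :=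
  Quot fun f g : Dendrices X n c d => Homotopic f.1 g.1

/-- The homotopy class `[f]`. -/
def hoMk {n : ℕ} {c : Fin n → Vertices X} {d : Vertices X} (f : Dendrices X n c d) :
    HoOp X n c d := Quot.mk _ f

variable (X) in
/-- The collection `Ho(X)`, whose colours are the vertices of `X`, with an operad structure. -/
def hoOperad (S : OperadStr (Vertices X) (HoOp X)) : Operad.{u} := ⟨Vertices X, HoOp X, S⟩

variable (X) in
/-- The structure `S` on the collection `Ho(X)` is given by: the unit of `x` is the class of
the degenerate dendrex on `x`; `σ^*[f] = [σ^* f]`; and `[f] ∘ᵢ [g] = [h]` whenever `h` is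
a `∘ᵢ`-composition of `f` and `g`. -/
structure IsHoStr (S : OperadStr (Vertices X) (HoOp X)) : Prop where
  one (x : Vertices X) : S.one x = hoMk (degen x)
  act {n : ℕ} {c : Fin n → Vertices X} {d : Vertices X} (σ : Equiv.Perm (Fin n))
    (f : Dendrices X n c d) : S.act σ (hoMk f) = hoMk (perm σ f)
  circ {n m k : ℕ} {c : Fin n → Vertices X} {d : Vertices X} {b : Fin m → Vertices X}
    {e : Vertices X} {a : Fin k → Vertices X} (i : Fin n) (φ : Shuffle n m k i) (he : c i = e)
    (ha : ∀ l, a l = Sum.elim c b (φ l).1) (f : Dendrices X n c d) (g : Dendrices X m b e)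
    (h : Dendrices X k a d) (hγ : IsComposite i φ f.1 g.1 h.1) :
    S.circ i φ he ha (hoMk f) (hoMk g) = hoMk h

variable (X) in
/-- A map of dendroidal sets `q : X ⟶ N_d(Ho(X))` extends the quotient map of
collections: it is the identity on vertices, and sends a dendrex `f` of shape `Cₙ` to
the map `Ω(Cₙ) ⟶ Ho(X)` whose value at the vertex of `Cₙ` is `[f]`. (The types of both
sides of `≍` are equal by naturality of `q`.) -/
structure ExtendsQuotient (S : OperadStr (Vertices X) (HoOp X))
    (q : X ⟶ dendroidalNerve.obj (hoOperad X S)) : Prop where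
  colour (x : Vertices X) : OperadHom.colour (q.app (op DTree.eta) x) () = x
  op {n : ℕ} (f : X.obj (op (DTree.corolla n))) :
    OperadHom.op (q.app (op (DTree.corolla n)) f)
      (⟨DTree.isOp_corolla n⟩ : (DTree.corolla n).operad.Op n _ _) ≍
    hoMk (⟨f, fun _ => rfl, rfl⟩ : Dendrices X n (input f) (output f))

/-- The map of operads `τ_d(X) ⟶ Ho(X)` that corresponds, under the adjunction
between `τ_d` and `N_d`, to a map `q : X ⟶ N_d(Ho(X))`. -/
def naturalMap (S : OperadStr (Vertices X) (HoOp X))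
    (q : X ⟶ dendroidalNerve.obj (hoOperad X S)) : tau.obj X ⟶ hoOperad X S :=
  (tauAdj.homEquiv X (hoOperad X S)).symm q

end

end Dendroidal

open CategoryTheory Dendroidal

/-! The construction is the operadic form of the homotopy category of a quasi-category. The inner
horn of `Cₙ ∘ᵢ Cₘ` consists of two corollas that meet in the inner edge, so filling it says that
composable dendrices have a composition (`IsInnerKan.exists_graft`). All other fillings take place
in trees with three vertices. Such a tree has two inner edges and four faces, and three compatible
dendrices on the faces of an inner horn produce one on the missing inner face. For three vertices on
top of each other this gives both directions of sequential associativity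
(`IsComposite.of_composeUpper`, `IsComposite.of_composeLower`); for two vertices side by side above
a third it gives parallel associativity (`IsComposite.of_par`).

If one of the three vertices is degenerate, associativity becomes a statement about homotopies: two
compositions of the same pair are homotopic along the root, and compositions are compatible with
homotopies in either argument. Since a homotopy is itself a composition with a degenerate dendrex,
homotopies along any edge reduce to homotopies along the root, in both directions
(`Homotopic.homotopicAlongRoot`). So composition descends to classes. The operad axioms follow from
associativity of compositions, from degenerate witnesses, and from reading one witness with
different enumerations.

To fill a horn one needs compatible data on its faces. Arrows of trees are controlled by their
effect on edges and leaves, and `Piece.compatible_of_shared` reduces compatibility of two faces to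
agreement on the edges and corollas they share.

A map `F : X ⟶ N_d(P)` gives each dendrex `f` of shape `Cₙ` an operation `liftGen F f` of `P`. This
assignment respects units, permutations and compositions, so it is constant on homotopy classes and
factors through `Ho(X)`. Thus `hoUnit` has the universal property of the unit of the adjunction,
which gives the isomorphism. The same facts, applied to `P = Ho(X)` with an arbitrary structure that
admits an extension `q`, force the formulas for that structure and hence its uniqueness. -/

namespace Dendroidal

namespace DTree

variable {R S T D D' D₁ D₂ : DTree}

/-! ### Arrows of trees in terms of edges -/

/-- A set of pairwise incomparable edges above `d` is part of the set of leaves of a subtree with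
root `d` whose other leaves are leaves of `T`. -/
lemma exists_isOp (T : DTree) (A : Set T.Edge) (d : T.Edge) (hd : ∀ a ∈ A, d ≤ a)
    (hA : ∀ a ∈ A, ∀ b ∈ A, a ≤ b → a = b) :
    ∃ (n : ℕ) (c : Fin n → T.Edge), T.IsOp c d ∧ (∀ a ∈ A, ∃ j, c j = a) ∧
      ∀ j, c j ∈ A ∨ c j ∈ T.leaves := by
  let B : Set T.Edge := A ∪ {l | l ∈ T.leaves ∧ d ≤ l ∧ ∀ a ∈ A, ¬ a ≤ l}
  obtain ⟨n, ⟨e⟩⟩ := Finite.exists_equiv_fin B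
  have hB : ∀ b ∈ B, ∃ j, (e.symm j).1 = b := fun b hb => ⟨e ⟨b, hb⟩, by simp⟩
  refine ⟨n, fun j => (e.symm j).1, ⟨fun j => ?_, fun j j' h => ?_, fun x hx hj hl => ?_⟩,
    fun a ha => hB a (Or.inl ha), fun j => ?_⟩
  · rcases (e.symm j).2 with h | h
    · exact hd _ h
    · exact h.2.1
  · apply e.symm.injective
    apply Subtype.ext
    rcases (e.symm j).2 with h1 | h1 <;> rcases (e.symm j').2 with h2 | h2
    · exact hA _ h1 _ h2 h
    · exact absurd h (h2.2.2 _ h1)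
    · exact (T.leaf_max _ h1.1 _ h).symm
    · exact (T.leaf_max _ h1.1 _ h).symm
  · by_cases hA' : ∃ a ∈ A, a ≤ x
    · obtain ⟨a, ha, hax⟩ := hA'
      obtain ⟨j, hj'⟩ := hB a (Or.inl ha)
      exact hj j (hj'.trans_le hax)
    · obtain ⟨j, hj'⟩ := hB x (Or.inr ⟨hl, hx, fun a ha hax => hA' ⟨a, ha, hax⟩⟩)
      exact hj j hj'.le
  · exact (e.symm j).2.imp id fun h => h.1

/-- `y` is an input of some subtree with root `x`, and arrows send operations to operations. This
and the next two lemmas give necessary conditions on the map of edges; `homOfEdges` shows that they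
suffice. -/
lemma edge_mono (f : S ⟶ T) {x y : S.Edge} (h : x ≤ y) : edge f x ≤ edge f y := by
  obtain ⟨n, c, hc, hj, -⟩ := S.exists_isOp {y} x (by simpa using h) (by simp)
  obtain ⟨j, hj⟩ := hj y rfl
  have := (isOp_edge f hc).le j
  rwa [Function.comp_apply, hj] at this

/-- Incomparable edges are different inputs of one subtree at the root of `S`, and the inputs of the
image operation are again incomparable. The order itself need not be reflected, as degeneracies
identify comparable edges. -/
lemma comparable_of_edge_le (f : S ⟶ T) {x y : S.Edge} (h : edge f x ≤ edge f y) :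
    x ≤ y ∨ y ≤ x := by
  by_contra hxy
  rw [not_or] at hxy
  obtain ⟨n, c, hc, hj, -⟩ := S.exists_isOp {x, y} S.root (fun a _ => S.root_le a) (by
    rintro a (rfl | rfl) b (rfl | rfl) hab
    · rfl
    · exact absurd hab hxy.1
    · exact absurd hab hxy.2
    · rfl)
  obtain ⟨j, rfl⟩ := hj x (Or.inl rfl)
  obtain ⟨j', rfl⟩ := hj y (Or.inr rfl)
  obtain rfl := (isOp_edge f hc).eq_of_le j j' h
  exact hxy.1 le_rfl

/-- All inputs of the largest subtree with root `x` are leaves of `S`. Its image is an operation, so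
a leaf of `T` above the root of that operation lies above one of its inputs. -/
lemma exists_leaf_of_edge_le (f : S ⟶ T) {x : S.Edge} {l : T.Edge} (hl : l ∈ T.leaves)
    (h : edge f x ≤ l) : ∃ y ∈ S.leaves, x ≤ y ∧ edge f y ≤ l := by
  obtain ⟨n, c, hc, -, hj⟩ := S.exists_isOp ∅ x (by simp) (by simp)
  by_contra hy
  refine (isOp_edge f hc).not_leaf l h (fun j hjl => hy ⟨c j, ?_, hc.le j, hjl⟩) hl
  simpa using hj j

/-- An arrow in `Ω` from a map of edges which is monotone, reflects comparability, and lifts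
leaves. -/
def homOfEdges (F : S.Edge → T.Edge) (mono : ∀ x y, x ≤ y → F x ≤ F y)
    (comparable : ∀ x y, F x ≤ F y → x ≤ y ∨ y ≤ x)
    (leaf : ∀ x, ∀ l ∈ T.leaves, F x ≤ l → ∃ y ∈ S.leaves, x ≤ y ∧ F y ≤ l) : S ⟶ T :=
  homMk F fun n c d h =>
    { le := fun j => mono _ _ (h.le j)
      eq_of_le := fun j j' hj => (comparable _ _ hj).elim (h.eq_of_le j j')
        fun h' => (h.eq_of_le j' j h').symm
      not_leaf := fun x hx hj hl => by
        obtain ⟨y, hy, hdy, hyx⟩ := leaf _ x hl hx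
        exact h.not_leaf y hdy (fun j hjy => hj j ((mono _ _ hjy).trans hyx)) hy }

@[simp] lemma edge_homOfEdges (F : S.Edge → T.Edge) (h₁ h₂ h₃) (x : S.Edge) :
    edge (homOfEdges (T := T) F h₁ h₂ h₃) x = F x := rfl

/-! ### Injective arrows and their images -/

lemma le_of_edge_le {f : S ⟶ T} (hf : Function.Injective (edge f)) {x y : S.Edge}
    (h : edge f x ≤ edge f y) : x ≤ y := by
  rcases comparable_of_edge_le f h with h' | h'
  · exact h'
  · exact (hf (h.antisymm (edge_mono f h'))).le

/-- Arrows are determined by their edges, so those that are injective on edges are monomorphisms. -/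
lemma eq_of_comp_eq {i : D ⟶ T} (hi : Function.Injective (edge i)) {a b : R ⟶ D}
    (h : a ≫ i = b ≫ i) : a = b := by
  ext x
  apply hi
  rw [← edge_comp, h, edge_comp]

/-- As `i` reflects the order, the conditions of `homOfEdges` can be checked in `T`. The hypothesis
on leaves is needed because a leaf of `D` need not be a leaf of `T`, so `g` alone provides no leaf
of `R` below it. -/
lemma exists_lift {i : D ⟶ T} (hi : Function.Injective (edge i)) (g : R ⟶ T)
    (hg : ∀ x, ∃ z, edge i z = edge g x)
    (leaf : ∀ x, ∀ l ∈ D.leaves, edge g x ≤ edge i l →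
      ∃ y ∈ R.leaves, x ≤ y ∧ edge g y ≤ edge i l) : ∃ a : R ⟶ D, a ≫ i = g := by
  choose F hF using hg
  refine ⟨homOfEdges F (fun x y h => le_of_edge_le hi ?_) (fun x y h => ?_)
    (fun x l hl h => ?_), ?_⟩
  · rw [hF, hF]; exact edge_mono g h
  · refine comparable_of_edge_le g ?_
    rw [← hF, ← hF]; exact edge_mono i h
  · obtain ⟨y, hy, hxy, h'⟩ := leaf x l hl (by rw [← hF]; exact edge_mono i h)
    exact ⟨y, hy, hxy, le_of_edge_le hi (by rwa [hF])⟩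
  · ext x
    simp [hF]

/-- Two arrows to `T` with the same edges and the same leaves. -/
structure SameImage (i : D ⟶ T) (i' : D' ⟶ T) : Prop where
  range : Set.range (edge i) = Set.range (edge i')
  leaves : edge i '' D.leaves = edge i' '' D'.leaves

lemma SameImage.symm {i : D ⟶ T} {i' : D' ⟶ T} (h : SameImage i i') : SameImage i' i :=
  ⟨h.1.symm, h.2.symm⟩

lemma SameImage.exists_lift {i : D ⟶ T} {i' : D' ⟶ T} (h : SameImage i i')
    (hi : Function.Injective (edge i)) (hi' : Function.Injective (edge i')) :
    ∃ a : D ⟶ D', a ≫ i' = i := by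
  refine DTree.exists_lift hi' i (fun x => ?_) fun x l hl hx => ?_
  · have : edge i x ∈ Set.range (edge i') := h.1 ▸ ⟨x, rfl⟩
    exact this
  · have : edge i' l ∈ edge i '' D.leaves := h.2 ▸ ⟨l, hl, rfl⟩
    obtain ⟨y, hy, hyl⟩ := this
    exact ⟨y, hy, le_of_edge_le hi (by rwa [hyl]), hyl.le⟩

lemma Face.edge_hom_injective : (F : Face T) → Function.Injective (DTree.edge F.hom)
  | .inner _ _ => Subtype.val_injective
  | .top _ _ => Subtype.val_injective
  | .bottom _ _ => Subtype.val_injective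
  | .edge _ _ => fun _ _ _ => rfl

lemma sameImage_inner {i : D ⟶ T} {e : T.Edge} (he : T.IsInner e)
    (h : ∀ x, x ∈ Set.range (edge i) ↔ x ≠ e) (hl : ∀ x, x ∈ edge i '' D.leaves ↔ x ∈ T.leaves) :
    SameImage i (Face.inner e he).hom where
  range := by
    ext x
    rw [h]
    exact ⟨fun hx => ⟨⟨x, hx⟩, rfl⟩, by rintro ⟨y, rfl⟩; exact y.2⟩
  leaves := by
    ext x
    rw [hl]
    exact ⟨fun hx => ⟨⟨x, fun h => he.2 (h ▸ hx)⟩, hx, rfl⟩, by rintro ⟨y, hy, rfl⟩; exact hy⟩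

lemma sameImage_top {i : D ⟶ T} {e : T.Edge} (he : T.IsTop e)
    (h : ∀ x, x ∈ Set.range (edge i) ↔ ¬ e < x)
    (hl : ∀ x, x ∈ edge i '' D.leaves ↔ (x ∈ T.leaves ∨ x = e) ∧ ¬ e < x) :
    SameImage i (Face.top e he).hom where
  range := by
    ext x
    rw [h]
    exact ⟨fun hx => ⟨⟨x, hx⟩, rfl⟩, by rintro ⟨y, rfl⟩; exact y.2⟩
  leaves := by
    ext x
    rw [hl]
    exact ⟨fun hx => ⟨⟨x, hx.2⟩, hx.1, rfl⟩, by rintro ⟨y, hy, rfl⟩; exact ⟨hy, y.2⟩⟩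

lemma sameImage_bottom {i : D ⟶ T} {e : T.Edge} (he : T.IsOnlyInner e)
    (h : ∀ x, x ∈ Set.range (edge i) ↔ e ≤ x)
    (hl : ∀ x, x ∈ edge i '' D.leaves ↔ x ∈ T.leaves ∧ e ≤ x) :
    SameImage i (Face.bottom e he).hom where
  range := by
    ext x
    rw [h]
    exact ⟨fun hx => ⟨⟨x, hx⟩, rfl⟩, by rintro ⟨y, rfl⟩; exact y.2⟩
  leaves := by
    ext x
    rw [hl]
    exact ⟨fun hx => ⟨⟨x, hx.2⟩, hx.1, rfl⟩, by rintro ⟨y, hy, rfl⟩; exact ⟨hy, y.2⟩⟩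

end DTree

open DTree

variable {X : DSet.{u}} {R T D₁ D₂ : DTree}

/-! ### Gluing dendrices along faces -/

/-- A dendrex of a tree over `T`. -/
structure Piece (X : DSet.{u}) (T : DTree) where
  /-- The shape of the dendrex. -/
  dom : DTree
  /-- The arrow to `T`. -/
  hom : dom ⟶ T
  /-- The dendrex. -/
  val : X.obj (op dom)

/-- Two dendrices over `T` are compatible if they agree wherever both are defined. -/
def Piece.Compatible (p q : Piece X T) : Prop :=
  ∀ ⦃R : DTree⦄ (a : R ⟶ p.dom) (b : R ⟶ q.dom), a ≫ p.hom = b ≫ q.hom →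
    pull a p.val = pull b q.val

lemma Piece.Compatible.symm {p q : Piece X T} (h : p.Compatible q) : q.Compatible p :=
  fun _ a b hab => (h b a hab.symm).symm

lemma Piece.compatible_self {p : Piece X T} (h : Function.Injective (edge p.hom)) :
    p.Compatible p := fun _ a b hab => by rw [eq_of_comp_eq h hab]

/-- In an inner Kan complex, compatible dendrices on the faces of an inner horn extend. -/
theorem IsInnerKan.exists_glue (hX : IsInnerKan X) {e : T.Edge} (he : T.IsInner e)
    (P : Set (Piece X T)) (inj : ∀ p ∈ P, Function.Injective (edge p.hom))
    (compat : ∀ p ∈ P, ∀ q ∈ P, p.Compatible q)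
    (face : ∀ F : Face T, F ≠ .inner e he → ∃ p ∈ P, SameImage p.hom F.hom)
    (piece : ∀ p ∈ P, ∃ F : Face T, F ≠ .inner e he ∧ SameImage p.hom F.hom) :
    ∃ x : X.obj (op T), ∀ p ∈ P, pull p.hom x = p.val := by
  -- The horn is the union of the ranges of its faces. Faces and pieces factor through each other,
  -- so its elements are the arrows that factor through a piece.
  have mem : ∀ {R : DTreeᵒᵖ} (g : R.unop ⟶ T),
      (ULift.up g : (uliftYoneda.{u}.obj T : DSet.{u}).obj R) ∈ (innerHorn T e he).obj R ↔
      ∃ p ∈ P, ∃ a : R.unop ⟶ p.dom, a ≫ p.hom = g := by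
    intro R g
    rw [innerHorn, Subfunctor.iSup_obj]
    constructor
    · intro h
      obtain ⟨⟨F, hF⟩, ⟨⟨a⟩, ha⟩⟩ := Set.mem_iUnion.1 h
      obtain ⟨p, hp, hpF⟩ := face F hF
      obtain ⟨b, hb⟩ := hpF.symm.exists_lift F.edge_hom_injective (inj p hp)
      refine ⟨p, hp, a ≫ b, ?_⟩
      have : a ≫ F.hom = g := congrArg ULift.down ha
      rw [Category.assoc, hb, this]
    · rintro ⟨p, hp, a, rfl⟩
      obtain ⟨F, hF, hpF⟩ := piece p hp
      obtain ⟨b, hb⟩ := hpF.exists_lift (inj p hp) F.edge_hom_injective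
      refine Set.mem_iUnion.2 ⟨⟨F, hF⟩, ⟨⟨a ≫ b⟩, ?_⟩⟩
      change ULift.up ((a ≫ b) ≫ F.hom) = _
      rw [Category.assoc, hb]
  -- By compatibility, the value at an arrow does not depend on the piece or on the factorisation.
  have uniq : ∀ (R : DTreeᵒᵖ) (g : (innerHorn.{u} T e he).toFunctor.obj R),
      ∃ y : X.obj R, ∀ p ∈ P, ∀ a : R.unop ⟶ p.dom, a ≫ p.hom = g.1.down →
        y = pull a p.val := by
    intro R g
    obtain ⟨p, hp, a, ha⟩ := (mem g.1.down).1 g.2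
    exact ⟨pull a p.val, fun q hq b hb => compat p hp q hq a b (ha.trans hb.symm)⟩
  choose φ hφ using uniq
  let Φ : (innerHorn.{u} T e he).toFunctor ⟶ X :=
    { app := fun R => ↾(φ R)
      naturality := by
        intro R R' f
        ext g
        obtain ⟨p, hp, a, ha⟩ := (mem g.1.down).1 g.2
        change φ R' _ = X.map f (φ R g)
        rw [hφ R g p hp a ha, hφ R' _ p hp (f.unop ≫ a)
          (by rw [Category.assoc, ha]; rfl)]
        exact (pull_pull _ _ _).symm }
  obtain ⟨y, hy⟩ := hX T e he Φ
  -- By Yoneda, the dendrex is the value of the extension at the identity of `T`.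
  refine ⟨y.app (op T) ⟨𝟙 T⟩, fun p hp => ?_⟩
  have hm : (ULift.up p.hom : (uliftYoneda.{u}.obj T : DSet.{u}).obj (op p.dom)) ∈
      (innerHorn T e he).obj (op p.dom) := (mem (R := op p.dom) p.hom).2 ⟨p, hp, 𝟙 _, by simp⟩
  have h1 : y.app (op p.dom) ⟨p.hom⟩ = φ (op p.dom) ⟨_, hm⟩ := by
    have := congrArg (fun t => t.app (op p.dom) ⟨_, hm⟩) hy
    exact this
  have h2 := hφ (op p.dom) ⟨_, hm⟩ p hp (𝟙 _) (by simp)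
  have h3 := NatTrans.naturality_apply y p.hom.op ⟨𝟙 T⟩
  refine h3.symm.trans ?_
  have h4 : (uliftYoneda.{u}.obj T : DSet.{u}).map p.hom.op ⟨𝟙 T⟩ = ⟨p.hom⟩ := by
    change ULift.up (p.hom ≫ 𝟙 T) = _
    rw [Category.comp_id]
  rw [h4, h1, h2]
  simp [pull]

/-- An edge `t` shared by two trees over `T` is terminal if one of these trees has a leaf above
`t` such that `t` is the last shared edge on the path from `t` to this leaf. -/
def Terminal (i₁ : D₁ ⟶ T) (i₂ : D₂ ⟶ T) (t : T.Edge) : Prop :=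
  ∃ l, (l ∈ edge i₁ '' D₁.leaves ∨ l ∈ edge i₂ '' D₂.leaves) ∧ t ≤ l ∧
    ∀ s ∈ Set.range (edge i₁), s ∈ Set.range (edge i₂) → t ≤ s → s ≤ l → s = t

lemma terminal_left {i₁ : D₁ ⟶ T} {i₂ : D₂ ⟶ T} {x : D₁.Edge} (hx : x ∈ D₁.leaves) :
    Terminal i₁ i₂ (edge i₁ x) :=
  ⟨_, Or.inl ⟨x, hx, rfl⟩, le_rfl, fun _ _ _ h h' => h'.antisymm h⟩

lemma terminal_right {i₁ : D₁ ⟶ T} {i₂ : D₂ ⟶ T} {x : D₂.Edge} (hx : x ∈ D₂.leaves) :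
    Terminal i₁ i₂ (edge i₂ x) :=
  ⟨_, Or.inr ⟨x, hx, rfl⟩, le_rfl, fun _ _ _ h h' => h'.antisymm h⟩

/-- Whichever tree has `l` as the image of a leaf, the arrow from `R` to that tree provides the leaf
of `R`; both composites to `T` agree, so the result can be expressed through `a`. -/
lemma exists_leaf_of_le {i₁ : D₁ ⟶ T} {i₂ : D₂ ⟶ T} (h₁ : Function.Injective (edge i₁))
    (h₂ : Function.Injective (edge i₂)) {a : R ⟶ D₁} {b : R ⟶ D₂} (hab : a ≫ i₁ = b ≫ i₂)
    {l : T.Edge} (hl : l ∈ edge i₁ '' D₁.leaves ∨ l ∈ edge i₂ '' D₂.leaves) {x : R.Edge}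
    (hx : edge i₁ (edge a x) ≤ l) : ∃ y ∈ R.leaves, x ≤ y ∧ edge i₁ (edge a y) ≤ l := by
  have key : ∀ y, edge i₁ (edge a y) = edge i₂ (edge b y) := fun y => by
    rw [← edge_comp, hab, edge_comp]
  rcases hl with ⟨l, hl, rfl⟩ | ⟨l, hl, rfl⟩
  · obtain ⟨y, hy, hxy, h⟩ := exists_leaf_of_edge_le a hl (le_of_edge_le h₁ hx)
    exact ⟨y, hy, hxy, edge_mono i₁ h⟩
  · rw [key] at hx
    obtain ⟨y, hy, hxy, h⟩ := exists_leaf_of_edge_le b hl (le_of_edge_le h₂ hx)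
    exact ⟨y, hy, hxy, (key y).trans_le (edge_mono i₂ h)⟩

/-- A map of trees which is constant and has a leaf factors through an edge. -/
lemma exists_eq_ofEdge (a : R ⟶ T) {y : R.Edge} (hy : y ∈ R.leaves)
    (h : edge a y = edge a R.root) : ∃ r : R ⟶ eta, a = r ≫ T.ofEdge (edge a R.root) := by
  have hc : ∀ x, x ≤ y := fun x => by
    rcases comparable_of_edge_le a (h.trans_le (edge_mono a (R.root_le x))) with h' | h'
    · exact (R.leaf_max y hy x h').le
    · exact h'
  refine ⟨homOfEdges (fun _ => ()) (fun _ _ _ => le_rfl) (fun x x' _ => R.linear x x' y (hc x) (hc x'))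
    (fun x _ _ _ => ⟨y, hy, hc x, le_rfl⟩), ?_⟩
  ext x
  exact ((edge_mono a (hc x)).trans h.le).antisymm (edge_mono a (R.root_le x))

/-- The dendrices `p` and `q` over `T` agree on a corolla with root `t` such that no tree
that maps to both sees more above `t` than this corolla. -/
structure SharedCorolla (p q : Piece X T) (t : T.Edge) {n : ℕ} (c₁ : Fin n → p.dom.Edge)
    (d₁ : p.dom.Edge) (c₂ : Fin n → q.dom.Edge) (d₂ : q.dom.Edge) : Prop where
  left : p.dom.IsOp c₁ d₁
  right : q.dom.IsOp c₂ d₂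
  root_left : edge p.hom d₁ = t
  root_right : edge q.hom d₂ = t
  inputs : ∀ j, edge p.hom (c₁ j) = edge q.hom (c₂ j)
  ne : ∀ j, c₁ j ≠ d₁
  agree : pull (p.dom.ofOp left) p.val = pull (q.dom.ofOp right) q.val
  terminal : ∀ j, Terminal p.hom q.hom (edge p.hom (c₁ j))
  above : ∀ s ∈ Set.range (edge p.hom), s ∈ Set.range (edge q.hom) → t ≤ s → s ≠ t →
    ∃ j, edge p.hom (c₁ j) ≤ s

/-- The root of `R` goes to a shared edge `t`. If `t` is terminal, some leaf of `R` also goes to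
`t`, so `R` collapses to an edge and equality of colours suffices. Otherwise there is a shared
corolla at `t`: either a leaf of `R` still goes to `t`, or both arrows factor through this corolla,
where `p` and `q` agree. -/
theorem Piece.compatible_of_shared {p q : Piece X T} (hp : Function.Injective (edge p.hom))
    (hq : Function.Injective (edge q.hom))
    (colour : ∀ x y, edge p.hom x = edge q.hom y → colourAt p.val x = colourAt q.val y)
    (shared : ∀ x y, edge p.hom x = edge q.hom y → Terminal p.hom q.hom (edge p.hom x) ∨
      ∃ (n : ℕ) (c₁ : Fin n → p.dom.Edge) (d₁ : p.dom.Edge) (c₂ : Fin n → q.dom.Edge)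
        (d₂ : q.dom.Edge), SharedCorolla p q (edge p.hom x) c₁ d₁ c₂ d₂) :
    p.Compatible q := by
  intro R a b hab
  have key : ∀ y, edge p.hom (edge a y) = edge q.hom (edge b y) := fun y => by
    rw [← edge_comp, hab, edge_comp]
  -- A leaf with the same image as the root makes `R` a chain that is sent to one edge, and both
  -- arrows factor through the same map to `η`.
  have hconst : ∀ y ∈ R.leaves, edge p.hom (edge a y) = edge p.hom (edge a R.root) →
      pull a p.val = pull b q.val := by
    intro y hy h
    obtain ⟨r, hr⟩ := exists_eq_ofEdge a hy (hp h)
    have hr' : b = r ≫ q.dom.ofEdge (edge b R.root) := by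
      apply eq_of_comp_eq hq
      rw [← hab, Category.assoc, ofEdge_comp, ← key, ← ofEdge_comp, ← Category.assoc, ← hr]
    rw [hr, hr', ← pull_pull, ← pull_pull]
    exact congrArg (pull r) (colour _ _ (key _))
  rcases shared _ _ (key R.root) with ⟨l, hl, htl, hs⟩ | ⟨n, c₁, d₁, c₂, d₂, H⟩
  · obtain ⟨y, hy, -, hyl⟩ := exists_leaf_of_le hp hq hab hl htl
    exact hconst y hy (hs _ ⟨_, rfl⟩ ⟨_, (key y).symm⟩
      (edge_mono _ (edge_mono _ (R.root_le y))) hyl)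
  by_cases hd : ∃ y ∈ R.leaves, edge p.hom (edge a y) = edge p.hom (edge a R.root)
  · obtain ⟨y, hy, h⟩ := hd
    exact hconst y hy h
  have hd' : edge a R.root = d₁ := hp H.root_left.symm
  have root_le : ∀ x, edge p.hom (edge a R.root) ≤ edge p.hom (edge a x) := fun x =>
    edge_mono _ (edge_mono _ (R.root_le x))
  have inputs_le : ∀ j j', edge p.hom (c₁ j) ≤ edge p.hom (c₁ j') → j = j' :=
    fun j j' h => H.left.eq_of_le _ _ (le_of_edge_le hp h)
  -- Let `l` be the leaf that makes `c₁ j` terminal. Some leaf of `R` above `x` has image below `l`.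
  -- This image is shared and differs from the root of the corolla, so it lies above an input; that
  -- input and `c₁ j` are both below `l`, hence equal. Terminality then forces the image to be `c₁
  -- j`.
  have hleaf : ∀ j x, edge p.hom (edge a x) ≤ edge p.hom (c₁ j) →
      ∃ y ∈ R.leaves, x ≤ y ∧ edge p.hom (edge a y) = edge p.hom (c₁ j) := by
    intro j x hx
    obtain ⟨l, hl, htl, hs⟩ := H.terminal j
    obtain ⟨y, hy, hxy, hyl⟩ := exists_leaf_of_le hp hq hab hl (hx.trans htl)
    refine ⟨y, hy, hxy, hs _ ⟨_, rfl⟩ ⟨_, (key y).symm⟩ ?_ hyl⟩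
    obtain ⟨j', hj'⟩ := H.above _ ⟨_, rfl⟩ ⟨_, (key y).symm⟩ (root_le y)
      fun h => hd ⟨y, hy, h⟩
    rcases T.linear _ _ _ (hj'.trans hyl) htl with h | h
    · rwa [inputs_le _ _ h] at hj'
    · rwa [← inputs_le _ _ h] at hj'
  have hroot : ∀ j, edge p.hom (edge a R.root) ≤ edge p.hom (c₁ j) := fun j => by
    rw [hd']; exact edge_mono _ (H.left.le j)
  -- No edge of `R` goes strictly above an input: by `hleaf` a leaf `y` of `R` goes to that input,
  -- and an edge `x` whose image lies above it is comparable with `y`, hence satisfies `x ≤ y`.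
  have hcase : ∀ x, edge a x = d₁ ∨ ∃ j, edge a x = c₁ j := by
    intro x
    by_cases h : edge p.hom (edge a x) = edge p.hom (edge a R.root)
    · exact Or.inl (hp (h.trans (congrArg _ hd')))
    obtain ⟨j, hj⟩ := H.above _ ⟨_, rfl⟩ ⟨_, (key x).symm⟩ (root_le x) h
    obtain ⟨y, hy, -, hyj⟩ := hleaf j R.root (hroot j)
    refine Or.inr ⟨j, hp (le_antisymm ?_ hj)⟩
    rw [← hyj] at hj ⊢
    rcases comparable_of_edge_le (a ≫ p.hom) hj with h' | h'
    · rw [R.leaf_max y hy x h']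
    · exact edge_mono _ (edge_mono _ h')
  have hcase' : ∀ x, ∃ z : (corolla n).Edge, edge (p.dom.ofOp H.left) z = edge a x := by
    intro x
    rcases hcase x with h | ⟨j, h⟩
    · exact ⟨CorollaEdge.root, h.symm⟩
    · exact ⟨CorollaEdge.leaf j, h.symm⟩
  have hinj : Function.Injective (edge (p.dom.ofOp H.left)) := by
    rintro (_ | j) (_ | j') h
    · rfl
    · exact absurd h.symm (H.ne j')
    · exact absurd h (H.ne j)
    · exact congrArg _ (H.left.eq_of_le j j' (le_of_eq h))
  obtain ⟨r, hr⟩ := DTree.exists_lift hinj a hcase' (by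
    rintro x (_ | j) hl hx
    · exact absurd rfl hl
    · obtain ⟨y, hy, hxy, h⟩ := hleaf j x (edge_mono p.hom hx)
      exact ⟨y, hy, hxy, (hp h).le⟩)
  have hr' : b = r ≫ q.dom.ofOp H.right := by
    apply eq_of_comp_eq hq
    refine hab.symm.trans ((congrArg (· ≫ p.hom) hr.symm).trans ?_)
    simp only [Category.assoc]
    congr 1
    ext x
    rcases x with _ | j
    · exact H.root_left.trans H.root_right.symm
    · exact H.inputs j
  rw [← hr, hr', ← pull_pull, ← pull_pull, H.agree]

lemma exists_shuffle {n m k : ℕ} {i : Fin n} (φ : Shuffle n m k i) {P : Fin n ⊕ Fin m → Prop} :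
    (∃ l, P (φ l).1) ↔ (∃ j, j ≠ i ∧ P (Sum.inl j)) ∨ ∃ t, P (Sum.inr t) := by
  rw [φ.exists_congr_left (p := fun l => P (φ l).1)]
  simp [Subtype.exists, Sum.exists]

namespace DTree

/-! ### Edges of corollas and of trees with two vertices -/

section

variable {n : ℕ}

/-- The root of the corolla. -/
def corollaRoot (n : ℕ) : (corolla n).Edge := CorollaEdge.root

/-- The input `j` of the corolla. -/
def corollaLeaf (j : Fin n) : (corolla n).Edge := CorollaEdge.leaf j

lemma corolla_cases (x : (corolla n).Edge) : x = corollaRoot n ∨ ∃ j, x = corollaLeaf j := by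
  rcases x with _ | j
  exacts [Or.inl rfl, Or.inr ⟨j, rfl⟩]

lemma exists_corolla {P : (corolla n).Edge → Prop} :
    (∃ z, P z) ↔ P (corollaRoot n) ∨ ∃ j, P (corollaLeaf j) := by
  constructor
  · rintro ⟨x, h⟩
    obtain rfl | ⟨j, rfl⟩ := corolla_cases x
    exacts [Or.inl h, Or.inr ⟨j, h⟩]
  · rintro (h | ⟨j, h⟩)
    exacts [⟨_, h⟩, ⟨_, h⟩]

@[simp] lemma corollaRoot_notMem_leaves : corollaRoot n ∉ (corolla n).leaves := fun h => h rfl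

@[simp] lemma corollaLeaf_mem_leaves (j : Fin n) : corollaLeaf j ∈ (corolla n).leaves := nofun

variable {c : Fin n → T.Edge} {d : T.Edge} (h : T.IsOp c d)

end

section

variable {n m : ℕ} {i : Fin n}

/-- The root of `Cₙ ∘ᵢ Cₘ`. -/
def graftRoot (n m : ℕ) (i : Fin n) : (graft n m i).Edge := GraftEdge.root

/-- The inputs of the lower vertex of `Cₙ ∘ᵢ Cₘ`. -/
def graftLow (m : ℕ) (i j : Fin n) : (graft n m i).Edge := GraftEdge.low j

/-- The inputs of the upper vertex of `Cₙ ∘ᵢ Cₘ`. -/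
def graftHigh (i : Fin n) (t : Fin m) : (graft n m i).Edge := GraftEdge.high t

lemma graft_cases (x : (graft n m i).Edge) :
    x = graftRoot n m i ∨ (∃ j, x = graftLow m i j) ∨ ∃ t, x = graftHigh i t := by
  rcases x with _ | j | t
  exacts [Or.inl rfl, Or.inr (Or.inl ⟨j, rfl⟩), Or.inr (Or.inr ⟨t, rfl⟩)]

lemma exists_graft {P : (graft n m i).Edge → Prop} :
    (∃ z, P z) ↔ P (graftRoot n m i) ∨ (∃ j, P (graftLow m i j)) ∨ ∃ t, P (graftHigh i t) := by
  constructor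
  · rintro ⟨x, h⟩
    obtain rfl | ⟨j, rfl⟩ | ⟨t, rfl⟩ := graft_cases x
    exacts [Or.inl h, Or.inr (Or.inl ⟨j, h⟩), Or.inr (Or.inr ⟨t, h⟩)]
  · rintro (h | ⟨j, h⟩ | ⟨t, h⟩)
    exacts [⟨_, h⟩, ⟨_, h⟩, ⟨_, h⟩]

@[simp] lemma graft_root : (graft n m i).root = graftRoot n m i := rfl

@[simp] lemma graftLow_inj {j j' : Fin n} : graftLow m i j = graftLow m i j' ↔ j = j' :=
  ⟨fun h => GraftEdge.low.inj h, fun h => h ▸ rfl⟩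

@[simp] lemma graftHigh_inj {t t' : Fin m} : graftHigh i t = graftHigh i t' ↔ t = t' :=
  ⟨fun h => GraftEdge.high.inj h, fun h => h ▸ rfl⟩

@[simp] lemma graftLow_ne_root (j : Fin n) : graftLow m i j ≠ graftRoot n m i := nofun

@[simp] lemma graftRoot_ne_low (j : Fin n) : graftRoot n m i ≠ graftLow m i j := nofun

@[simp] lemma graftHigh_ne_root (t : Fin m) : graftHigh i t ≠ graftRoot n m i := nofun

@[simp] lemma graftRoot_ne_high (t : Fin m) : graftRoot n m i ≠ graftHigh i t := nofun

@[simp] lemma graftLow_ne_high (j : Fin n) (t : Fin m) : graftLow m i j ≠ graftHigh i t := nofun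

@[simp] lemma graftHigh_ne_low (j : Fin n) (t : Fin m) : graftHigh i t ≠ graftLow m i j := nofun

@[simp] lemma graftRoot_le (x : (graft n m i).Edge) : graftRoot n m i ≤ x := Or.inl rfl

lemma graft_le_iff {x y : (graft n m i).Edge} :
    x ≤ y ↔ x = graftRoot n m i ∨ x = y ∨ (x = graftLow m i i ∧ ∃ t, y = graftHigh i t) := Iff.rfl

@[simp] lemma graftLow_le_root (j : Fin n) : ¬ graftLow m i j ≤ graftRoot n m i := by
  simp [graft_le_iff]

@[simp] lemma graftLow_le_low {j j' : Fin n} : graftLow m i j ≤ graftLow m i j' ↔ j = j' := by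
  simp [graft_le_iff]

@[simp] lemma graftLow_le_high {j : Fin n} {t : Fin m} :
    graftLow m i j ≤ graftHigh i t ↔ j = i := by
  simp [graft_le_iff]

@[simp] lemma graftHigh_le_root (t : Fin m) : ¬ graftHigh i t ≤ graftRoot n m i := by
  simp [graft_le_iff]

@[simp] lemma graftHigh_le_low {t : Fin m} {j : Fin n} :
    ¬ graftHigh i t ≤ graftLow m i j := by
  simp [graft_le_iff]

@[simp] lemma graftHigh_le_high {t t' : Fin m} : graftHigh i t ≤ graftHigh i t' ↔ t = t' := by
  simp [graft_le_iff]

@[simp] lemma graftRoot_notMem_leaves : graftRoot n m i ∉ (graft n m i).leaves := fun h => h.1 rfl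

@[simp] lemma graftLow_mem_leaves {j : Fin n} : graftLow m i j ∈ (graft n m i).leaves ↔ j ≠ i :=
  ⟨fun h h' => h.2 (h' ▸ rfl), fun h => ⟨nofun, fun h' => h (graftLow_inj.1 h')⟩⟩

@[simp] lemma graftHigh_mem_leaves (t : Fin m) : graftHigh i t ∈ (graft n m i).leaves :=
  ⟨nofun, nofun⟩

end

/-! ### Arrows from trees with two vertices -/

/-- A function on the edges of `Cₙ ∘ᵢ Cₘ`, given by its values at the root, at the inputs of the
lower vertex, and at the inputs of the upper vertex. -/
def GraftEdge.elim {n m : ℕ} {i : Fin n} {E : Type*} (d : E) (c : Fin n → E) (b : Fin m → E) :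
    GraftEdge n m i → E
  | .root => d
  | .low j => c j
  | .high t => b t

section

variable {n m : ℕ} {c : Fin n → T.Edge} {d : T.Edge} {b : Fin m → T.Edge} {e : T.Edge}

/-- The arrow `Cₙ ∘ᵢ Cₘ ⟶ T` given by two composable operations of `Ω(T)`. -/
def graftHom (i : Fin n) (hf : T.IsOp c d) (hg : T.IsOp b e) (he : c i = e) :
    graft n m i ⟶ T :=
  homOfEdges (S := graft n m i) (GraftEdge.elim d c b)
    (by
      subst he
      rintro x y (rfl | rfl | ⟨rfl, t, rfl⟩)
      · rcases y with _ | j | t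
        exacts [le_rfl, hf.le j, (hf.le i).trans (hg.le t)]
      · exact le_rfl
      · exact hg.le t)
    (by
      subst he
      rintro (_ | j | t) (_ | j' | t') h
      · exact Or.inl le_rfl
      · exact Or.inl (Or.inl rfl)
      · exact Or.inl (Or.inl rfl)
      · exact Or.inr (Or.inl rfl)
      · rw [hf.eq_of_le j j' h]; exact Or.inl le_rfl
      · have : j = i := by
          rcases T.linear _ _ _ h (hg.le t') with h' | h'
          · exact hf.eq_of_le _ _ h'
          · exact (hf.eq_of_le _ _ h').symm
        subst this
        exact Or.inl (Or.inr (Or.inr ⟨rfl, t', rfl⟩))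
      · exact Or.inr (Or.inl rfl)
      · obtain rfl := hf.eq_of_le _ _ ((hg.le t).trans h)
        exact Or.inr (Or.inr (Or.inr ⟨rfl, t, rfl⟩))
      · rw [hg.eq_of_le t t' h]; exact Or.inl le_rfl)
    (by
      subst he
      have high : ∀ l ∈ T.leaves, c i ≤ l → ∃ t, b t ≤ l := fun l hl h => by
        by_contra hb
        exact hg.not_leaf l h (fun t ht => hb ⟨t, ht⟩) hl
      have low : ∀ l ∈ T.leaves, d ≤ l → ∃ j, c j ≤ l := fun l hl h => by
        by_contra hb
        exact hf.not_leaf l h (fun t ht => hb ⟨t, ht⟩) hl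
      have leaf_low : ∀ j, j ≠ i → (GraftEdge.low j : GraftEdge n m i) ∈ (graft n m i).leaves :=
        fun j hj => ⟨by simp, by simpa using hj⟩
      have leaf_high : ∀ t, (GraftEdge.high t : GraftEdge n m i) ∈ (graft n m i).leaves :=
        fun j => ⟨by simp, by simp⟩
      rintro (_ | j | t) l hl h
      · obtain ⟨j, hj⟩ := low l hl h
        by_cases hji : j = i
        · subst hji
          obtain ⟨t, ht⟩ := high l hl hj
          exact ⟨_, leaf_high t, Or.inl rfl, ht⟩
        · exact ⟨_, leaf_low j hji, Or.inl rfl, hj⟩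
      · by_cases hji : j = i
        · subst hji
          obtain ⟨t, ht⟩ := high l hl h
          exact ⟨_, leaf_high t, Or.inr (Or.inr ⟨rfl, t, rfl⟩), ht⟩
        · exact ⟨_, leaf_low j hji, le_rfl, h⟩
      · exact ⟨_, leaf_high t, le_rfl, h⟩)

section

variable (i : Fin n) (hf : T.IsOp c d) (hg : T.IsOp b e) (he : c i = e)

@[simp] lemma edge_graftHom_root : edge (graftHom i hf hg he) (graftRoot n m i) = d := rfl

@[simp] lemma edge_graftHom_low (j : Fin n) :
    edge (graftHom i hf hg he) (graftLow m i j) = c j := rfl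

@[simp] lemma edge_graftHom_high (t : Fin m) :
    edge (graftHom i hf hg he) (graftHigh i t) = b t := rfl

end

/-- The hypotheses say that neither operation is a unit. An input of the upper one that is also an
input of the lower one would lie above `c i`, hence equal `c i` by incomparability. -/
lemma graftHom_injective {i : Fin n} {hf : T.IsOp c d} {hg : T.IsOp b e} {he : c i = e}
    (hc : ∀ j, c j ≠ d) (hb : ∀ t, b t ≠ e) : Function.Injective (edge (graftHom i hf hg he)) := by
  subst he
  have hbd : ∀ t, b t ≠ d := fun t h =>
    hc i (((hg.le t).trans h.le).antisymm (hf.le i))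
  have hbc : ∀ t j, b t ≠ c j := fun t j h => by
    obtain rfl := hf.eq_of_le _ _ ((hg.le t).trans h.le)
    exact hb t h
  rintro (_ | j | t) (_ | j' | t') h
  · rfl
  · exact absurd h.symm (hc j')
  · exact absurd h.symm (hbd t')
  · exact absurd h (hc j)
  · rw [hf.eq_of_le j j' (le_of_eq h)]
  · exact absurd h.symm (hbc t' j)
  · exact absurd h (hbd t)
  · exact absurd h (hbc t j')
  · rw [hg.eq_of_le t t' (le_of_eq h)]

end

/-! ### Grafting a corolla onto a leaf -/

/-- The edges of the tree obtained by grafting a corolla with `p` inputs onto `l`. -/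
inductive GraftOnEdge (l : T.Edge) (p : ℕ) : Type
  | base (x : T.Edge) : GraftOnEdge l p
  | top (t : Fin p) : GraftOnEdge l p

namespace GraftOnEdge

variable {l : T.Edge} {p : ℕ}

/-- The order on the edges. -/
def Le : GraftOnEdge l p → GraftOnEdge l p → Prop
  | base x, base y => x ≤ y
  | base x, top _ => x ≤ l
  | top _, base _ => False
  | top t, top t' => t = t'

end GraftOnEdge

/-- The tree obtained by grafting a corolla with `p` inputs onto the leaf `l` of `T`. -/
def graftOn (T : DTree) (l : T.Edge) (_hl : l ∈ T.leaves) (p : ℕ) : DTree where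
  Edge := GraftOnEdge l p
  order :=
    { le := GraftOnEdge.Le
      le_refl := by rintro (x | t); exacts [le_rfl (a := x), rfl]
      le_trans := by
        rintro (x | t) (y | t') (z | t'') h h'
        · exact le_trans (α := T.Edge) h h'
        · exact le_trans (α := T.Edge) h h'
        · exact h'.elim
        · exact h
        · exact h.elim
        · exact h.elim
        · exact h'.elim
        · exact Eq.trans (α := Fin p) h h'
      le_antisymm := by
        rintro (x | t) (y | t') h h'
        · exact congrArg _ (le_antisymm (α := T.Edge) h h')
        · exact h'.elim
        · exact h.elim
        · exact congrArg _ h }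
  finite := Finite.of_injective (β := T.Edge ⊕ Fin p)
    (fun x => match x with
      | .base x => Sum.inl x
      | .top t => Sum.inr t)
    (by rintro (_ | _) (_ | _) h <;> simp_all)
  root := .base T.root
  leaves := {x | match x with
    | .base x => x ∈ T.leaves ∧ x ≠ l
    | .top _ => True}
  root_le := by rintro (x | t); exacts [T.root_le x, T.root_le l]
  linear := by
    rintro (x | t) (y | t') (z | t'') h h'
    · exact T.linear x y z h h'
    · exact T.linear x y l h h'
    · exact h'.elim
    · exact Or.inl h
    · exact h.elim
    · exact Or.inr h'
    · exact h.elim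
    · exact Or.inl (Eq.trans (α := Fin p) h (Eq.symm (α := Fin p) h'))
  leaf_max := by
    rintro (x | t) hx (y | t') h
    · exact congrArg _ (T.leaf_max x hx.1 y h)
    · exact absurd (T.leaf_max x hx.1 l h).symm hx.2
    · exact h.elim
    · exact congrArg _ (Eq.symm (α := Fin p) h)

section

variable {l : T.Edge} {hl : l ∈ T.leaves} {p : ℕ}

/-- An edge of `T`, as an edge of the tree obtained by grafting a corolla onto `l`. -/
def onBase (hl : l ∈ T.leaves) (p : ℕ) (x : T.Edge) : (T.graftOn l hl p).Edge := GraftOnEdge.base x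

/-- An input of the grafted corolla. -/
def onTop (hl : l ∈ T.leaves) (t : Fin p) : (T.graftOn l hl p).Edge := GraftOnEdge.top t

lemma graftOn_cases (x : (T.graftOn l hl p).Edge) :
    (∃ y, x = onBase hl p y) ∨ ∃ t, x = onTop hl t := by
  rcases x with y | t
  exacts [Or.inl ⟨y, rfl⟩, Or.inr ⟨t, rfl⟩]

@[simp] lemma onBase_inj {x y : T.Edge} : onBase hl p x = onBase hl p y ↔ x = y :=
  ⟨fun h => GraftOnEdge.base.inj h, fun h => h ▸ rfl⟩

@[simp] lemma onTop_inj {t t' : Fin p} : onTop hl t = onTop hl t' ↔ t = t' :=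
  ⟨fun h => GraftOnEdge.top.inj h, fun h => h ▸ rfl⟩

@[simp] lemma onBase_ne_top (x : T.Edge) (t : Fin p) : onBase hl p x ≠ onTop hl t := nofun

@[simp] lemma onTop_ne_base (x : T.Edge) (t : Fin p) : onTop hl t ≠ onBase hl p x := nofun

@[simp] lemma base_le_base {x y : T.Edge} : onBase hl p x ≤ onBase hl p y ↔ x ≤ y := Iff.rfl

@[simp] lemma base_le_top {x : T.Edge} {t : Fin p} : onBase hl p x ≤ onTop hl t ↔ x ≤ l := Iff.rfl

@[simp] lemma base_mem_leaves {x : T.Edge} :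
    onBase hl p x ∈ (T.graftOn l hl p).leaves ↔ x ∈ T.leaves ∧ x ≠ l := Iff.rfl

@[simp] lemma top_mem_leaves {t : Fin p} : onTop hl t ∈ (T.graftOn l hl p).leaves := trivial

@[simp] lemma graftOn_root : (T.graftOn l hl p).root = onBase hl p T.root := rfl

/-- The inclusion of `T` into the tree obtained by grafting a corolla onto a leaf. -/
def graftOnHom (hl : l ∈ T.leaves) (p : ℕ) : T ⟶ T.graftOn l hl p :=
  homOfEdges (onBase hl p) (fun _ _ h => h) (fun _ _ h => Or.inl h) (by
    rintro x (y | t) hy h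
    · exact ⟨y, hy.1, h, le_rfl⟩
    · exact ⟨l, hl, h, le_rfl (a := l)⟩)

@[simp] lemma edge_graftOnHom (x : T.Edge) :
    edge (graftOnHom hl p) x = onBase hl p x := rfl

lemma graftOnHom_injective : Function.Injective (edge (graftOnHom hl p)) :=
  fun _ _ h => onBase_inj.1 h

/-- The grafted corolla, as an operation. -/
lemma isOp_onTop (hl : l ∈ T.leaves) (p : ℕ) :
    (T.graftOn l hl p).IsOp (fun t : Fin p => onTop hl t) (onBase hl p l) where
  le t := le_refl l
  eq_of_le _ _ h := h
  not_leaf := by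
    rintro (x | t) h h'
    · rintro ⟨-, hx⟩
      exact hx (T.leaf_max l hl x h)
    · exact absurd rfl (h' t)

end

lemma ofOp_congr {n : ℕ} {c c' : Fin n → T.Edge} {d d' : T.Edge} (h : T.IsOp c d)
    (h' : T.IsOp c' d') (hc : ∀ j, c j = c' j) (hd : d = d') : T.ofOp h = T.ofOp h' := by
  obtain rfl : c = c' := funext hc
  subst hd
  rfl

end DTree

/-- An operation of `Ω(T)` is determined by its inputs and output, so restrictions to corollas can
be compared by comparing edges alone. -/
lemma pull_ofOp_pull {S T : DTree} (f : S ⟶ T) (x : X.obj (op T)) {n : ℕ} {c : Fin n → S.Edge}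
    {c' : Fin n → T.Edge} {d : S.Edge} {d' : T.Edge} (h : S.IsOp c d) (h' : T.IsOp c' d')
    (hc : ∀ j, edge f (c j) = c' j) (hd : edge f d = d') :
    pull (S.ofOp h) (pull f x) = pull (T.ofOp h') x := by
  rw [pull_pull, ofOp_comp, ofOp_congr _ h' hc hd]

/-- Each dendrex of shape `T` gives compositions of its restrictions to the operations
of `Ω(T)`. -/
lemma isComposite_pull (x : X.obj (op T)) {n m k : ℕ} {c : Fin n → T.Edge} {d : T.Edge}
    {b : Fin m → T.Edge} {e : T.Edge} {a : Fin k → T.Edge} (i : Fin n) (φ : Shuffle n m k i)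
    (hf : T.IsOp c d) (hg : T.IsOp b e) (h : T.IsOp a d) (he : c i = e)
    (ha : ∀ l, a l = Sum.elim c b (φ l).1) :
    IsComposite i φ (pull (T.ofOp hf) x) (pull (T.ofOp hg) x) (pull (T.ofOp h) x) := by
  refine ⟨pull (graftHom i hf hg he) x, pull_ofOp_pull _ _ _ _ (fun _ => rfl) rfl,
    pull_ofOp_pull _ _ _ _ (fun _ => rfl) he, pull_ofOp_pull _ _ _ _ (fun l => ?_) rfl⟩
  rw [ha]
  rcases (φ l).1 with j | t <;> rfl

/-! ### Existence of compositions -/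

lemma input_pull {n : ℕ} {c : Fin n → T.Edge} {d : T.Edge} (h : T.IsOp c d) (x : X.obj (op T))
    (j : Fin n) : input (pull (T.ofOp h) x) j = colourAt x (c j) :=
  colourAt_pull _ _ _

lemma output_pull {n : ℕ} {c : Fin n → T.Edge} {d : T.Edge} (h : T.IsOp c d) (x : X.obj (op T)) :
    output (pull (T.ofOp h) x) = colourAt x d :=
  colourAt_pull _ _ _

lemma colourAt_graft {n m : ℕ} {i : Fin n} {γ : X.obj (op (graft n m i))}
    {f : X.obj (op (corolla n))} {g : X.obj (op (corolla m))}
    (hf : pull ((graft n m i).ofOp (isOp_low n m i)) γ = f)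
    (hg : pull ((graft n m i).ofOp (isOp_high n m i)) γ = g) (z : (graft n m i).Edge) :
    colourAt γ z = GraftEdge.elim (output f) (input f) (input g) z := by
  subst hf hg
  rcases z with _ | j | t
  exacts [(output_pull _ _).symm, (input_pull _ _ _).symm, (input_pull _ _ _).symm]

lemma input_eq_of_graft {n m k : ℕ} {i : Fin n} {φ : Shuffle n m k i}
    {γ : X.obj (op (graft n m i))}
    {f : X.obj (op (corolla n))} {g : X.obj (op (corolla m))} {h : X.obj (op (corolla k))}
    (hf : pull ((graft n m i).ofOp (isOp_low n m i)) γ = f)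
    (hg : pull ((graft n m i).ofOp (isOp_high n m i)) γ = g)
    (hh : pull ((graft n m i).ofOp (isOp_graft φ)) γ = h) (l : Fin k) :
    input h l = Sum.elim (input f) (input g) (φ l).1 := by
  subst hh
  refine (colourAt_pull _ _ _).trans ((colourAt_graft hf hg _).trans ?_)
  change GraftEdge.elim _ _ _ (graftInput (φ l).1) = _
  rcases (φ l).1 with j | t <;> rfl

lemma output_eq_of_graft {n m k : ℕ} {i : Fin n} {φ : Shuffle n m k i}
    {γ : X.obj (op (graft n m i))}
    {f : X.obj (op (corolla n))} {h : X.obj (op (corolla k))}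
    (hf : pull ((graft n m i).ofOp (isOp_low n m i)) γ = f)
    (hh : pull ((graft n m i).ofOp (isOp_graft φ)) γ = h) :
    output h = output f := by
  subst hf hh
  exact (output_pull _ _).trans (output_pull _ _).symm

lemma ofOp_injective {n : ℕ} {c : Fin n → T.Edge} {d : T.Edge} {h : T.IsOp c d}
    (hc : ∀ j, c j ≠ d) : Function.Injective (edge (T.ofOp h)) := by
  rintro (_ | j) (_ | j') h'
  · rfl
  · exact absurd h'.symm (hc j')
  · exact absurd h' (hc j)
  · rw [h.eq_of_le j j' (le_of_eq h')]

/-- The two outer faces are the corollas of the two vertices, and they meet only in the inner edge.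
Thus a map from the horn amounts to `f` and `g` with the same colour on that edge. -/
theorem IsInnerKan.exists_graft (hX : IsInnerKan X) {n m : ℕ} (i : Fin n)
    (f : X.obj (op (corolla n))) (g : X.obj (op (corolla m))) (hfg : input f i = output g) :
    ∃ γ : X.obj (op (graft n m i)),
      pull ((graft n m i).ofOp (isOp_low n m i)) γ = f ∧
      pull ((graft n m i).ofOp (isOp_high n m i)) γ = g := by
  have he : (graft n m i).IsInner (graftLow m i i) := ⟨by simp, by simp⟩
  have ht : (graft n m i).IsTop (graftLow m i i) := ⟨he, fun x h => by
    have := h.le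
    have := h.ne
    obtain rfl | ⟨j, rfl⟩ | ⟨t, rfl⟩ := graft_cases x <;> simp_all⟩
  have hb : (graft n m i).IsOnlyInner (graftLow m i i) := ⟨he, fun x => by
    obtain rfl | ⟨j, rfl⟩ | ⟨t, rfl⟩ := graft_cases x <;> simp
    tauto⟩
  have inner_eq : ∀ x, (graft n m i).IsInner x → x = graftLow m i i := fun x ⟨h, h'⟩ => by
    obtain rfl | ⟨j, rfl⟩ | ⟨t, rfl⟩ := graft_cases x <;> simp_all
  let p : Piece X (graft n m i) := ⟨_, (graft n m i).ofOp (isOp_low n m i), f⟩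
  let q : Piece X (graft n m i) := ⟨_, (graft n m i).ofOp (isOp_high n m i), g⟩
  have hp : Function.Injective (edge p.hom) :=
    ofOp_injective (h := isOp_low n m i) nofun
  have hq : Function.Injective (edge q.hom) :=
    ofOp_injective (h := isOp_high n m i) nofun
  have hpq : p.Compatible q := by
    refine Piece.compatible_of_shared hp hq ?_ ?_
    · rintro (_ | j) (_ | t) h
      · cases h
      · cases h
      · cases h
        exact hfg
      · cases h
    -- The root of the lower corolla is not shared, and its other edges are leaves, hence terminal;
    -- no shared corolla is needed.
    · rintro (_ | j) y h
      · rcases y with _ | t <;> cases h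
      · exact Or.inl (terminal_left (corollaLeaf_mem_leaves j))
  have p_root : edge p.hom (corollaRoot n) = graftRoot n m i := rfl
  have p_leaf : ∀ j, edge p.hom (corollaLeaf j) = graftLow m i j := fun _ => rfl
  have q_root : edge q.hom (corollaRoot m) = graftLow m i i := rfl
  have q_leaf : ∀ j, edge q.hom (corollaLeaf j) = graftHigh i j := fun _ => rfl
  have hp' : SameImage p.hom (Face.top _ ht).hom := by
    refine sameImage_top ht (fun x => ?_) (fun x => ?_) <;>
    obtain rfl | ⟨j, rfl⟩ | ⟨t, rfl⟩ := graft_cases x <;>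
    simp [exists_corolla, p_root, p_leaf, lt_iff_le_and_ne, p]
    tauto
  have hq' : SameImage q.hom (Face.bottom _ hb).hom := by
    refine sameImage_bottom hb (fun x => ?_) (fun x => ?_) <;>
    obtain rfl | ⟨j, rfl⟩ | ⟨t, rfl⟩ := graft_cases x <;>
    simp [exists_corolla, q_root, q_leaf, q]
    tauto
  obtain ⟨x, hx⟩ := hX.exists_glue he {p, q} (by rintro _ (rfl | rfl) <;> assumption)
    (by
      rintro _ (rfl | rfl) _ (rfl | rfl)
      exacts [Piece.compatible_self hp, hpq, hpq.symm, Piece.compatible_self hq])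
    (by
      rintro (⟨e, he'⟩ | ⟨e, he'⟩ | ⟨e, he'⟩ | ⟨h, e⟩) hF
      · obtain rfl := inner_eq e he'
        exact absurd rfl hF
      · obtain rfl := inner_eq e he'.1
        exact ⟨p, Or.inl rfl, hp'⟩
      · obtain rfl := inner_eq e he'.1
        exact ⟨q, Or.inr rfl, hq'⟩
      · exact absurd ((h _).1 he.2) he.1)
    (by
      rintro _ (rfl | rfl)
      · exact ⟨_, by simp, hp'⟩
      · exact ⟨_, by simp, hq'⟩)
  exact ⟨x, hx p (Or.inl rfl), hx q (Or.inr rfl)⟩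

/-- This is the form for trees with four faces: a horn has three of them, and each is represented by
a piece with the same edges and leaves. -/
theorem IsInnerKan.exists_glue_three (hX : IsInnerKan X) {e : T.Edge} (he : T.IsInner e)
    (p q r : Piece X T) {F G H : Face T} (all : ∀ F', F' = .inner e he ∨ F' = F ∨ F' = G ∨ F' = H)
    (hF : F ≠ .inner e he) (hG : G ≠ .inner e he) (hH : H ≠ .inner e he)
    (hp : Function.Injective (edge p.hom)) (hq : Function.Injective (edge q.hom))
    (hr : Function.Injective (edge r.hom)) (hpF : SameImage p.hom F.hom)
    (hqG : SameImage q.hom G.hom) (hrH : SameImage r.hom H.hom) (hpq : p.Compatible q)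
    (hpr : p.Compatible r) (hqr : q.Compatible r) :
    ∃ x : X.obj (op T), pull p.hom x = p.val ∧ pull q.hom x = q.val ∧ pull r.hom x = r.val := by
  obtain ⟨x, hx⟩ := hX.exists_glue he {p, q, r} (by rintro _ (rfl | rfl | rfl) <;> assumption)
    (by
      rintro _ (rfl | rfl | rfl) _ (rfl | rfl | rfl)
      exacts [Piece.compatible_self hp, hpq, hpr, hpq.symm, Piece.compatible_self hq, hqr,
        hpr.symm, hqr.symm, Piece.compatible_self hr])
    (by
      intro F' hF'
      rcases all F' with rfl | rfl | rfl | rfl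
      exacts [absurd rfl hF', ⟨p, by simp, hpF⟩, ⟨q, by simp, hqG⟩, ⟨r, by simp, hrH⟩])
    (by
      rintro _ (rfl | rfl | rfl)
      exacts [⟨F, hF, hpF⟩, ⟨G, hG, hqG⟩, ⟨H, hH, hrH⟩])
  exact ⟨x, hx p (by simp), hx q (by simp), hx r (by simp)⟩

/-! ### Leaves of two-vertex trees and enumerated inputs of compositions -/

lemma mem_image_graftHom {n m : ℕ} {c : Fin n → T.Edge} {d : T.Edge} {b : Fin m → T.Edge}
    {e : T.Edge} {i : Fin n} {hf : T.IsOp c d} {hg : T.IsOp b e} {he : c i = e} {x : T.Edge} :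
    x ∈ edge (graftHom i hf hg he) '' (graft n m i).leaves ↔
      (∃ j, j ≠ i ∧ c j = x) ∨ ∃ t, b t = x := by
  simp [exists_graft]

lemma exists_elim_shuffle {n m k : ℕ} {i : Fin n} (φ : Shuffle n m k i) {E : Type*}
    {c : Fin n → E} {b : Fin m → E} {x : E} :
    (∃ l, Sum.elim c b (φ l).1 = x) ↔ (∃ j, j ≠ i ∧ c j = x) ∨ ∃ t, b t = x :=
  exists_shuffle φ (P := fun y => Sum.elim c b y = x)

/-- For the leaves of an inner face: the input `l₀` of the composed vertex carries the remaining
vertex and so is not a leaf. Its label `y` may come from either of the two composed vertices. -/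
lemma exists_ne_elim_shuffle {n m k : ℕ} {i : Fin n} (φ : Shuffle n m k i) {E : Type*}
    {c : Fin n → E} {b : Fin m → E} {x : E} {l₀ : Fin k} {y : Fin n ⊕ Fin m}
    (hy : (φ l₀).1 = y) : (∃ l, l ≠ l₀ ∧ Sum.elim c b (φ l).1 = x) ↔
      (∃ j, j ≠ i ∧ Sum.inl j ≠ y ∧ c j = x) ∨ ∃ t, Sum.inr t ≠ y ∧ b t = x := by
  subst hy
  refine Iff.trans ?_ (exists_shuffle φ (P := fun z => z ≠ (φ l₀).1 ∧ Sum.elim c b z = x))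
  simp only [ne_eq, ← Subtype.ext_iff, φ.injective.eq_iff]

/-- Used with `x` the contracted edge, which an inner face must miss, and with `x` the output of the
composition, to get injectivity of the face. -/
lemma elim_shuffle_ne {n m k : ℕ} {i : Fin n} (φ : Shuffle n m k i) {E : Type*}
    {c : Fin n → E} {b : Fin m → E} {x : E} (hc : ∀ j, j ≠ i → c j ≠ x) (hb : ∀ t, b t ≠ x) (l) :
    Sum.elim c b (φ l).1 ≠ x := fun h => by
  rcases (exists_elim_shuffle φ).1 ⟨l, h⟩ with ⟨j, hj, h⟩ | ⟨t, h⟩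
  exacts [hc j hj h, hb t h]

/-! ### Edges of trees with three vertices -/

section

variable {n m : ℕ} {i : Fin n} {l : (graft n m i).Edge} {hl : l ∈ (graft n m i).leaves} {p : ℕ}

lemma graftOn_graft_cases (x : ((graft n m i).graftOn l hl p).Edge) :
    x = onBase hl p (graftRoot n m i) ∨ (∃ j, x = onBase hl p (graftLow m i j)) ∨
      (∃ t, x = onBase hl p (graftHigh i t)) ∨ ∃ t, x = onTop hl t := by
  obtain ⟨y, rfl⟩ | ⟨t, rfl⟩ := graftOn_cases x
  · obtain rfl | ⟨j, rfl⟩ | ⟨t, rfl⟩ := graft_cases y <;> simp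
  · simp

lemma isInner_graftOn_graft {x : ((graft n m i).graftOn l hl p).Edge} :
    ((graft n m i).graftOn l hl p).IsInner x ↔
      x = onBase hl p (graftLow m i i) ∨ x = onBase hl p l := by
  have h1 : l ≠ graftRoot n m i := fun h => graftRoot_notMem_leaves (h ▸ hl)
  obtain rfl | ⟨j, rfl⟩ | ⟨t, rfl⟩ | ⟨t, rfl⟩ := graftOn_graft_cases x <;>
    simp [IsInner, h1.symm, eq_comm (b := l)]
  tauto

variable (hl p)

lemma isOp_baseLow : ((graft n m i).graftOn l hl p).IsOp
    (fun j : Fin n => onBase hl p (graftLow m i j)) (onBase hl p (graftRoot n m i)) :=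
  isOp_edge (graftOnHom hl p) (isOp_low n m i)

lemma isOp_baseHigh : ((graft n m i).graftOn l hl p).IsOp
    (fun t : Fin m => onBase hl p (graftHigh i t)) (onBase hl p (graftLow m i i)) :=
  isOp_edge (graftOnHom hl p) (isOp_high n m i)

end

/-! ### Three vertices on top of each other -/

section

variable (n m p : ℕ) (i : Fin n) (j : Fin m)

/-- The tree `Cₙ ∘ᵢ (Cₘ ∘ⱼ Cₚ)`. -/
abbrev seqTree : DTree := (graft n m i).graftOn (graftHigh i j) (graftHigh_mem_leaves j) p

/-- The inclusion of the two lower vertices. -/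
abbrev seqLower : graft n m i ⟶ seqTree n m p i j := graftOnHom (graftHigh_mem_leaves j) p

/-- The inclusion of the two upper vertices. -/
abbrev seqUpper : graft m p j ⟶ seqTree n m p i j :=
  graftHom j (isOp_baseHigh _ p) (isOp_onTop _ p) rfl

variable {n m p i j}

/-- The inner face that composes the two upper vertices. -/
abbrev seqComposeUpper {s : ℕ} (ψ' : Shuffle m p s j) : graft n s i ⟶ seqTree n m p i j :=
  graftHom i (isOp_baseLow _ p)
    (IsOp.circ j ψ' rfl (fun _ => rfl) (isOp_baseHigh _ p) (isOp_onTop _ p)) rfl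

/-- The inner face that composes the two lower vertices. -/
abbrev seqComposeLower {r : ℕ} (φ : Shuffle n m r i) {j' : Fin r} (hj : (φ j').1 = Sum.inr j) :
    graft r p j' ⟶ seqTree n m p i j :=
  graftHom j' (IsOp.circ i φ rfl (fun _ => rfl) (isOp_baseLow _ p) (isOp_baseHigh _ p))
    (isOp_onTop _ p) (by rw [hj]; rfl)

/-- The inner edge between the two lower vertices. -/
abbrev seqLow (n m p : ℕ) (i : Fin n) (j : Fin m) : (seqTree n m p i j).Edge :=
  onBase (graftHigh_mem_leaves j) p (graftLow m i i)

/-- The inner edge between the two upper vertices. -/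
abbrev seqHigh (n m p : ℕ) (i : Fin n) (j : Fin m) : (seqTree n m p i j).Edge :=
  onBase (graftHigh_mem_leaves j) p (graftHigh i j)

lemma isInner_seqLow : (seqTree n m p i j).IsInner (seqLow n m p i j) :=
  isInner_graftOn_graft.2 (Or.inl rfl)

lemma isInner_seqHigh : (seqTree n m p i j).IsInner (seqHigh n m p i j) :=
  isInner_graftOn_graft.2 (Or.inr rfl)

lemma isTop_seqHigh : (seqTree n m p i j).IsTop (seqHigh n m p i j) :=
  ⟨isInner_seqHigh, fun x h => by
    have := h.le
    have := h.ne
    obtain rfl | ⟨j, rfl⟩ | ⟨t, rfl⟩ | ⟨t, rfl⟩ := graftOn_graft_cases x <;> simp_all⟩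

lemma isOnlyInner_seqLow : (seqTree n m p i j).IsOnlyInner (seqLow n m p i j) :=
  ⟨isInner_seqLow, fun x => by
    obtain rfl | ⟨j, rfl⟩ | ⟨t, rfl⟩ | ⟨t, rfl⟩ := graftOn_graft_cases x <;> simp
    tauto⟩

/-- The middle vertex is not a top vertex, because the edge `seqHigh` above it is not a leaf. Nor is
`seqHigh` the only inner edge at the root vertex, because `seqLow` is inner and not above it. -/
lemma seqTree_face (F : Face (seqTree n m p i j)) :
    F = .inner _ isInner_seqLow ∨ F = .inner _ isInner_seqHigh ∨ F = .top _ isTop_seqHigh ∨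
      F = .bottom _ isOnlyInner_seqLow := by
  rcases F with ⟨e, he⟩ | ⟨e, he⟩ | ⟨e, he⟩ | ⟨h, e⟩
  · obtain rfl | rfl := isInner_graftOn_graft.1 he <;> simp
  · obtain rfl | rfl := isInner_graftOn_graft.1 he.1
    · have := he.2 (seqHigh n m p i j) (by simp [lt_iff_le_and_ne])
      simp at this
    · simp
  · obtain rfl | rfl := isInner_graftOn_graft.1 he.1
    · simp
    · have := he.2 (seqLow n m p i j)
      simp at this
  · exact absurd ((h _).1 isInner_seqLow.2) isInner_seqLow.1

lemma sameImage_seqLower :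
    SameImage (seqLower n m p i j) (Face.top _ (isTop_seqHigh (n := n) (i := i) (j := j))).hom := by
  refine sameImage_top _ (fun x => ?_) (fun x => ?_) <;>
  obtain rfl | ⟨j, rfl⟩ | ⟨t, rfl⟩ | ⟨t, rfl⟩ := graftOn_graft_cases x <;>
  simp [lt_iff_le_and_ne]
  tauto

lemma sameImage_seqUpper : SameImage (seqUpper n m p i j)
    (Face.bottom _ (isOnlyInner_seqLow (n := n) (i := i) (j := j))).hom := by
  refine sameImage_bottom _ (fun x => ?_) (fun x => ?_) <;>
  obtain rfl | ⟨j, rfl⟩ | ⟨t, rfl⟩ | ⟨t, rfl⟩ := graftOn_graft_cases x <;>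
  simp [exists_graft]
  tauto

lemma sameImage_seqComposeUpper {s : ℕ} (ψ' : Shuffle m p s j) :
    SameImage (seqComposeUpper (i := i) ψ') (Face.inner _ (isInner_seqHigh (i := i))).hom := by
  refine sameImage_inner _ (fun x => ?_) (fun x => ?_) <;>
  obtain rfl | ⟨j, rfl⟩ | ⟨t, rfl⟩ | ⟨t, rfl⟩ := graftOn_graft_cases x <;>
  simp [exists_graft, exists_elim_shuffle]

lemma sameImage_seqComposeLower {r : ℕ} (φ : Shuffle n m r i) {j' : Fin r}
    (hj : (φ j').1 = Sum.inr j) : SameImage (seqComposeLower (p := p) φ hj)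
      (Face.inner _ (isInner_seqLow (i := i))).hom := by
  refine sameImage_inner _ (fun x => ?_) (fun x => ?_)
  · obtain rfl | ⟨j, rfl⟩ | ⟨t, rfl⟩ | ⟨t, rfl⟩ := graftOn_graft_cases x <;>
    simp [exists_graft, exists_elim_shuffle]
  · rw [mem_image_graftHom, exists_ne_elim_shuffle φ hj]
    obtain rfl | ⟨j, rfl⟩ | ⟨t, rfl⟩ | ⟨t, rfl⟩ := graftOn_graft_cases x <;> simp

lemma seqLower_injective : Function.Injective (edge (seqLower n m p i j)) := graftOnHom_injective

lemma seqUpper_injective : Function.Injective (edge (seqUpper n m p i j)) :=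
  graftHom_injective (by simp) (by simp)

lemma seqComposeUpper_injective {s : ℕ} (ψ' : Shuffle m p s j) :
    Function.Injective (edge (seqComposeUpper (i := i) ψ')) :=
  graftHom_injective (by simp) (elim_shuffle_ne ψ' (by simp) (by simp))

lemma seqComposeLower_injective {r : ℕ} (φ : Shuffle n m r i) {j' : Fin r}
    (hj : (φ j').1 = Sum.inr j) : Function.Injective (edge (seqComposeLower (p := p) φ hj)) :=
  graftHom_injective (elim_shuffle_ne φ (by simp) (by simp)) (by simp)

end

/-! ### Compatibility of faces and sequential associativity -/

section

variable {n m p r s k : ℕ} {i : Fin n} {j : Fin m} {j' : Fin r}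
  {φ : Shuffle n m r i} {ψ : Shuffle r p k j'} {ψ' : Shuffle m p s j} {φ' : Shuffle n s k i}
  {f : X.obj (op (corolla n))} {g : X.obj (op (corolla m))} {h : X.obj (op (corolla p))}
  {u : X.obj (op (corolla r))} {v : X.obj (op (corolla s))} {w : X.obj (op (corolla k))}

lemma colourAt_graftRoot {γ : X.obj (op (graft n m i))}
    (hf : pull ((graft n m i).ofOp (isOp_low n m i)) γ = f) :
    colourAt γ (graftRoot n m i) = output f := by
  subst hf
  exact (output_pull _ _).symm

lemma colourAt_graftLow {γ : X.obj (op (graft n m i))}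
    (hf : pull ((graft n m i).ofOp (isOp_low n m i)) γ = f) (j : Fin n) :
    colourAt γ (graftLow m i j) = input f j := by
  subst hf
  exact (input_pull _ _ _).symm

lemma colourAt_graftHigh {γ : X.obj (op (graft n m i))}
    (hg : pull ((graft n m i).ofOp (isOp_high n m i)) γ = g) (t : Fin m) :
    colourAt γ (graftHigh i t) = input g t := by
  subst hg
  exact (input_pull _ _ _).symm

lemma output_eq_input_of_graft {γ : X.obj (op (graft n m i))}
    (hf : pull ((graft n m i).ofOp (isOp_low n m i)) γ = f)
    (hg : pull ((graft n m i).ofOp (isOp_high n m i)) γ = g) : output g = input f i := by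
  subst hf hg
  exact (output_pull _ _).trans (input_pull _ _ _).symm

lemma IsComposite.output_right (hu : IsComposite i φ f g u) : output g = input f i := by
  obtain ⟨γ, hf, hg, -⟩ := hu
  exact output_eq_input_of_graft hf hg

lemma IsComposite.output_eq (hu : IsComposite i φ f g u) : output u = output f := by
  obtain ⟨γ, hf, -, hu⟩ := hu
  exact output_eq_of_graft hf hu

lemma IsComposite.input_eq (hu : IsComposite i φ f g u) (l : Fin r) :
    input u l = Sum.elim (input f) (input g) (φ l).1 := by
  obtain ⟨γ, hf, hg, hu⟩ := hu
  exact input_eq_of_graft hf hg hu l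

/-- The edge of `Cₙ ∘ᵢ Cₘ` given by an input of one of the two vertices. -/
def graftIn (i : Fin n) : Fin n ⊕ Fin m → (graft n m i).Edge := Sum.elim (graftLow m i) (graftHigh i)

@[simp] lemma graftIn_inl (j : Fin n) : graftIn (m := m) i (Sum.inl j) = graftLow m i j := rfl

@[simp] lemma graftIn_inr (t : Fin m) : graftIn i (Sum.inr t) = graftHigh i t := rfl

lemma graftIn_mem_leaves (φ : Shuffle n m r i) (l : Fin r) :
    graftIn i (φ l).1 ∈ (graft n m i).leaves := by
  have := (φ l).2
  rcases h : (φ l).1 with j | t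
  · rw [h] at this
    exact graftLow_mem_leaves.2 fun h => this (congrArg _ h)
  · exact graftHigh_mem_leaves t

lemma graftIn_ne_root (y : Fin n ⊕ Fin m) : graftIn i y ≠ graftRoot n m i := by
  rcases y with j | t <;> simp

lemma isOp_graftIn (φ : Shuffle n m r i) :
    (graft n m i).IsOp (fun l => graftIn i (φ l).1) (graftRoot n m i) := isOp_graft φ

lemma edge_seqLower_graftIn (y : Fin n ⊕ Fin m) : edge (seqLower n m p i j) (graftIn i y) =
    Sum.elim (fun j' => onBase (graftHigh_mem_leaves j) p (graftLow m i j'))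
      (fun t => onBase (graftHigh_mem_leaves j) p (graftHigh i t)) y := by
  rcases y with _ | _ <;> rfl

lemma edge_graftHom_graftIn {c : Fin n → T.Edge} {d : T.Edge} {b : Fin m → T.Edge} {e : T.Edge}
    (hf : T.IsOp c d) (hg : T.IsOp b e) (he : c i = e) (y : Fin n ⊕ Fin m) :
    edge (graftHom i hf hg he) (graftIn i y) = Sum.elim c b y := by
  rcases y with _ | _ <;> rfl

/-- By `hk`, both bracketings list the inputs of the three vertices in the same order, so they give
the same operation of the tree. -/
lemma elim_seq (hk : ∀ l, Equiv.sumAssoc _ _ _ (Sum.map (fun t => (φ t).1) id (ψ l).1) =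
      Sum.map id (fun t => (ψ' t).1) (φ' l).1) {E : Type*} (c : Fin n → E) (b : Fin m → E)
    (a : Fin p → E) (l : Fin k) : Sum.elim c (fun t => Sum.elim b a (ψ' t).1) (φ' l).1 =
      Sum.elim (fun t => Sum.elim c b (φ t).1) a (ψ l).1 := by
  have h1 : ∀ y, Sum.elim c (fun t => Sum.elim b a (ψ' t).1) y =
      Sum.elim c (Sum.elim b a) (Sum.map id (fun t => (ψ' t).1) y) := by
    rintro (_ | _) <;> rfl
  have h2 : ∀ y, Sum.elim (fun t => Sum.elim c b (φ t).1) a y =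
      Sum.elim c (Sum.elim b a) (Equiv.sumAssoc _ _ _ (Sum.map (fun t => (φ t).1) id y)) := by
    rintro (t | t)
    · rcases h : (φ t).1 with _ | _ <;> simp [h]
    · rfl
  rw [h1, h2, hk]

lemma edge_seqUpper_graftIn (y : Fin m ⊕ Fin p) : edge (seqUpper n m p i j) (graftIn j y) =
    Sum.elim (fun t => onBase (graftHigh_mem_leaves j) p (graftHigh i t))
      (onTop (graftHigh_mem_leaves j)) y :=
  edge_graftHom_graftIn _ _ _ _

/-- The faces share the middle vertex, which carries `g` in both, and its inputs are leaves of the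
lower face. -/
lemma compatible_seqLower_seqUpper {γ : X.obj (op (graft n m i))} {δ : X.obj (op (graft m p j))}
    (hf : pull ((graft n m i).ofOp (isOp_low n m i)) γ = f)
    (hg : pull ((graft n m i).ofOp (isOp_high n m i)) γ = g)
    (hg' : pull ((graft m p j).ofOp (isOp_low m p j)) δ = g) :
    Piece.Compatible ⟨_, seqLower n m p i j, γ⟩ ⟨_, seqUpper n m p i j, δ⟩ := by
  refine Piece.compatible_of_shared seqLower_injective seqUpper_injective (fun x y h => ?_)
    (fun x y h => ?_)
  · obtain rfl | ⟨j, rfl⟩ | ⟨t, rfl⟩ := graft_cases x <;>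
    obtain rfl | ⟨j', rfl⟩ | ⟨t', rfl⟩ := graft_cases y <;> simp at h
    · subst h
      rw [colourAt_graftLow hf, colourAt_graftRoot hg', output_eq_input_of_graft hf hg]
    · subst h
      rw [colourAt_graftHigh hg, colourAt_graftLow hg']
  · obtain rfl | ⟨j, rfl⟩ | ⟨t, rfl⟩ := graft_cases x
    · obtain rfl | ⟨j', rfl⟩ | ⟨t', rfl⟩ := graft_cases y <;> simp at h
    · obtain rfl | ⟨j', rfl⟩ | ⟨t', rfl⟩ := graft_cases y <;> simp at h
      subst h
      refine Or.inr ⟨_, _, _, _, _, isOp_high n m j, isOp_low m p _, rfl, rfl, fun _ => rfl, nofun,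
        hg.trans hg'.symm, fun t => terminal_left (graftHigh_mem_leaves t), ?_⟩
      rintro _ ⟨x, rfl⟩ ⟨y, hy⟩ h h'
      obtain rfl | ⟨j', rfl⟩ | ⟨t', rfl⟩ := graft_cases y
      · exact absurd hy.symm h'
      · exact ⟨j', hy.le⟩
      · obtain rfl | ⟨j', rfl⟩ | ⟨t', rfl⟩ := graft_cases x <;> simp at hy
    · exact Or.inl (terminal_left (graftHigh_mem_leaves t))

/-- The shared corolla is the vertex at the root, with `f`. The inputs of `g` other than `j` are
shared as well, but only as leaves. -/
lemma compatible_seqLower_seqComposeUpper {γ : X.obj (op (graft n m i))}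
    {δ : X.obj (op (graft n s i))}
    (hf : pull ((graft n m i).ofOp (isOp_low n m i)) γ = f)
    (hg : pull ((graft n m i).ofOp (isOp_high n m i)) γ = g)
    (hv : IsComposite j ψ' g h v)
    (hf' : pull ((graft n s i).ofOp (isOp_low n s i)) δ = f)
    (hv' : pull ((graft n s i).ofOp (isOp_high n s i)) δ = v) :
    Piece.Compatible ⟨_, seqLower n m p i j, γ⟩ ⟨_, seqComposeUpper ψ', δ⟩ := by
  have high : ∀ t', Sum.elim (fun t => onBase (graftHigh_mem_leaves j) p (graftHigh i t))
      (onTop (graftHigh_mem_leaves j)) (ψ' t').1 ≠ seqHigh n m p i j :=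
    elim_shuffle_ne ψ' (by simp) (by simp)
  have low : ∀ j', Terminal (seqLower n m p i j) (seqComposeUpper (i := i) ψ')
      (onBase (graftHigh_mem_leaves j) p (graftLow m i j')) := by
    intro j'
    by_cases hj : j' = i
    · subst hj
      -- The input `i` is a leaf of neither face. It is terminal because the leaf `seqHigh` of the
      -- lower face lies above it and the other face misses this edge.
      refine ⟨seqHigh n m p j' j, Or.inl ⟨_, graftHigh_mem_leaves j, rfl⟩, by simp, ?_⟩
      rintro _ ⟨x, rfl⟩ ⟨y, hy⟩ h h'
      obtain rfl | ⟨j', rfl⟩ | ⟨t', rfl⟩ := graft_cases x <;> simp at h h' ⊢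
      · exact h.symm
      · subst h'
        obtain rfl | ⟨j', rfl⟩ | ⟨t', rfl⟩ := graft_cases y <;> simp at hy
        exact high t' hy
    · exact terminal_left (graftLow_mem_leaves.2 hj)
  refine Piece.compatible_of_shared seqLower_injective (seqComposeUpper_injective _)
    (fun x y h => ?_) (fun x y h => ?_)
  · obtain rfl | ⟨j, rfl⟩ | ⟨t, rfl⟩ := graft_cases y
    · obtain rfl | ⟨j, rfl⟩ | ⟨t, rfl⟩ := graft_cases x <;> simp at h
      rw [colourAt_graftRoot hf, colourAt_graftRoot hf']
    · obtain rfl | ⟨j, rfl⟩ | ⟨t, rfl⟩ := graft_cases x <;> simp at h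
      rw [h, colourAt_graftLow hf, colourAt_graftLow hf']
    · rw [colourAt_graftHigh hv', hv.input_eq]
      simp only [edge_graftOnHom, edge_graftHom_high] at h
      rcases hz : (ψ' t).1 with t' | t' <;> rw [hz] at h
      · obtain rfl : x = graftHigh i t' := by simpa using h
        exact colourAt_graftHigh hg _
      · simp at h
  · obtain rfl | ⟨j, rfl⟩ | ⟨t, rfl⟩ := graft_cases x
    · refine Or.inr ⟨_, _, _, _, _, isOp_low n m i, isOp_low n s i, rfl, rfl, fun _ => rfl, nofun,
        hf.trans hf'.symm, low, ?_⟩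
      rintro _ ⟨x, rfl⟩ - h h'
      obtain rfl | ⟨j', rfl⟩ | ⟨t', rfl⟩ := graft_cases x
      · exact absurd rfl h'
      · exact ⟨j', le_rfl⟩
      · exact ⟨i, Or.inr (Or.inr ⟨rfl, t', rfl⟩)⟩
    · exact Or.inl (low j)
    · exact Or.inl (terminal_left (graftHigh_mem_leaves t))

/-- The shared corolla is the inner face of `γ` and the upper vertex of `δ`; both are `v`. The
contracted edge is the only edge of the upper face that is not shared. -/
lemma compatible_seqUpper_seqComposeUpper {γ : X.obj (op (graft m p j))}
    {δ : X.obj (op (graft n s i))}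
    (hv : pull ((graft m p j).ofOp (isOp_graft ψ')) γ = v)
    (hv' : pull ((graft n s i).ofOp (isOp_high n s i)) δ = v) :
    Piece.Compatible ⟨_, seqUpper n m p i j, γ⟩ ⟨_, seqComposeUpper ψ', δ⟩ := by
  have high : ∀ t', Sum.elim (fun t => onBase (graftHigh_mem_leaves j) p (graftHigh i t))
      (onTop (graftHigh_mem_leaves j)) (ψ' t').1 ≠ seqHigh n m p i j :=
    elim_shuffle_ne ψ' (by simp) (by simp)
  refine Piece.compatible_of_shared seqUpper_injective (seqComposeUpper_injective _)
    (fun x y h => ?_) (fun x y h => ?_)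
  · obtain rfl | ⟨j', rfl⟩ | ⟨t, rfl⟩ := graft_cases y
    · obtain rfl | ⟨j, rfl⟩ | ⟨t, rfl⟩ := graft_cases x <;> simp at h
    · obtain rfl | ⟨j, rfl⟩ | ⟨t, rfl⟩ := graft_cases x <;> simp at h
      subst h
      exact (output_pull (isOp_graft ψ') γ).symm.trans
        ((congrArg output (hv.trans hv'.symm)).trans (output_pull (isOp_high n s i) δ))
    · obtain rfl : x = graftIn j (ψ' t).1 := seqUpper_injective (i := i)
        (h.trans (edge_seqUpper_graftIn _).symm)
      exact (input_pull (isOp_graft ψ') γ t).symm.trans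
        ((congrArg (input · t) (hv.trans hv'.symm)).trans (input_pull (isOp_high n s i) δ t))
  · obtain rfl | ⟨t, rfl⟩ | ⟨t, rfl⟩ := graft_cases x
    · refine Or.inr ⟨_, _, _, _, _, isOp_graftIn ψ', isOp_high n s i, rfl, rfl,
        fun l => edge_seqUpper_graftIn _, fun l => graftIn_ne_root _,
        hv.trans hv'.symm, fun l => terminal_left (graftIn_mem_leaves ψ' l), ?_⟩
      rintro _ ⟨x, rfl⟩ ⟨y, hy⟩ h h'
      obtain rfl | ⟨j', rfl⟩ | ⟨t', rfl⟩ := graft_cases y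
      · obtain rfl | ⟨j, rfl⟩ | ⟨t, rfl⟩ := graft_cases x <;> simp at hy
      · obtain rfl | ⟨j, rfl⟩ | ⟨t, rfl⟩ := graft_cases x <;> simp at hy h'
      · exact ⟨t', (edge_seqUpper_graftIn _).trans hy |>.le⟩
    · by_cases ht : t = j
      · subst ht
        obtain rfl | ⟨j', rfl⟩ | ⟨t', rfl⟩ := graft_cases y <;> simp at h
        exact absurd h.symm (high t')
      · exact Or.inl (terminal_left (graftLow_mem_leaves.2 ht))
    · exact Or.inl (terminal_left (graftHigh_mem_leaves t))

/-- Here the shared corolla is the inner face of `γ` and the lower vertex of `δ`; both are `u`. -/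
lemma compatible_seqLower_seqComposeLower (hj : (φ j').1 = Sum.inr j)
    {γ : X.obj (op (graft n m i))} {δ : X.obj (op (graft r p j'))}
    (hu : pull ((graft n m i).ofOp (isOp_graft φ)) γ = u)
    (hu' : pull ((graft r p j').ofOp (isOp_low r p j')) δ = u) :
    Piece.Compatible ⟨_, seqLower n m p i j, γ⟩ ⟨_, seqComposeLower φ hj, δ⟩ := by
  have low : ∀ l, Sum.elim (fun j' => onBase (graftHigh_mem_leaves j) p (graftLow m i j'))
      (fun t => onBase (graftHigh_mem_leaves j) p (graftHigh i t)) (φ l).1 ≠ seqLow n m p i j :=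
    elim_shuffle_ne φ (by simp) (by simp)
  refine Piece.compatible_of_shared seqLower_injective (seqComposeLower_injective _ hj)
    (fun x y h => ?_) (fun x y h => ?_)
  · obtain rfl | ⟨l, rfl⟩ | ⟨t, rfl⟩ := graft_cases y
    · obtain rfl | ⟨j, rfl⟩ | ⟨t, rfl⟩ := graft_cases x <;> simp at h
      exact (output_pull (isOp_graft φ) γ).symm.trans
        ((congrArg output (hu.trans hu'.symm)).trans (output_pull (isOp_low r p j') δ))
    · obtain rfl : x = graftIn i (φ l).1 := seqLower_injective
        (h.trans (edge_seqLower_graftIn _).symm)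
      exact (input_pull (isOp_graft φ) γ l).symm.trans
        ((congrArg (input · l) (hu.trans hu'.symm)).trans (input_pull (isOp_low r p j') δ l))
    · obtain rfl | ⟨j, rfl⟩ | ⟨t, rfl⟩ := graft_cases x <;> simp at h
  · obtain rfl | ⟨t, rfl⟩ | ⟨t, rfl⟩ := graft_cases x
    · refine Or.inr ⟨_, _, _, _, _, isOp_graftIn φ, isOp_low r p j', rfl, rfl,
        fun l => edge_seqLower_graftIn _, fun l => graftIn_ne_root _,
        hu.trans hu'.symm, fun l => terminal_left (graftIn_mem_leaves φ l), ?_⟩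
      rintro _ ⟨x, rfl⟩ ⟨y, hy⟩ h h'
      obtain rfl | ⟨l, rfl⟩ | ⟨t', rfl⟩ := graft_cases y
      · exact absurd hy.symm h'
      · exact ⟨l, (edge_seqLower_graftIn _).trans hy |>.le⟩
      · obtain rfl | ⟨j, rfl⟩ | ⟨t, rfl⟩ := graft_cases x <;> simp at hy
    · by_cases ht : t = i
      · subst ht
        obtain rfl | ⟨l, rfl⟩ | ⟨t', rfl⟩ := graft_cases y <;> simp at h
        exact absurd h.symm (low l)
      · exact Or.inl (terminal_left (graftLow_mem_leaves.2 ht))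
    · exact Or.inl (terminal_left (graftHigh_mem_leaves t))

/-- Contracting `seqLow` removes the root of the upper face. What is shared is the top vertex, with
`h`, and the other inputs of `g`, whose colours are recovered from the inputs of `u`. -/
lemma compatible_seqUpper_seqComposeLower (hj : (φ j').1 = Sum.inr j)
    {γ : X.obj (op (graft m p j))} {δ : X.obj (op (graft r p j'))}
    (hu : IsComposite i φ f g u)
    (hg : pull ((graft m p j).ofOp (isOp_low m p j)) γ = g)
    (hh : pull ((graft m p j).ofOp (isOp_high m p j)) γ = h)
    (hu' : pull ((graft r p j').ofOp (isOp_low r p j')) δ = u)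
    (hh' : pull ((graft r p j').ofOp (isOp_high r p j')) δ = h) :
    Piece.Compatible ⟨_, seqUpper n m p i j, γ⟩ ⟨_, seqComposeLower φ hj, δ⟩ := by
  have low : ∀ l, Sum.elim (fun j' => onBase (graftHigh_mem_leaves j) p (graftLow m i j'))
      (fun t => onBase (graftHigh_mem_leaves j) p (graftHigh i t)) (φ l).1 ≠ seqLow n m p i j :=
    elim_shuffle_ne φ (by simp) (by simp)
  have root : ∀ y, edge (seqComposeLower (p := p) φ hj) y ≠ seqLow n m p i j := fun y h => by
    obtain rfl | ⟨l, rfl⟩ | ⟨t', rfl⟩ := graft_cases y <;> simp at h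
    exact low l h
  refine Piece.compatible_of_shared seqUpper_injective (seqComposeLower_injective _ hj)
    (fun x y h => ?_) (fun x y h => ?_)
  · obtain rfl | ⟨t, rfl⟩ | ⟨t, rfl⟩ := graft_cases x
    · exact absurd h.symm (root y)
    · obtain rfl | ⟨l, rfl⟩ | ⟨t, rfl⟩ := graft_cases y
      · simp at h
      · rw [colourAt_graftLow hg, colourAt_graftLow hu', hu.input_eq]
        simp only [edge_graftHom_low] at h
        rcases hz : (φ l).1 with t' | t' <;> rw [hz] at h
        · simp at h
        · simp only [Sum.elim_inr, onBase_inj, graftHigh_inj] at h ⊢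
          rw [h]
      · simp at h
    · obtain rfl | ⟨l, rfl⟩ | ⟨t, rfl⟩ := graft_cases y
      · simp at h
      · simp only [edge_graftHom_low, edge_graftHom_high] at h
        rcases hz : (φ l).1 with t' | t' <;> rw [hz] at h <;> simp at h
      · simp only [edge_graftHom_high, onTop_inj] at h
        rw [colourAt_graftHigh hh, colourAt_graftHigh hh', h]
  · obtain rfl | ⟨t, rfl⟩ | ⟨t, rfl⟩ := graft_cases x
    · exact absurd h.symm (root y)
    · by_cases ht : t = j
      · subst ht
        refine Or.inr ⟨_, _, _, _, _, isOp_high m p t, isOp_high r p j', rfl, ?_, fun _ => rfl,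
          nofun, hh.trans hh'.symm, fun l => terminal_left (graftHigh_mem_leaves l), ?_⟩
        · change Sum.elim _ _ (φ j').1 = _
          rw [hj]
          rfl
        · rintro _ ⟨x, rfl⟩ - h h'
          obtain rfl | ⟨j', rfl⟩ | ⟨t', rfl⟩ := graft_cases x
          · simp at h
          · simp only [edge_graftHom_low, base_le_base, graftHigh_le_high] at h
            subst h
            exact absurd rfl h'
          · exact ⟨t', le_rfl⟩
      · exact Or.inl (terminal_left (graftLow_mem_leaves.2 ht))
    · exact Or.inl (terminal_left (graftHigh_mem_leaves t))

/-- If `v` is a composition of `g` and `h`, and `w` one of `f` and `v`, then `w` is also a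
composition of `u` and `h` for each composition `u` of `f` and `g`. -/
theorem IsComposite.of_composeUpper (hX : IsInnerKan X) (hu : IsComposite i φ f g u)
    (hv : IsComposite j ψ' g h v) (hw : IsComposite i φ' f v w) (hj : (φ j').1 = Sum.inr j)
    (hk : ∀ l, Equiv.sumAssoc _ _ _ (Sum.map (fun t => (φ t).1) id (ψ l).1) =
      Sum.map id (fun t => (ψ' t).1) (φ' l).1) : IsComposite j' ψ u h w := by
  have hv₀ := hv
  obtain ⟨γ, hf, hg, hu⟩ := hu
  obtain ⟨δ, hg', hh, hv⟩ := hv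
  obtain ⟨ε, hf', hv', hw⟩ := hw
  -- The face missing from this horn contracts the edge between `f` and `g`. The filler restricts
  -- there to a witness with `u` below `h`.
  obtain ⟨x, hγ, hδ, hε⟩ := hX.exists_glue_three isInner_seqLow
    ⟨_, seqLower n m p i j, γ⟩ ⟨_, seqUpper n m p i j, δ⟩ ⟨_, seqComposeUpper ψ', ε⟩
    (F := .top _ isTop_seqHigh) (G := .bottom _ isOnlyInner_seqLow)
    (H := .inner _ isInner_seqHigh) (fun F => by have := seqTree_face F; tauto)
    (by simp) (by simp) (by simp) seqLower_injective seqUpper_injective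
    (seqComposeUpper_injective _) sameImage_seqLower sameImage_seqUpper
    (sameImage_seqComposeUpper _) (compatible_seqLower_seqUpper hf hg hg')
    (compatible_seqLower_seqComposeUpper hf hg hv₀ hf' hv')
    (compatible_seqUpper_seqComposeUpper hv hv')
  have key := isComposite_pull x j' ψ (IsOp.circ i φ rfl (fun _ => rfl)
    (isOp_baseLow (graftHigh_mem_leaves j) p) (isOp_baseHigh (graftHigh_mem_leaves j) p))
    (isOp_onTop (graftHigh_mem_leaves j) p)
    (IsOp.circ i φ' rfl (fun _ => rfl) (isOp_baseLow (graftHigh_mem_leaves j) p)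
      (IsOp.circ j ψ' rfl (fun _ => rfl) (isOp_baseHigh _ p) (isOp_onTop _ p)))
    (by rw [hj]; rfl) (elim_seq hk _ _ _)
  dsimp only at hγ hδ hε
  convert key
  · rw [← hu, ← hγ]
    exact pull_ofOp_pull _ _ (isOp_graftIn φ) _ (fun _ => edge_seqLower_graftIn _) rfl
  · rw [← hh, ← hδ]
    exact pull_ofOp_pull _ _ (isOp_high m p j) _ (fun _ => rfl) rfl
  · rw [← hw, ← hε]
    exact pull_ofOp_pull _ _ (isOp_graftIn φ') _ (fun _ => edge_graftHom_graftIn _ _ _ _) rfl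

/-- If `u` is a composition of `f` and `g`, and `w` one of `u` and `h`, then `w` is also a
composition of `f` and `v` for each composition `v` of `g` and `h`. -/
theorem IsComposite.of_composeLower (hX : IsInnerKan X) (hu : IsComposite i φ f g u)
    (hv : IsComposite j ψ' g h v) (hw : IsComposite j' ψ u h w) (hj : (φ j').1 = Sum.inr j)
    (hk : ∀ l, Equiv.sumAssoc _ _ _ (Sum.map (fun t => (φ t).1) id (ψ l).1) =
      Sum.map id (fun t => (ψ' t).1) (φ' l).1) : IsComposite i φ' f v w := by
  have hu₀ := hu
  obtain ⟨γ, hf, hg, hu⟩ := hu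
  obtain ⟨δ, hg', hh, hv⟩ := hv
  obtain ⟨ε, hu', hh', hw⟩ := hw
  -- Now the missing face contracts the edge between `g` and `h`, and the filler restricts there to
  -- a witness with `f` below `v`.
  obtain ⟨x, hγ, hδ, hε⟩ := hX.exists_glue_three isInner_seqHigh
    ⟨_, seqLower n m p i j, γ⟩ ⟨_, seqUpper n m p i j, δ⟩ ⟨_, seqComposeLower φ hj, ε⟩
    (F := .top _ isTop_seqHigh) (G := .bottom _ isOnlyInner_seqLow)
    (H := .inner _ isInner_seqLow) (fun F => by have := seqTree_face F; tauto)
    (by simp) (by simp) (by simp) seqLower_injective seqUpper_injective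
    (seqComposeLower_injective _ hj) sameImage_seqLower sameImage_seqUpper
    (sameImage_seqComposeLower _ hj) (compatible_seqLower_seqUpper hf hg hg')
    (compatible_seqLower_seqComposeLower hj hu hu')
    (compatible_seqUpper_seqComposeLower hj hu₀ hg' hh hu' hh')
  have key := isComposite_pull x i φ' (isOp_baseLow (graftHigh_mem_leaves j) p)
    (IsOp.circ j ψ' rfl (fun _ => rfl) (isOp_baseHigh _ p) (isOp_onTop _ p))
    (IsOp.circ j' ψ (by rw [hj]; rfl) (fun _ => rfl) (IsOp.circ i φ rfl (fun _ => rfl)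
      (isOp_baseLow (graftHigh_mem_leaves j) p) (isOp_baseHigh (graftHigh_mem_leaves j) p))
      (isOp_onTop (graftHigh_mem_leaves j) p))
    rfl (fun l => (elim_seq hk _ _ _ l).symm)
  dsimp only at hγ hδ hε
  convert key
  · rw [← hf, ← hγ]
    exact pull_ofOp_pull _ _ (isOp_low n m i) _ (fun _ => rfl) rfl
  · rw [← hv, ← hδ]
    exact pull_ofOp_pull _ _ (isOp_graftIn ψ') _ (fun _ => edge_graftHom_graftIn _ _ _ _) rfl
  · rw [← hw, ← hε]
    exact pull_ofOp_pull _ _ (isOp_graftIn ψ) _ (fun _ => edge_graftHom_graftIn _ _ _ _) rfl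

end

/-! ### Two vertices next to each other -/

section

variable {n m : ℕ} {i j : Fin n}

/-- The tree `(Cₙ ∘ᵢ Cₘ) ∘ⱼ Cₚ`, where `i` and `j` are different inputs of `Cₙ`. -/
abbrev parTree (m p : ℕ) (hij : j ≠ i) : DTree :=
  (graft n m i).graftOn (graftLow m i j) (graftLow_mem_leaves.2 hij) p

/-- The inclusion of the vertex at the root and the one on its input `i`. -/
abbrev parLeft (m p : ℕ) (hij : j ≠ i) : graft n m i ⟶ parTree m p hij :=
  graftOnHom (graftLow_mem_leaves.2 hij) p

/-- The inclusion of the vertex at the root and the one on its input `j`. -/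
abbrev parRight (m p : ℕ) (hij : j ≠ i) : graft n p j ⟶ parTree m p hij :=
  graftHom j (isOp_baseLow _ p) (isOp_onTop _ p) rfl

/-- The inner face that composes the vertex at the root with the one on its input `j`. -/
abbrev parCompose (m : ℕ) {p s : ℕ} (hij : j ≠ i) (ψ' : Shuffle n p s j) {i' : Fin s}
    (hi : (ψ' i').1 = Sum.inl i) : graft s m i' ⟶ parTree m p hij :=
  graftHom i' (IsOp.circ j ψ' rfl (fun _ => rfl) (isOp_baseLow _ p) (isOp_onTop _ p))
    (isOp_baseHigh _ p) (by rw [hi]; rfl)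

/-- The inner edge on the input `t` of the vertex at the root. -/
abbrev parLow (m p : ℕ) (hij : j ≠ i) (t : Fin n) : (parTree m p hij).Edge :=
  onBase (graftLow_mem_leaves.2 hij) p (graftLow m i t)

variable {p : ℕ} {hij : j ≠ i}

lemma isInner_parLow_left : (parTree m p hij).IsInner (parLow m p hij i) :=
  isInner_graftOn_graft.2 (Or.inl rfl)

lemma isInner_parLow_right : (parTree m p hij).IsInner (parLow m p hij j) :=
  isInner_graftOn_graft.2 (Or.inr rfl)

lemma isTop_parLow_left : (parTree m p hij).IsTop (parLow m p hij i) :=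
  ⟨isInner_parLow_left, fun x h => by
    have := h.le
    have := h.ne
    obtain rfl | ⟨j, rfl⟩ | ⟨t, rfl⟩ | ⟨t, rfl⟩ := graftOn_graft_cases x <;> simp_all⟩

lemma isTop_parLow_right : (parTree m p hij).IsTop (parLow m p hij j) :=
  ⟨isInner_parLow_right, fun x h => by
    have := h.le
    have := h.ne
    obtain rfl | ⟨j, rfl⟩ | ⟨t, rfl⟩ | ⟨t, rfl⟩ := graftOn_graft_cases x <;> simp_all⟩

/-- Both upper vertices are top vertices. No face deletes the root vertex, because two inner edges
are attached to it. -/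
lemma parTree_face (F : Face (parTree m p hij)) :
    F = .inner _ isInner_parLow_left ∨ F = .inner _ isInner_parLow_right ∨
      F = .top _ isTop_parLow_left ∨ F = .top _ isTop_parLow_right := by
  rcases F with ⟨e, he⟩ | ⟨e, he⟩ | ⟨e, he⟩ | ⟨h, e⟩
  · obtain rfl | rfl := isInner_graftOn_graft.1 he <;> simp
  · obtain rfl | rfl := isInner_graftOn_graft.1 he.1 <;> simp
  · obtain rfl | rfl := isInner_graftOn_graft.1 he.1
    · have := he.2 (parLow m p hij j)
      simp [hij.symm] at this
    · have := he.2 (parLow m p hij i)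
      simp [hij] at this
  · exact absurd ((h _).1 isInner_parLow_left.2) isInner_parLow_left.1

lemma sameImage_parLeft : SameImage (parLeft m p hij)
    (Face.top _ (isTop_parLow_right (m := m) (p := p) (hij := hij))).hom := by
  refine sameImage_top _ (fun x => ?_) (fun x => ?_) <;>
  obtain rfl | ⟨t, rfl⟩ | ⟨t, rfl⟩ | ⟨t, rfl⟩ := graftOn_graft_cases x <;>
  simp [lt_iff_le_and_ne]
  · exact hij
  · by_cases h : t = j <;> simp [h, hij]
  · exact hij

lemma sameImage_parRight : SameImage (parRight m p hij)
    (Face.top _ (isTop_parLow_left (m := m) (p := p) (hij := hij))).hom := by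
  refine sameImage_top _ (fun x => ?_) (fun x => ?_) <;>
  obtain rfl | ⟨t, rfl⟩ | ⟨t, rfl⟩ | ⟨t, rfl⟩ := graftOn_graft_cases x <;>
  simp [exists_graft, lt_iff_le_and_ne, hij.symm]
  by_cases h : t = j <;> simp [h, hij]
  tauto

lemma sameImage_parCompose {s : ℕ} (ψ' : Shuffle n p s j) {i' : Fin s}
    (hi : (ψ' i').1 = Sum.inl i) : SameImage (parCompose m hij ψ' hi)
      (Face.inner _ (isInner_parLow_right (m := m) (p := p) (hij := hij))).hom := by
  refine sameImage_inner _ (fun x => ?_) (fun x => ?_)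
  · obtain rfl | ⟨t, rfl⟩ | ⟨t, rfl⟩ | ⟨t, rfl⟩ := graftOn_graft_cases x <;>
    simp [exists_graft, exists_elim_shuffle]
  · rw [mem_image_graftHom, exists_ne_elim_shuffle ψ' hi]
    obtain rfl | ⟨t, rfl⟩ | ⟨t, rfl⟩ | ⟨t, rfl⟩ := graftOn_graft_cases x <;> simp
    tauto

lemma parLeft_injective : Function.Injective (edge (parLeft m p hij)) := graftOnHom_injective

lemma parRight_injective : Function.Injective (edge (parRight m p hij)) :=
  graftHom_injective (by simp) (by simp)

lemma parCompose_injective {s : ℕ} (ψ' : Shuffle n p s j) {i' : Fin s}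
    (hi : (ψ' i').1 = Sum.inl i) : Function.Injective (edge (parCompose m hij ψ' hi)) :=
  graftHom_injective (elim_shuffle_ne ψ' (by simp) (by simp)) (by simp)

end

/-! ### Compatibility of faces and parallel associativity -/

section

variable {n m p r s k : ℕ} {i j : Fin n} {j' : Fin r} {i' : Fin s} {hij : j ≠ i}
  {φ : Shuffle n m r i} {ψ : Shuffle r p k j'} {ψ' : Shuffle n p s j} {φ' : Shuffle s m k i'}
  {f : X.obj (op (corolla n))} {g : X.obj (op (corolla m))} {h : X.obj (op (corolla p))}
  {u : X.obj (op (corolla r))} {v : X.obj (op (corolla s))} {w : X.obj (op (corolla k))}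

lemma elim_par (hk : ∀ l, swapLast (Sum.map (fun t => (φ t).1) id (ψ l).1) =
      Sum.map (fun t => (ψ' t).1) id (φ' l).1) {E : Type*} (c : Fin n → E) (b : Fin m → E)
    (a : Fin p → E) (l : Fin k) : Sum.elim (fun t => Sum.elim c a (ψ' t).1) b (φ' l).1 =
      Sum.elim (fun t => Sum.elim c b (φ t).1) a (ψ l).1 := by
  have h1 : ∀ y, Sum.elim (fun t => Sum.elim c a (ψ' t).1) b y =
      Sum.elim (Sum.elim c a) b (Sum.map (fun t => (ψ' t).1) id y) := by
    rintro (_ | _) <;> rfl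
  have h2 : ∀ y, Sum.elim (fun t => Sum.elim c b (φ t).1) a y =
      Sum.elim (Sum.elim c a) b (swapLast (Sum.map (fun t => (φ t).1) id y)) := by
    rintro (t | t)
    · rcases h : (φ t).1 with _ | _ <;> simp [h, swapLast]
    · rfl
  rw [h1, h2, hk]

/-- The shared corolla is the vertex at the root. Each of its inputs is a leaf of one of the faces:
`i` of the right one, all others of the left one. -/
lemma compatible_parLeft_parRight {γ : X.obj (op (graft n m i))} {δ : X.obj (op (graft n p j))}
    (hf : pull ((graft n m i).ofOp (isOp_low n m i)) γ = f)
    (hf' : pull ((graft n p j).ofOp (isOp_low n p j)) δ = f) :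
    Piece.Compatible ⟨_, parLeft m p hij, γ⟩ ⟨_, parRight m p hij, δ⟩ := by
  have low : ∀ t, Terminal (parLeft m p hij) (parRight m p hij) (parLow m p hij t) := fun t => by
    by_cases ht : t = i
    · subst ht
      exact terminal_right (graftLow_mem_leaves.2 hij.symm)
    · exact terminal_left (graftLow_mem_leaves.2 ht)
  refine Piece.compatible_of_shared parLeft_injective parRight_injective (fun x y h => ?_)
    (fun x y h => ?_)
  · obtain rfl | ⟨t, rfl⟩ | ⟨t, rfl⟩ := graft_cases x <;>
    obtain rfl | ⟨t', rfl⟩ | ⟨t', rfl⟩ := graft_cases y <;> simp at h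
    · rw [colourAt_graftRoot hf, colourAt_graftRoot hf']
    · rw [colourAt_graftLow hf, colourAt_graftLow hf', h]
  · obtain rfl | ⟨t, rfl⟩ | ⟨t, rfl⟩ := graft_cases x
    · refine Or.inr ⟨_, _, _, _, _, isOp_low n m i, isOp_low n p j, rfl, rfl, fun _ => rfl, nofun,
        hf.trans hf'.symm, low, ?_⟩
      rintro _ ⟨x, rfl⟩ - h h'
      obtain rfl | ⟨t, rfl⟩ | ⟨t, rfl⟩ := graft_cases x
      · exact absurd rfl h'
      · exact ⟨t, le_rfl⟩
      · exact ⟨i, Or.inr (Or.inr ⟨rfl, t, rfl⟩)⟩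
    · exact Or.inl (low t)
    · exact Or.inl (terminal_left (graftHigh_mem_leaves t))

/-- The shared corolla carries `v`, as the inner face of `γ` and the lower vertex of `δ`. -/
lemma compatible_parRight_parCompose (hi : (ψ' i').1 = Sum.inl i)
    {γ : X.obj (op (graft n p j))} {δ : X.obj (op (graft s m i'))}
    (hv : pull ((graft n p j).ofOp (isOp_graft ψ')) γ = v)
    (hv' : pull ((graft s m i').ofOp (isOp_low s m i')) δ = v) :
    Piece.Compatible ⟨_, parRight m p hij, γ⟩ ⟨_, parCompose m hij ψ' hi, δ⟩ := by
  have low : ∀ l, Sum.elim (fun t => onBase (graftLow_mem_leaves.2 hij) p (graftLow m i t))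
      (onTop (graftLow_mem_leaves.2 hij)) (ψ' l).1 ≠ parLow m p hij j :=
    elim_shuffle_ne ψ' (by simp) (by simp)
  have edge_graftIn : ∀ y, edge (parRight m p hij) (graftIn j y) =
      Sum.elim (fun t => onBase (graftLow_mem_leaves.2 hij) p (graftLow m i t))
      (onTop (graftLow_mem_leaves.2 hij)) y := edge_graftHom_graftIn _ _ _
  refine Piece.compatible_of_shared parRight_injective (parCompose_injective _ hi)
    (fun x y h => ?_) (fun x y h => ?_)
  · obtain rfl | ⟨l, rfl⟩ | ⟨t, rfl⟩ := graft_cases y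
    · obtain rfl | ⟨j, rfl⟩ | ⟨t, rfl⟩ := graft_cases x <;> simp at h
      exact (output_pull (isOp_graft ψ') γ).symm.trans
        ((congrArg output (hv.trans hv'.symm)).trans (output_pull (isOp_low s m i') δ))
    · obtain rfl : x = graftIn j (ψ' l).1 := parRight_injective
        (h.trans (edge_graftIn _).symm)
      exact (input_pull (isOp_graft ψ') γ l).symm.trans
        ((congrArg (input · l) (hv.trans hv'.symm)).trans (input_pull (isOp_low s m i') δ l))
    · obtain rfl | ⟨j, rfl⟩ | ⟨t, rfl⟩ := graft_cases x <;> simp at h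
  · obtain rfl | ⟨t, rfl⟩ | ⟨t, rfl⟩ := graft_cases x
    · refine Or.inr ⟨_, _, _, _, _, isOp_graftIn ψ', isOp_low s m i', rfl, rfl,
        fun l => edge_graftIn _, fun l => graftIn_ne_root _,
        hv.trans hv'.symm, fun l => terminal_left (graftIn_mem_leaves ψ' l), ?_⟩
      rintro _ ⟨x, rfl⟩ ⟨y, hy⟩ h h'
      obtain rfl | ⟨l, rfl⟩ | ⟨t', rfl⟩ := graft_cases y
      · exact absurd hy.symm h'
      · exact ⟨l, (edge_graftIn _).trans hy |>.le⟩
      · obtain rfl | ⟨j, rfl⟩ | ⟨t, rfl⟩ := graft_cases x <;> simp at hy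
    · by_cases ht : t = j
      · subst ht
        obtain rfl | ⟨l, rfl⟩ | ⟨t', rfl⟩ := graft_cases y <;> simp at h
        exact absurd h.symm (low l)
      · exact Or.inl (terminal_left (graftLow_mem_leaves.2 ht))
    · exact Or.inl (terminal_left (graftHigh_mem_leaves t))

/-- The root vertices are `f` and `v`, so the only corolla to compare is the vertex on the input
`i`, with `g`. -/
lemma compatible_parLeft_parCompose (hi : (ψ' i').1 = Sum.inl i)
    {γ : X.obj (op (graft n m i))} {δ : X.obj (op (graft s m i'))}
    (hv : IsComposite j ψ' f h v)
    (hf : pull ((graft n m i).ofOp (isOp_low n m i)) γ = f)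
    (hg : pull ((graft n m i).ofOp (isOp_high n m i)) γ = g)
    (hv' : pull ((graft s m i').ofOp (isOp_low s m i')) δ = v)
    (hg' : pull ((graft s m i').ofOp (isOp_high s m i')) δ = g) :
    Piece.Compatible ⟨_, parLeft m p hij, γ⟩ ⟨_, parCompose m hij ψ' hi, δ⟩ := by
  have low : ∀ l, Sum.elim (fun t => onBase (graftLow_mem_leaves.2 hij) p (graftLow m i t))
      (onTop (graftLow_mem_leaves.2 hij)) (ψ' l).1 ≠ parLow m p hij j :=
    elim_shuffle_ne ψ' (by simp) (by simp)
  have low' : ∀ y, edge (parCompose m hij ψ' hi) y ≠ parLow m p hij j := fun y h => by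
    obtain rfl | ⟨l, rfl⟩ | ⟨t', rfl⟩ := graft_cases y <;> simp at h
    exact low l h
  refine Piece.compatible_of_shared parLeft_injective (parCompose_injective _ hi)
    (fun x y h => ?_) (fun x y h => ?_)
  · obtain rfl | ⟨t, rfl⟩ | ⟨t, rfl⟩ := graft_cases y
    · obtain rfl | ⟨t, rfl⟩ | ⟨t, rfl⟩ := graft_cases x <;> simp at h
      rw [colourAt_graftRoot hf, colourAt_graftRoot hv', hv.output_eq]
    · rw [colourAt_graftLow hv', hv.input_eq]
      simp only [edge_graftOnHom, edge_graftHom_low] at h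
      rcases hz : (ψ' t).1 with t' | t' <;> rw [hz] at h
      · obtain rfl : x = graftLow m i t' := by simpa using h
        exact colourAt_graftLow hf _
      · simp at h
    · obtain rfl : x = graftHigh i t := by simpa using h
      rw [colourAt_graftHigh hg, colourAt_graftHigh hg']
  · obtain rfl | ⟨t, rfl⟩ | ⟨t, rfl⟩ := graft_cases x
    -- The root is terminal: the leaf on the input `j` of the left face lies above it and is missing
    -- from the other face.
    · refine Or.inl ⟨parLow m p hij j, Or.inl ⟨_, graftLow_mem_leaves.2 hij, rfl⟩, by simp, ?_⟩
      rintro _ ⟨x, rfl⟩ ⟨y, hy⟩ h h'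
      obtain rfl | ⟨t, rfl⟩ | ⟨t, rfl⟩ := graft_cases x <;> simp at h h' ⊢
      subst h'
      exact low' y hy
    · by_cases ht : t = i
      · subst ht
        refine Or.inr ⟨_, _, _, _, _, isOp_high n m t, isOp_high s m i', rfl, ?_, fun _ => rfl,
          nofun, hg.trans hg'.symm, fun l => terminal_left (graftHigh_mem_leaves l), ?_⟩
        · change Sum.elim _ _ (ψ' i').1 = _
          rw [hi]
          rfl
        · rintro _ ⟨x, rfl⟩ - h h'
          obtain rfl | ⟨j', rfl⟩ | ⟨t', rfl⟩ := graft_cases x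
          · simp at h
          · simp only [edge_graftOnHom, base_le_base, graftLow_le_low] at h
            subst h
            exact absurd rfl h'
          · exact ⟨t', le_rfl⟩
      · exact Or.inl (terminal_left (graftLow_mem_leaves.2 ht))
    · exact Or.inl (terminal_left (graftHigh_mem_leaves t))

/-- If `u` is a `∘ᵢ`-composition of `f` and `g`, and `v` a `∘ⱼ`-composition of `f` and `h`, then
each composition of `v` and `g` is also a composition of `u` and `h`. -/
theorem IsComposite.of_par (hX : IsInnerKan X) (hu : IsComposite i φ f g u)
    (hv : IsComposite j ψ' f h v) (hw : IsComposite i' φ' v g w) (hj : (φ j').1 = Sum.inl j)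
    (hi : (ψ' i').1 = Sum.inl i)
    (hk : ∀ l, swapLast (Sum.map (fun t => (φ t).1) id (ψ l).1) =
      Sum.map (fun t => (ψ' t).1) id (φ' l).1) : IsComposite j' ψ u h w := by
  have hij : j ≠ i := fun h => (φ j').2 (hj.trans (congrArg _ h))
  have hv₀ := hv
  obtain ⟨γ, hf, hg, hu⟩ := hu
  obtain ⟨δ, hf', hh, hv⟩ := hv
  obtain ⟨ε, hv', hg', hw⟩ := hw
  -- The missing face contracts the edge on the input `i`, so the filler restricts there to a
  -- witness with `u` below `h`.
  obtain ⟨x, hγ, hδ, hε⟩ := hX.exists_glue_three isInner_parLow_left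
    ⟨_, parLeft m p hij, γ⟩ ⟨_, parRight m p hij, δ⟩ ⟨_, parCompose m hij ψ' hi, ε⟩
    (F := .top _ isTop_parLow_right) (G := .top _ isTop_parLow_left)
    (H := .inner _ isInner_parLow_right) (fun F => by have := parTree_face F; tauto)
    (by simp) (by simp) (by simp [hij]) parLeft_injective parRight_injective
    (parCompose_injective _ hi) sameImage_parLeft sameImage_parRight
    (sameImage_parCompose _ hi) (compatible_parLeft_parRight hf hf')
    (compatible_parLeft_parCompose hi hv₀ hf hg hv' hg')
    (compatible_parRight_parCompose hi hv hv')
  have key := isComposite_pull x j' ψ (IsOp.circ i φ rfl (fun _ => rfl)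
    (isOp_baseLow (graftLow_mem_leaves.2 hij) p) (isOp_baseHigh (graftLow_mem_leaves.2 hij) p))
    (isOp_onTop (graftLow_mem_leaves.2 hij) p)
    (IsOp.circ i' φ' (by rw [hi]; rfl) (fun _ => rfl) (IsOp.circ j ψ' rfl (fun _ => rfl)
      (isOp_baseLow (graftLow_mem_leaves.2 hij) p) (isOp_onTop _ p)) (isOp_baseHigh _ p))
    (by rw [hj]; rfl) (elim_par hk _ _ _)
  dsimp only at hγ hδ hε
  convert key
  · rw [← hu, ← hγ]
    refine pull_ofOp_pull _ _ (isOp_graftIn φ) _ (fun l => ?_) rfl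
    rcases (φ l).1 with _ | _ <;> rfl
  · rw [← hh, ← hδ]
    exact pull_ofOp_pull _ _ (isOp_high n p j) _ (fun _ => rfl) rfl
  · rw [← hw, ← hε]
    exact pull_ofOp_pull _ _ (isOp_graftIn φ') _ (fun _ => edge_graftHom_graftIn _ _ _ _) rfl

end

/-! ### Homotopy and compositions -/

section

variable {n m k : ℕ} {i : Fin n} {φ : Shuffle n m k i}
  {f f' : X.obj (op (corolla n))} {g g' : X.obj (op (corolla m))} {h h' : X.obj (op (corolla k))}

lemma isComposite_of_pull_eq (x : X.obj (op T)) {c : Fin n → T.Edge} {d : T.Edge}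
    {b : Fin m → T.Edge} {e : T.Edge} {a : Fin k → T.Edge} {hf : T.IsOp c d} {hg : T.IsOp b e}
    {hh : T.IsOp a d} (he : c i = e) (ha : ∀ l, a l = Sum.elim c b (φ l).1)
    (h₁ : pull (T.ofOp hf) x = f) (h₂ : pull (T.ofOp hg) x = g) (h₃ : pull (T.ofOp hh) x = h) :
    IsComposite i φ f g h := by
  subst h₁ h₂ h₃
  exact isComposite_pull x i φ hf hg hh he ha

/-- The arrow given by a unit operation factors as `C₁ ⟶ η ⟶ T`. -/
lemma pull_ofOp_isOp_one (x : X.obj (op T)) (e : T.Edge) :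
    pull (T.ofOp (T.isOp_one e)) x = (degen (colourAt x e)).1 :=
  (pull_ofOp_pull (T.ofEdge e) x (eta.isOp_one ()) (T.isOp_one e) (fun _ => rfl) rfl).symm

lemma pull_ofOp_isOp_corolla (f : X.obj (op (corolla n))) :
    pull ((corolla n).ofOp (isOp_corolla n)) f = f := by
  have : (corolla n).ofOp (isOp_corolla n) = 𝟙 (corolla n) := by
    ext x
    rcases x with _ | j <;> rfl
  rw [this]
  simp [pull]

/-- The witness is degenerate: it is the restriction of `f` along the arrow `Cₙ ∘ᵢ C₁ ⟶ Cₙ` given by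
the vertex and the unit operation on its input `i`. -/
lemma isComposite_degen_right (i : Fin n) (f : X.obj (op (corolla n))) :
    IsComposite i (rightShuffle i) f (degen (input f i)).1 f :=
  isComposite_of_pull_eq f (e := corollaLeaf i) rfl (fun l => by
      change _ = Sum.elim _ _ (if l = i then Sum.inr 0 else Sum.inl l)
      split_ifs with h
      · rw [h]; rfl
      · rfl)
    (pull_ofOp_isOp_corolla f) (pull_ofOp_isOp_one f (corollaLeaf i)) (pull_ofOp_isOp_corolla f)

lemma isComposite_degen_left (f : X.obj (op (corolla n))) :
    IsComposite 0 (leftShuffle n) (degen (output f)).1 f f :=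
  isComposite_of_pull_eq f (e := corollaRoot n) rfl (fun _ => rfl)
    (pull_ofOp_isOp_one f (corollaRoot n)) (pull_ofOp_isOp_corolla f) (pull_ofOp_isOp_corolla f)

lemma leftShuffle_apply (l : Fin n) : (leftShuffle n l).1 = Sum.inr l := rfl

lemma rightShuffle_apply (i l : Fin n) :
    (rightShuffle i l).1 = if l = i then Sum.inr 0 else Sum.inl l := rfl

lemma leftShuffle_seq (φ : Shuffle n m k i) (l : Fin k) :
    Equiv.sumAssoc _ _ _ (Sum.map (fun t => (leftShuffle n t).1) id (φ l).1) =
      Sum.map id (fun t => (φ t).1) (leftShuffle k l).1 := by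
  rw [leftShuffle_apply]
  rcases h : (φ l).1 with _ | _ <;> simp [h, leftShuffle_apply]

lemma rightShuffle_seq (φ : Shuffle n m k i) (l : Fin k) :
    Equiv.sumAssoc _ _ _ (Sum.map (fun t => (rightShuffle i t).1) id (φ l).1) =
      Sum.map id (fun t => (leftShuffle m t).1) (φ l).1 := by
  have := (φ l).2
  rcases h : (φ l).1 with j | _
  · have hj : j ≠ i := fun hj => this (by rw [h, hj])
    simp [rightShuffle_apply, hj]
  · simp [leftShuffle_apply]

/-- Associativity for `1`, `f'`, `g`: since `f` is a composition of `1` and `f'`, the composition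
`h` of `f` and `g` is also one of `1` and `h'`. -/
lemma IsComposite.homotopicAlongRoot_of_left (hX : IsInnerKan X) (hf : HomotopicAlongRoot f' f)
    (h₁ : IsComposite i φ f g h) (h₂ : IsComposite i φ f' g h') : HomotopicAlongRoot h' h := by
  unfold HomotopicAlongRoot at hf ⊢
  rw [h₂.output_eq]
  exact hf.of_composeLower hX h₂ h₁ rfl (leftShuffle_seq φ)

/-- Compositions of the same two dendrices are homotopic. -/
lemma IsComposite.homotopicAlongRoot (hX : IsInnerKan X) (h₁ : IsComposite i φ f g h)
    (h₂ : IsComposite i φ f g h') : HomotopicAlongRoot h' h :=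
  homotopicAlongRoot_of_left hX (isComposite_degen_left f) h₁ h₂

/-- Associativity for `f`, `1`, `g'`, where `f` is taken as the composition of `f` and `1`. In this
argument the dendrex `h` itself remains a composition. -/
lemma IsComposite.of_right (hX : IsInnerKan X) (hg : HomotopicAlongRoot g' g)
    (h₁ : IsComposite i φ f g h) : IsComposite i φ f g' h := by
  have h₂ := isComposite_degen_right i f
  rw [← h₁.output_right, hg.output_eq, (degen (output g')).2.2] at h₂
  exact h₂.of_composeUpper hX hg h₁ (by simp [rightShuffle_apply]) (rightShuffle_seq φ)

/-- A homotopy makes `f'` a composition of `f` with a degenerate dendrex, and `f` is another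
composition of the same pair; compositions of one pair are homotopic along the root in both
directions. -/
lemma Homotopic.homotopicAlongRoot (hX : IsInnerKan X) {f f' : X.obj (op (corolla n))}
    (hf : Homotopic f f') : HomotopicAlongRoot f f' ∧ HomotopicAlongRoot f' f := by
  rcases hf with hf | ⟨i, hf⟩
  · exact ⟨hf, IsComposite.homotopicAlongRoot hX (isComposite_degen_left f) hf⟩
  · exact ⟨IsComposite.homotopicAlongRoot hX hf (isComposite_degen_right i f),
      IsComposite.homotopicAlongRoot hX (isComposite_degen_right i f) hf⟩

/-! ### Compositions and permutations -/

/-- The dendrex `σ^* f`. -/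
def permute (σ : Equiv.Perm (Fin n)) (f : X.obj (op (corolla n))) : X.obj (op (corolla n)) :=
  pull ((corolla n).ofOp ((isOp_corolla n).act σ)) f

lemma pull_ofOp_act (x : X.obj (op T)) {c : Fin n → T.Edge} {d : T.Edge} (h : T.IsOp c d)
    (σ : Equiv.Perm (Fin n)) : pull (T.ofOp (h.act σ)) x = permute σ (pull (T.ofOp h) x) :=
  (pull_ofOp_pull (T.ofOp h) x ((isOp_corolla n).act σ) (h.act σ) (fun _ => rfl) rfl).symm

lemma output_permute (σ : Equiv.Perm (Fin n)) (f : X.obj (op (corolla n))) :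
    output (permute σ f) = output f :=
  output_pull ((isOp_corolla n).act σ) f

/-- Here and in the next two lemmas the witness is kept up to renaming; only the enumerations of the
inputs change. -/
lemma IsComposite.act (σ : Equiv.Perm (Fin k)) (h₁ : IsComposite i φ f g h) :
    IsComposite i (σ.trans φ) f g (permute σ h) := by
  obtain ⟨γ, hf, hg, rfl⟩ := h₁
  exact ⟨γ, hf, hg, pull_ofOp_act γ (isOp_graft φ) σ⟩

lemma IsComposite.act_left (σ : Equiv.Perm (Fin n)) (φ : Shuffle n m k i)
    {φ' : Shuffle n m k (σ i)} (hφ : ∀ l, (φ' l).1 = Sum.map σ id (φ l).1)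
    (h₁ : IsComposite (σ i) φ' f g h) : IsComposite i φ (permute σ f) g h := by
  obtain ⟨γ, rfl, hg, hh⟩ := h₁
  refine isComposite_of_pull_eq γ rfl (fun l => ?_) (pull_ofOp_act γ (isOp_low n m (σ i)) σ) hg hh
  rw [hφ]
  rcases (φ l).1 with _ | _ <;> rfl

lemma IsComposite.act_right (τ : Equiv.Perm (Fin m)) (φ : Shuffle n m k i)
    {φ' : Shuffle n m k i} (hφ : ∀ l, (φ' l).1 = Sum.map id τ (φ l).1)
    (h₁ : IsComposite i φ' f g h) : IsComposite i φ f (permute τ g) h := by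
  obtain ⟨γ, hf, rfl, hh⟩ := h₁
  refine isComposite_of_pull_eq γ rfl (fun l => ?_) hf (pull_ofOp_act γ (isOp_high n m i) τ) hh
  rw [hφ]
  rcases (φ l).1 with _ | _ <;> rfl

/-- Permuting the inner face changes its enumeration, and permuting the upper vertex in the same way
restores it. -/
lemma HomotopicAlongRoot.act (σ : Equiv.Perm (Fin n)) {f f' : X.obj (op (corolla n))}
    (hf : HomotopicAlongRoot f f') : HomotopicAlongRoot (permute σ f) (permute σ f') := by
  unfold HomotopicAlongRoot at hf ⊢
  rw [output_permute]
  exact (hf.act σ).act_right σ _ fun l => rfl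

end

/-! ### The operad `Ho(X)` -/

section

variable {n m k : ℕ} {c : Fin n → Vertices X} {d : Vertices X} {b : Fin m → Vertices X}
  {e : Vertices X} {a : Fin k → Vertices X}

lemma hoMk_surjective : Function.Surjective (hoMk : Dendrices X n c d → HoOp X n c d) :=
  Quot.exists_rep

lemma hoMk_eq {f g : Dendrices X n c d} (h : HomotopicAlongRoot f.1 g.1) : hoMk f = hoMk g :=
  Quot.sound (Or.inl h)

lemma hoMk_eq_of_isComposite (hX : IsInnerKan X) {i : Fin n} {φ : Shuffle n m k i}
    {f : X.obj (op (corolla n))} {g : X.obj (op (corolla m))} {h h' : Dendrices X k a d}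
    (h₁ : IsComposite i φ f g h.1) (h₂ : IsComposite i φ f g h'.1) : hoMk h = hoMk h' :=
  hoMk_eq (h₂.homotopicAlongRoot hX h₁)

lemma IsInnerKan.exists_isComposite (hX : IsInnerKan X) (i : Fin n) (φ : Shuffle n m k i)
    (he : c i = e) (ha : ∀ l, a l = Sum.elim c b (φ l).1) (f : Dendrices X n c d)
    (g : Dendrices X m b e) : ∃ h : Dendrices X k a d, IsComposite i φ f.1 g.1 h.1 := by
  obtain ⟨γ, hf, hg⟩ := hX.exists_graft i f.1 g.1
    ((f.2.1 i).trans (he.trans g.2.2.symm))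
  refine ⟨⟨pull ((graft n m i).ofOp (isOp_graft φ)) γ, fun l => ?_, ?_⟩, γ, hf, hg, rfl⟩
  · rw [input_eq_of_graft hf hg rfl, ha, funext f.2.1, funext g.2.1]
  · exact (output_eq_of_graft hf rfl).trans f.2.2

/-- The composition in `Ho(X)`. -/
noncomputable def hoCirc (hX : IsInnerKan X) (i : Fin n) (φ : Shuffle n m k i) (he : c i = e)
    (ha : ∀ l, a l = Sum.elim c b (φ l).1) : HoOp X n c d → HoOp X m b e → HoOp X k a d :=
  Quot.lift₂ (fun f g => hoMk (hX.exists_isComposite i φ he ha f g).choose)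
    -- A change of `g` within its class keeps the chosen dendrex as a composition, while a change of
    -- `f` moves it by a homotopy along the root.
    (fun f g g' hg => hoMk_eq_of_isComposite hX
      (IsComposite.of_right hX (hg.homotopicAlongRoot hX).2
        (hX.exists_isComposite i φ he ha f g).choose_spec)
      (hX.exists_isComposite i φ he ha f g').choose_spec)
    (fun f f' g hf => hoMk_eq (IsComposite.homotopicAlongRoot_of_left hX
      (hf.homotopicAlongRoot hX).1 (hX.exists_isComposite i φ he ha f' g).choose_spec
      (hX.exists_isComposite i φ he ha f g).choose_spec))

lemma hoCirc_eq (hX : IsInnerKan X) (i : Fin n) (φ : Shuffle n m k i) (he : c i = e)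
    (ha : ∀ l, a l = Sum.elim c b (φ l).1) {f : Dendrices X n c d} {g : Dendrices X m b e}
    {h : Dendrices X k a d} (hh : IsComposite i φ f.1 g.1 h.1) :
    hoCirc hX i φ he ha (hoMk f) (hoMk g) = hoMk h :=
  hoMk_eq_of_isComposite hX (hX.exists_isComposite i φ he ha f g).choose_spec hh

/-- The symmetric group actions on `Ho(X)`. -/
def hoAct (hX : IsInnerKan X) (σ : Equiv.Perm (Fin n)) : HoOp X n c d → HoOp X n (c ∘ σ) d :=
  Quot.map (perm σ) fun _ _ h => Or.inl ((h.homotopicAlongRoot hX).1.act σ)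

lemma hoAct_mk (hX : IsInnerKan X) (σ : Equiv.Perm (Fin n)) (f : Dendrices X n c d) :
    hoAct hX σ (hoMk f) = hoMk (perm σ f) := rfl

end

/-- The operad structure on `Ho(X)`. -/
noncomputable def hoStr (hX : IsInnerKan X) : OperadStr (Vertices X) (HoOp X) where
  one x := hoMk (degen x)
  act := hoAct hX
  circ := hoCirc hX
  act_one f := by
    obtain ⟨f, rfl⟩ := hoMk_surjective f
    rw [hoAct_mk]
    exact congrArg hoMk (Subtype.ext (pull_ofOp_isOp_corolla f.1))
  act_mul σ τ f := by
    obtain ⟨f, rfl⟩ := hoMk_surjective f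
    simp only [hoAct_mk]
    exact congrArg hoMk (Subtype.ext (pull_ofOp_act f.1 ((isOp_corolla _).act σ) τ).symm)
  act_circ σ i φ he ha f g := by
    obtain ⟨f, rfl⟩ := hoMk_surjective f
    obtain ⟨g, rfl⟩ := hoMk_surjective g
    obtain ⟨h, hh⟩ := hX.exists_isComposite i φ he ha f g
    rw [hoCirc_eq hX i φ he ha hh, hoAct_mk]
    exact (hoCirc_eq hX _ _ he _ (hh.act σ)).symm
  circ_act_left σ i φ φ' hφ he ha ha' f g := by
    obtain ⟨f, rfl⟩ := hoMk_surjective f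
    obtain ⟨g, rfl⟩ := hoMk_surjective g
    obtain ⟨h, hh⟩ := hX.exists_isComposite (σ i) φ' he ha' f g
    rw [hoCirc_eq hX _ φ' he ha' hh, hoAct_mk]
    exact hoCirc_eq hX _ _ _ _ (hh.act_left σ φ hφ)
  circ_act_right τ i φ φ' hφ he ha ha' f g := by
    obtain ⟨f, rfl⟩ := hoMk_surjective f
    obtain ⟨g, rfl⟩ := hoMk_surjective g
    obtain ⟨h, hh⟩ := hX.exists_isComposite i φ' he ha' f g
    rw [hoCirc_eq hX _ φ' he ha' hh, hoAct_mk]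
    exact hoCirc_eq hX _ _ _ _ (hh.act_right τ φ hφ)
  one_circ φ hφ ha f := by
    obtain ⟨f, rfl⟩ := hoMk_surjective f
    obtain rfl : φ = leftShuffle _ := Equiv.ext fun l => Subtype.ext (hφ l)
    refine hoCirc_eq hX _ _ _ _ ?_
    have := isComposite_degen_left f.1
    rwa [f.2.2] at this
  circ_one i φ hφ ha f := by
    obtain ⟨f, rfl⟩ := hoMk_surjective f
    obtain rfl : φ = rightShuffle _ := Equiv.ext fun l => Subtype.ext (hφ l)
    refine hoCirc_eq hX _ _ _ _ ?_
    have := isComposite_degen_right i f.1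
    rwa [f.2.1] at this
  circ_seq i j j' φ ψ ψ' φ' hj hk he hx he₁ hz he₂ hy hz' f g h := by
    obtain ⟨f, rfl⟩ := hoMk_surjective f
    obtain ⟨g, rfl⟩ := hoMk_surjective g
    obtain ⟨h, rfl⟩ := hoMk_surjective h
    obtain ⟨u, hu⟩ := hX.exists_isComposite i φ he hx f g
    obtain ⟨v, hv⟩ := hX.exists_isComposite j ψ' he₂ hy g h
    -- The composition `w` is chosen for one bracketing; the same dendrex then serves for the other
    -- one.
    obtain ⟨w, hw⟩ := hX.exists_isComposite i φ' he hz' f v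
    rw [hoCirc_eq hX i φ he hx hu, hoCirc_eq hX j ψ' he₂ hy hv, hoCirc_eq hX i φ' he hz' hw]
    exact hoCirc_eq hX _ _ _ _ (hu.of_composeUpper hX hv hw hj hk)
  circ_par i j j' i' φ ψ ψ' φ' hj hi hk he hx he₁ hz he₂ hy he₃ hz' f g h := by
    obtain ⟨f, rfl⟩ := hoMk_surjective f
    obtain ⟨g, rfl⟩ := hoMk_surjective g
    obtain ⟨h, rfl⟩ := hoMk_surjective h
    obtain ⟨u, hu⟩ := hX.exists_isComposite i φ he hx f g
    obtain ⟨v, hv⟩ := hX.exists_isComposite j ψ' he₂ hy f h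
    obtain ⟨w, hw⟩ := hX.exists_isComposite i' φ' he₃ hz' v g
    rw [hoCirc_eq hX i φ he hx hu, hoCirc_eq hX j ψ' he₂ hy hv, hoCirc_eq hX i' φ' he₃ hz' hw]
    exact hoCirc_eq hX _ _ _ _ (hu.of_par hX hv hw hj hi hk)

lemma isHoStr_hoStr (hX : IsInnerKan X) : IsHoStr X (hoStr hX) where
  one _ := rfl
  act _ _ := rfl
  circ i φ he ha _ _ _ hγ := hoCirc_eq hX i φ he ha hγ

/-- Any two composable classes have representatives with a composition, so the formulas leave no
choice. -/
lemma IsHoStr.unique (hX : IsInnerKan X) {S S' : OperadStr (Vertices X) (HoOp X)}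
    (hS : IsHoStr X S) (hS' : IsHoStr X S') : S = S' := by
  have one : @S.one = @S'.one := funext fun x => (hS.one x).trans (hS'.one x).symm
  have act : @S.act = @S'.act := by
    funext n c d σ f
    obtain ⟨f, rfl⟩ := hoMk_surjective f
    exact (hS.act σ f).trans (hS'.act σ f).symm
  have circ : @S.circ = @S'.circ := by
    funext n m k c d b e a i φ he ha f g
    obtain ⟨f, rfl⟩ := hoMk_surjective f
    obtain ⟨g, rfl⟩ := hoMk_surjective g
    obtain ⟨h, hh⟩ := hX.exists_isComposite i φ he ha f g
    exact (hS.circ i φ he ha f g h hh).trans (hS'.circ i φ he ha f g h hh).symm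
  cases S
  cases S'
  congr

/-! ### The map `X ⟶ N_d(Ho(X))` -/

lemma hoMk_heq {n : ℕ} {c c' : Fin n → Vertices X} {d d' : Vertices X} (hc : c = c') (hd : d = d')
    {f : Dendrices X n c d} {f' : Dendrices X n c' d'} (hf : f.1 = f'.1) :
    hoMk f ≍ hoMk f' := by
  subst hc hd
  obtain rfl : f = f' := Subtype.ext hf
  rfl

section

variable {S : OperadStr (Vertices X) (HoOp X)}

/-- The map `Ω(T) ⟶ Ho(X)` given by a dendrex of shape `T`. -/
def hoHom (hS : IsHoStr X S) (x : X.obj (op T)) : OperadHom T.operad (hoOperad X S) where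
  colour := colourAt x
  op f := hoMk (restr x f.down)
  map_one e := (congrArg hoMk (Subtype.ext (pull_ofOp_isOp_one x e))).trans (hS.one _).symm
  map_act σ f := (congrArg hoMk (Subtype.ext (pull_ofOp_act x f.down σ))).trans
    (hS.act σ (restr x f.down)).symm
  map_circ i φ he ha ha' f g := (hS.circ i φ (congrArg (colourAt x) he) ha' (restr x f.down)
    (restr x g.down) (restr x (IsOp.circ i φ he ha f.down g.down)) (isComposite_pull x i φ f.down g.down _ he ha)).symm

lemma hoHom_pull (hS : IsHoStr X S) {R : DTree} (f : R ⟶ T) (x : X.obj (op T)) :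
    hoHom hS (pull f x) = OperadHom.comp f (hoHom hS x) := by
  refine OperadHom.ext_of_heq (fun e => colourAt_pull f x e) fun n c d h => ?_
  exact hoMk_heq (funext fun j => colourAt_pull f x (c j)) (colourAt_pull f x d)
    (pull_ofOp_pull f x h.down (isOp_edge f h.down) (fun _ => rfl) rfl)

/-- The map `X ⟶ N_d(Ho(X))`. -/
def hoUnit (hS : IsHoStr X S) : X ⟶ dendroidalNerve.obj (hoOperad X S) where
  app T := ↾fun x => hoHom (T := T.unop) hS x
  naturality R T f := by
    ext x
    exact hoHom_pull hS f.unop x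

lemma extendsQuotient_hoUnit (hS : IsHoStr X S) : ExtendsQuotient X S (hoUnit hS) where
  colour x := colourAt_eta x
  op f := hoMk_heq rfl rfl (pull_ofOp_isOp_corolla f)

lemma ExtendsQuotient.liftColour_eq {q : X ⟶ dendroidalNerve.obj (hoOperad X S)}
    (hq : ExtendsQuotient X S q) (x : Vertices X) : liftColour q x = x := hq.colour x

/-- The equality is heterogeneous since `liftColour q` is the identity only up to a proved equation.
It turns facts on `liftGen` into facts about classes. -/
lemma ExtendsQuotient.liftGen_heq {q : X ⟶ dendroidalNerve.obj (hoOperad X S)}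
    (hq : ExtendsQuotient X S q) {n : ℕ} {c : Fin n → Vertices X} {d : Vertices X}
    (f : Dendrices X n c d) : liftGen q f ≍ hoMk f :=
  (cast_heq _ _).trans ((hq.op f.1).trans (hoMk_heq (funext f.2.1) f.2.2 rfl))

/-- A map to a nerve is determined by its values on `η` and on corollas, because each operation of
`Ω(T)` is the vertex of a corolla over `T`. -/
lemma ExtendsQuotient.unique {q q' : X ⟶ dendroidalNerve.obj (hoOperad X S)}
    (hq : ExtendsQuotient X S q) (hq' : ExtendsQuotient X S q') : q = q' := by
  ext T x
  refine OperadHom.ext_of_heq (fun e => ?_) fun n c d h => ?_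
  · exact (liftColour_colourAt q (T := T.unop) x e).symm.trans
      ((hq.liftColour_eq _).trans ((hq'.liftColour_eq _).symm.trans
        (liftColour_colourAt q' (T := T.unop) x e)))
  · exact (liftGen_restr q (T := T.unop) x h.down).symm.trans ((hq.liftGen_heq _).trans
      ((hq'.liftGen_heq _).symm.trans (liftGen_restr q' (T := T.unop) x h.down)))

end

/-! ### Operations given by a map to a nerve -/

section

variable {P : Operad.{u}} (F : X ⟶ dendroidalNerve.obj P)

lemma liftGen_heq_of_eq {n : ℕ} {c c' : Fin n → Vertices X} {d d' : Vertices X} (hc : c = c')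
    (hd : d = d') {f : Dendrices X n c d} {f' : Dendrices X n c' d'} (hf : f.1 = f'.1) :
    liftGen F f ≍ liftGen F f' := by
  subst hc hd
  obtain rfl : f = f' := Subtype.ext hf
  rfl

/-- In this and the next two lemmas, `F` turns a dendrex into a map of operads on its tree, and one
law of that map is read off: on `η`, on a corolla, and on the witness of a composition. -/
lemma liftGen_degen (x : Vertices X) : liftGen F (degen x) = P.str.one (liftColour F x) := by
  have h1 := liftGen_restr F (T := eta) x (eta.isOp_one ())
  have h2 := OperadHom.map_one (F.app (op eta) x) ()
  exact eq_of_heq ((liftGen_heq_of_eq F (funext fun _ => (colourAt_eta x).symm)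
    (colourAt_eta x).symm rfl).trans (h1.trans (heq_of_eq h2)))

lemma liftGen_perm {n : ℕ} {c : Fin n → Vertices X} {d : Vertices X} (σ : Equiv.Perm (Fin n))
    (f : Dendrices X n c d) : liftGen F (perm σ f) = P.str.act σ (liftGen F f) := by
  obtain ⟨f, h, rfl⟩ := f
  obtain rfl : (fun j => input f j) = c := funext h
  have h1 := liftGen_restr F f ((isOp_corolla n).act σ)
  have h2 := OperadHom.map_act (F.app (op (corolla n)) f) σ ⟨isOp_corolla n⟩
  refine eq_of_heq ((h1.trans (heq_of_eq h2)).trans ?_)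
  exact OperadStr.act_heq (liftGen_aux F ⟨f, h, rfl⟩).1 (liftGen_aux F ⟨f, h, rfl⟩).2 σ
    (cast_heq _ _).symm

lemma liftGen_circ {n m k : ℕ} {c : Fin n → Vertices X} {d : Vertices X} {b : Fin m → Vertices X}
    {e : Vertices X} {a : Fin k → Vertices X} (i : Fin n) (φ : Shuffle n m k i) (he : c i = e)
    (ha : ∀ l, a l = Sum.elim c b (φ l).1) {f : Dendrices X n c d} {g : Dendrices X m b e}
    {h : Dendrices X k a d} (hh : IsComposite i φ f.1 g.1 h.1) :
    liftGen F h = P.str.circ (c := liftColour F ∘ c) i φ (congrArg (liftColour F) he)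
      (elim_comp_aux (liftColour F) _ ha) (liftGen F f) (liftGen F g) := by
  obtain ⟨γ, hf, hg, hh⟩ := hh
  have col : ∀ z : (graft n m i).Edge, OperadHom.colour (F.app _ γ) z =
      liftColour F (colourAt γ z) := fun z => (liftColour_colourAt F γ z).symm
  have hc : colourAt γ ∘ graftLow m i = c := funext fun j =>
    (colourAt_graftLow hf j).trans (f.2.1 j)
  have hd : colourAt γ (graftRoot n m i) = d := (colourAt_graftRoot hf).trans f.2.2
  have hb : colourAt γ ∘ graftHigh i = b := funext fun j =>
    (colourAt_graftHigh hg j).trans (g.2.1 j)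
  have he' : colourAt γ (graftLow m i i) = e := (congrFun hc i).trans he
  have ha' : (fun l => colourAt γ (graftIn i (φ l).1)) = a := funext fun l => by
    rw [ha, ← hc, ← hb]
    rcases (φ l).1 with _ | _ <;> rfl
  have hlow : liftGen F f ≍ OperadHom.op (F.app _ γ) ⟨isOp_low n m i⟩ :=
    (liftGen_heq_of_eq F hc.symm hd.symm hf.symm).trans (liftGen_restr F γ (isOp_low n m i))
  have hhigh : liftGen F g ≍ OperadHom.op (F.app _ γ) ⟨isOp_high n m i⟩ :=
    (liftGen_heq_of_eq F hb.symm he'.symm hg.symm).trans (liftGen_restr F γ (isOp_high n m i))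
  have hcomp : liftGen F h ≍ OperadHom.op (F.app _ γ) ⟨isOp_graft φ⟩ :=
    (liftGen_heq_of_eq F ha'.symm hd.symm hh.symm).trans (liftGen_restr F γ (isOp_graft φ))
  -- This is the composition law for the map that `F` assigns to the witness. The remaining steps
  -- transport it along equalities of colours.
  have key := OperadHom.map_circ (F.app (op (graft n m i)) γ) i φ (e := graftLow m i i)
    (b := graftHigh i) rfl (fun _ => rfl) (elim_comp_aux _ _ fun _ => rfl)
    ⟨isOp_low n m i⟩ ⟨isOp_high n m i⟩
  refine eq_of_heq (hcomp.trans ((heq_of_eq key).trans ?_))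
  refine OperadStr.circ_heq ?_ ?_ ?_ ?_ ?_ i φ _ _ _ _ hlow.symm hhigh.symm
  · rw [← hc]; exact funext fun j => col _
  · rw [← hd]; exact col _
  · rw [← hb]; exact funext fun j => col _
  · rw [← he']; exact col _
  · rw [← ha']; exact funext fun j => col _

end

/-! ### Uniqueness of the operad structure -/

section

variable {S : OperadStr (Vertices X) (HoOp X)}

/-- `liftGen` respects units, permutations and compositions for every map to a nerve, and `liftGen q
f` is `[f]`. So the existence of an extension already forces the formulas. -/
lemma ExtendsQuotient.isHoStr {q : X ⟶ dendroidalNerve.obj (hoOperad X S)}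
    (hq : ExtendsQuotient X S q) : IsHoStr X S where
  one x := eq_of_heq <| (OperadStr.one_heq (P := hoOperad X S) (hq.liftColour_eq x).symm).trans
    ((heq_of_eq (liftGen_degen q x).symm).trans (hq.liftGen_heq _))
  act σ f := eq_of_heq <| (OperadStr.act_heq (P := hoOperad X S)
    (funext fun _ => (hq.liftColour_eq _).symm) (hq.liftColour_eq _).symm σ
    (hq.liftGen_heq f).symm).trans
    ((heq_of_eq (liftGen_perm q σ f).symm).trans (hq.liftGen_heq _))
  circ i φ he ha f g _ hγ := eq_of_heq <| (OperadStr.circ_heq (P := hoOperad X S)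
    (funext fun _ => (hq.liftColour_eq _).symm) (hq.liftColour_eq _).symm
    (funext fun _ => (hq.liftColour_eq _).symm) (hq.liftColour_eq _).symm
    (funext fun _ => (hq.liftColour_eq _).symm) i φ _ _ _ _
    (hq.liftGen_heq f).symm (hq.liftGen_heq g).symm).trans
    ((heq_of_eq (liftGen_circ q i φ he ha hγ).symm).trans (hq.liftGen_heq _))

/-! ### The universal property of `Ho(X)` -/

variable {P : Operad.{u}}

/-- `g` is a composition of `1` and `f`, so `F` sends it to the composition of a unit with the image
of `f`, and the left unit law of `P` applies. -/
lemma liftGen_eq_of_homotopic (F : X ⟶ dendroidalNerve.obj P) {n : ℕ} {c : Fin n → Vertices X}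
    {d : Vertices X} {f g : Dendrices X n c d} (h : HomotopicAlongRoot f.1 g.1) :
    liftGen F f = liftGen F g := by
  unfold HomotopicAlongRoot at h
  rw [f.2.2] at h
  have h1 := liftGen_circ F 0 (leftShuffle n) (f := degen d) rfl (fun _ => rfl) h
  rw [liftGen_degen] at h1
  exact (h1.trans (P.str.one_circ _ (fun _ => rfl) _ _)).symm

/-- The map on operations `Ho(X) ⟶ P` given by a map `X ⟶ N_d(P)`. -/
def hoLiftOp (hX : IsInnerKan X) (F : X ⟶ dendroidalNerve.obj P) {n : ℕ} {c : Fin n → Vertices X}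
    {d : Vertices X} : HoOp X n c d → P.Op n (liftColour F ∘ c) (liftColour F d) :=
  Quot.lift (liftGen F) fun _ _ h => liftGen_eq_of_homotopic F (h.homotopicAlongRoot hX).1

/-- The map `Ho(X) ⟶ P` given by a map `X ⟶ N_d(P)`. -/
def hoLift (hX : IsInnerKan X) (hS : IsHoStr X S) (F : X ⟶ dendroidalNerve.obj P) :
    hoOperad X S ⟶ P :=
  OperadHom.mk (P := hoOperad X S) (liftColour F) (hoLiftOp hX F)
    (fun x => (congrArg (hoLiftOp hX F) (hS.one x)).trans (liftGen_degen F x))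
    (fun σ f => by
      obtain ⟨f, rfl⟩ := hoMk_surjective f
      exact (congrArg (hoLiftOp hX F) (hS.act σ f)).trans (liftGen_perm F σ f))
    (fun i φ he ha _ f g => by
      obtain ⟨f, rfl⟩ := hoMk_surjective f
      obtain ⟨g, rfl⟩ := hoMk_surjective g
      obtain ⟨h, hh⟩ := hX.exists_isComposite i φ he ha f g
      exact (congrArg (hoLiftOp hX F) (hS.circ i φ he ha f g h hh)).trans
        (liftGen_circ F i φ he ha hh))

lemma hoUnit_comp_hoLift (hX : IsInnerKan X) (hS : IsHoStr X S) (F : X ⟶ dendroidalNerve.obj P) :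
    hoUnit hS ≫ dendroidalNerve.map (hoLift hX hS F) = F := by
  ext T x
  refine OperadHom.ext_of_heq (fun e => liftColour_colourAt F (T := T.unop) x e)
    fun n c d h => liftGen_restr F (T := T.unop) x h.down

/-- Colours are detected on `η`, and every operation of `Ho(X)` is the class of a dendrex of a
corolla, hence a value of `hoUnit`. -/
lemma hoOperad_hom_ext (hS : IsHoStr X S) {A B : hoOperad X S ⟶ P}
    (h : hoUnit hS ≫ dendroidalNerve.map A = hoUnit hS ≫ dendroidalNerve.map B) : A = B := by
  have h' : ∀ {T : DTree} (x : X.obj (op T)),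
      OperadHom.comp (hoHom hS x) A = OperadHom.comp (hoHom hS x) B := fun {T} x =>
    congrArg (fun G => G.app (op T) x) h
  have hc : ∀ x : Vertices X, OperadHom.colour A x = OperadHom.colour B x := fun x => by
    have := congrArg (fun G => OperadHom.colour G ()) (h' (T := eta) x)
    change OperadHom.colour A (colourAt x ()) = OperadHom.colour B (colourAt x ()) at this
    rwa [colourAt_eta] at this
  refine OperadHom.ext_of_heq hc fun n c d f => ?_
  obtain ⟨f, rfl⟩ := hoMk_surjective f
  obtain ⟨f, hf, rfl⟩ := f
  obtain rfl : (fun j => input f j) = c := funext hf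
  have h1 := op_heq_of_eq (h' f) ⟨isOp_corolla n⟩
  have h2 : restr f (isOp_corolla n) = ⟨f, hf, rfl⟩ := Subtype.ext (pull_ofOp_isOp_corolla f)
  change OperadHom.op A (hoMk (restr f (isOp_corolla n))) ≍
    OperadHom.op B (hoMk (restr f (isOp_corolla n))) at h1
  rw [h2] at h1
  exact h1

/-- `hoUnit` and the unit of the adjunction are both universal among maps from `X` to nerves. The
inverse is the factorisation of the adjunction unit through `Ho(X)`. -/
lemma isIso_naturalMap (hX : IsInnerKan X) (hS : IsHoStr X S) :
    IsIso (naturalMap S (hoUnit hS)) := by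
  have h1 : tauAdj.unit.app X ≫ dendroidalNerve.map (naturalMap S (hoUnit hS)) = hoUnit hS := by
    exact ((tauAdj.homEquiv_unit (f := naturalMap S (hoUnit hS))).symm.trans
      (Equiv.apply_symm_apply (tauAdj.homEquiv X (hoOperad X S)) (hoUnit hS)) : _)
  have h2 := hoUnit_comp_hoLift hX hS (tauAdj.unit.app X)
  refine ⟨hoLift hX hS (tauAdj.unit.app X), ?_, ?_⟩
  · apply (tauAdj.homEquiv X (tau.obj X)).injective
    rw [Adjunction.homEquiv_unit, Adjunction.homEquiv_unit, CategoryTheory.Functor.map_comp, ← Category.assoc, h1]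
    refine h2.trans ?_
    rw [CategoryTheory.Functor.map_id]
    exact (Category.comp_id _).symm
  · apply hoOperad_hom_ext hS
    rw [CategoryTheory.Functor.map_comp, ← Category.assoc, h2]
    refine h1.trans ?_
    rw [CategoryTheory.Functor.map_id, Category.comp_id]

end

end Dendroidal

open CategoryTheory Dendroidal
theorem proposition6p10 (X : DSet.{u}) (hX : IsInnerKan X) :
    ∃ S : OperadStr (Vertices X) (HoOp X),
      IsHoStr X S ∧
      (∀ S' : OperadStr (Vertices X) (HoOp X), (∃ q', ExtendsQuotient X S' q') → S' = S) ∧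
      ∃ q : X ⟶ dendroidalNerve.obj (hoOperad X S),
        ExtendsQuotient X S q ∧ (∀ q', ExtendsQuotient X S q' → q' = q) ∧
        IsIso (naturalMap S q) := by
  have hS := isHoStr_hoStr hX
  refine ⟨hoStr hX, hS, fun S' ⟨q', hq'⟩ => hq'.isHoStr.unique hX hS, hoUnit hS,
    extendsQuotient_hoUnit hS, fun q' hq' => hq'.unique (extendsQuotient_hoUnit hS),
    isIso_naturalMap hX hS⟩
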